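/- Let $k$ be an algebraically closed field, $N\cong\mathbb Z^d$ a lattice with dual lattice $M=\operatorname{Hom}(N,\mathbb Z)$, and let $\Delta$ be a (finite, nonempty) fan of strongly convex rational polyhedral cones in $N_{\mathbb R}=N\otimes\mathbb R$ which is not contained in a proper linear subspace of $N_{\mathbb R}$. Let $X=X_\Delta$ be the associated toric variety over $k$, glued from the affine charts $U_\sigma=\operatorname{Spec}k[\sigma^\vee\cap M]$, $\sigma\in\Delta$. For a ray $\rho\in\Delta(1)$ let $n_\rho$ be its primitive generator and $D_\rho\subset X$ the corresponding $T$-invariant prime divisor; $\sigma(1)$ denotes the set of rays of $\sigma$. Let $\mathrm{SF}(N,\Delta)$ be the group of $\Delta$-linear support functions, i.e. of functions $h:|\Delta|\to\mathbb R$ such that for every $\sigma\in\Delta$ there is $m_\sigma\in M$ with $h|_\sigma=m_\sigma|_\sigma$. The $T$-invariant Cartier divisors of $X$ are the divisors $D_h$, $h\in \mathrm{SF}(N,\Delta)$, where $D_h$ has the local equation $\chi(m_\sigma)$ on $U_\sigma$. Assume that 1. $X$ has enough invariant Cartier divisors: for every $\sigma\in\Delta$ there is an effective $T$-invariant Cartier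 divisor on $X$ whose support is exactly $\bigcup_{\rho\in\Delta(1)\setminus\sigma(1)}D_\rho$; 2. $\operatorname{Pic}(X)$ is a free abelian group. Let $C$ be the cone in the dual space of $\mathrm{SF}(N,\Delta)_{\mathbb R}$ which is dual to the cone $\bigcap_{\rho\in\Delta(1)}\{h\mid h(n_\rho)\ge 0\}$, and let $S=k[C^\vee\cap \mathrm{SF}(N,\Delta)]$ be the coordinate ring of the affine toric variety $U_C$, graded by $\operatorname{Pic}(X)$ so that the character $\chi(h)$ has degree $[D_h]$. For $\sigma\in\Delta$ let $\hat\sigma\subset C$ be the cone generated by the linear forms $h\mapsto h(n_\rho)$, $\rho\in\sigma(1)$, let $B_\sigma\subset S$ be the vanishing ideal of $U_C\setminus U_{\hat\sigma}$, and let $B=\sum_{\sigma\in\Delta}B_\sigma$ be the irrelevant ideal. Let $\operatorname{Tproj}(S)$ be the ringed space whose points are the homogeneous prime ideals of $S$ not containing $B$, with the topology induced from $\operatorname{Spec}S$, and whose structure sheaf consists of the functions assigning to each point $\mathfrak p$ an element of $S_{(\mathfrak p)}$ (the ring of fractions $f/g$ with $f,g\in S$ homogeneous of the same degree, $g\notin\mathfrak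 p$) which are locally given by one such fraction $f/g$. Then the ringed space $\operatorname{Tproj}(S)$ is a scheme, and it is isomorphic over $k$ to the toric variety $X$. -/

import Mathlib

open CategoryTheory AlgebraicGeometry TopologicalSpace Opposite
open scoped TensorProduct

universe u

noncomputable section

namespace Toric

/-- The real vector space `L_ℝ = ℝ ⊗ L` of a lattice `L`. -/
abbrev RealSpace (L : Type u) [AddCommGroup L] : Type u := ℝ ⊗[ℤ] L

/-- A lattice element seen in `L_ℝ`. -/
def latticePt {L : Type u} [AddCommGroup L] (n : L) : RealSpace L := (1 : ℝ) ⊗ₜ[ℤ] n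

/-- The `ℝ`-linear extension to `L_ℝ` of an additive function `L → ℝ`. -/
def realExtend {L : Type u} [AddCommGroup L] : (L →+ ℝ) →+ Module.Dual ℝ (RealSpace L) where
  toFun f := LinearMap.liftBaseChange ℝ f.toIntLinearMap
  map_zero' := by ext; simp
  map_add' f g := by ext; simp

@[simp] lemma realExtend_latticePt {L : Type u} [AddCommGroup L] (f : L →+ ℝ) (n : L) :
    realExtend f (latticePt n) = f n := by
  simp [realExtend, latticePt]

/-- The dual lattice `M = Hom(N, ℤ)`. -/
abbrev DualLattice (N : Type u) [AddCommGroup N] : Type u := Module.Dual ℤ N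

/-- The pairing of `M` with `N_ℝ`: the real extension of `m : N → ℤ`. -/
def charPairing (N : Type u) [AddCommGroup N] :
    DualLattice N →+ Module.Dual ℝ (RealSpace N) where
  toFun m := realExtend ((Int.castAddHom ℝ).comp m.toAddMonoidHom)
  map_zero' := by
    rw [← realExtend.map_zero]; congr 1; ext; simp
  map_add' a b := by
    rw [← realExtend.map_add]; congr 1; ext; simp

@[simp] lemma charPairing_latticePt {N : Type u} [AddCommGroup N] (m : DualLattice N) (n : N) :
    charPairing N m (latticePt n) = (m n : ℝ) := by
  simp [charPairing]

/-- For a lattice `L` paired with a real vector space `V` and a cone `σ` in `V`, the semigroup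
of the `l ∈ L` which are nonnegative on `σ`, i.e. `σ^∨ ∩ L`. -/
def dualMonoid {L : Type u} [AddCommGroup L] {V : Type u} [AddCommGroup V] [Module ℝ V]
    (p : L →+ Module.Dual ℝ V) (σ : PointedCone ℝ V) : AddSubmonoid L where
  carrier := {l | ∀ v ∈ σ, 0 ≤ p l v}
  zero_mem' := by simp
  add_mem' {a b} ha hb v hv := by simpa using add_nonneg (ha v hv) (hb v hv)

section SemigroupRing

variable (k : Type u) [Field k] {L : Type u} [AddCommGroup L]

/-- The semigroup ring `k[A]` of a semigroup `A` in a lattice. -/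
abbrev SemigroupRing (A : AddSubmonoid L) : Type u := AddMonoidAlgebra k A

/-- The character `χ(a) ∈ k[A]`. -/
def chi {A : AddSubmonoid L} (a : A) : SemigroupRing k A := AddMonoidAlgebra.single a 1

/-- The inclusion `k[A] ⊆ k[B]` for `A ⊆ B`. -/
def ringIncl {A B : AddSubmonoid L} (h : A ≤ B) : SemigroupRing k A →+* SemigroupRing k B :=
  AddMonoidAlgebra.mapDomainRingHom k (AddSubmonoid.inclusion h)

@[simp] lemma ringIncl_chi {A B : AddSubmonoid L} (h : A ≤ B) (a : A) :
    ringIncl k h (chi k a) = chi k (AddSubmonoid.inclusion h a) := by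
  simp [ringIncl, chi]

@[simp] lemma ringIncl_single {A B : AddSubmonoid L} (h : A ≤ B) (a : A) (c : k) :
    ringIncl k h (AddMonoidAlgebra.single a c) =
      AddMonoidAlgebra.single (AddSubmonoid.inclusion h a) c := by
  simp [ringIncl]

lemma chi_add {A : AddSubmonoid L} (a b : A) : chi k (a + b) = chi k a * chi k b := by
  simp [chi, AddMonoidAlgebra.single_mul_single]

lemma chi_zero {A : AddSubmonoid L} : chi k (0 : A) = 1 := rfl

lemma chi_nsmul {A : AddSubmonoid L} (n : ℕ) (a : A) : chi k (n • a) = chi k a ^ n := by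
  induction n with
  | zero => simp [chi_zero]
  | succ n ih => rw [succ_nsmul, chi_add, ih, pow_succ]

lemma ringIncl_injective {A B : AddSubmonoid L} (h : A ≤ B) :
    Function.Injective (ringIncl k h) :=
  AddMonoidAlgebra.mapDomain_injective (AddSubmonoid.inclusion_injective h)

/-- `k[B]` is the localization of `k[A]` at `χ(u)` if `B = A + ℤ u`. -/
lemma isLocalization_ringIncl {A B : AddSubmonoid L} (h : A ≤ B) (u : A)
    (hu : -(u : L) ∈ B) (hB : ∀ b ∈ B, ∃ n : ℕ, b + n • (u : L) ∈ A) :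
    let _ : Algebra (SemigroupRing k A) (SemigroupRing k B) := (ringIncl k h).toAlgebra
    IsLocalization.Away (chi k u) (SemigroupRing k B) := by
  let _ : Algebra (SemigroupRing k A) (SemigroupRing k B) := (ringIncl k h).toAlgebra
  have hunit : chi k (AddSubmonoid.inclusion h u) * chi k (⟨-(u : L), hu⟩ : B) = 1 := by
    rw [← chi_add, ← chi_zero]; congr 1; ext; simp
  refine IsLocalization.Away.mk (chi k u) ?_ ?_ ?_
  · change IsUnit (ringIncl k h _)
    rw [ringIncl_chi]
    exact IsUnit.of_mul_eq_one _ hunit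
  · intro s
    change ∃ n a, s * ringIncl k h _ ^ n = ringIncl k h a
    rw [ringIncl_chi]
    induction s using AddMonoidAlgebra.induction_linear with
    | zero => exact ⟨0, 0, by simp⟩
    | add f g hf hg =>
      obtain ⟨n, a, ha⟩ := hf
      obtain ⟨m, b, hb⟩ := hg
      refine ⟨n + m, a * chi k u ^ m + b * chi k u ^ n, ?_⟩
      simp only [map_add, map_mul, map_pow, ringIncl_chi, ← ha, ← hb]
      ring
    | single b c =>
      obtain ⟨n, hn⟩ := hB b b.2
      refine ⟨n, AddMonoidAlgebra.single ⟨_, hn⟩ c, ?_⟩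
      rw [← chi_nsmul, ringIncl_single, chi, AddMonoidAlgebra.single_mul_single, mul_one]
      congr 1
  · intro a b hab
    exact ⟨0, by simpa using ringIncl_injective k h hab⟩

lemma ringIncl_refl (A : AddSubmonoid L) : ringIncl k (le_refl A) = RingHom.id _ :=
  AddMonoidAlgebra.ringHom_ext (fun c => by simp) (fun a => by simp; rfl)

lemma ringIncl_comp {A B C : AddSubmonoid L} (h : A ≤ B) (h' : B ≤ C) :
    (ringIncl k h').comp (ringIncl k h) = ringIncl k (h.trans h') :=
  AddMonoidAlgebra.ringHom_ext (fun c => by simp) (fun a => by simp; rfl)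

end SemigroupRing

lemma uniqueSums_submonoid {N : Type u} [AddCommGroup N] (A : AddSubmonoid (DualLattice N)) :
    UniqueSums A :=
  UniqueSums.of_injective_addHom
    (f := ({ toFun := fun a n => a.1 n, map_add' := fun _ _ => rfl } : A →ₙ+ (N → ℤ)))
    (fun _ _ h => Subtype.ext (LinearMap.ext fun n => congrFun h n)) inferInstance

instance {N : Type u} [AddCommGroup N] (k : Type u) [Field k]
    (A : AddSubmonoid (DualLattice N)) : IsDomain (SemigroupRing k A) :=
  have := uniqueSums_submonoid A
  NoZeroDivisors.to_isDomain _

/-! ### Fans -/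

section Fans

variable {N : Type u} [AddCommGroup N]

/-- `τ` is a face of the rational cone `σ`: the intersection of `σ` with the hyperplane orthogonal
to some `m ∈ σ^∨ ∩ M`. (For a rational polyhedral cone every supporting hyperplane can be replaced
by a rational one cutting out the same face.) -/
def IsFace (τ σ : PointedCone ℝ (RealSpace N)) : Prop :=
  ∃ m ∈ dualMonoid (charPairing N) σ, ∀ v, v ∈ τ ↔ v ∈ σ ∧ charPairing N m v = 0

variable (N) in
/-- A fan in `N_ℝ`: a nonempty finite set of strongly convex rational polyhedral cones, closed under
taking faces, in which two cones always meet in a common face. As the zero cone is a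
face of every strongly convex cone, being nonempty amounts to containing the zero cone. -/
structure Fan where
  cones : Set (PointedCone ℝ (RealSpace N))
  finite : cones.Finite
  zero_mem : ⊥ ∈ cones
  rational : ∀ σ ∈ cones, ∃ s : Finset N, σ = PointedCone.hull ℝ (latticePt '' (s : Set N))
  stronglyConvex : ∀ σ ∈ cones, ∀ v ∈ σ, -v ∈ σ → v = 0
  face_mem : ∀ σ ∈ cones, ∀ τ, IsFace τ σ → τ ∈ cones
  inter_isFace : ∀ σ ∈ cones, ∀ τ ∈ cones, IsFace (σ ⊓ τ) σ ∧ IsFace (σ ⊓ τ) τ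

lemma dualMonoid_anti {L : Type u} [AddCommGroup L] {V : Type u} [AddCommGroup V] [Module ℝ V]
    (p : L →+ Module.Dual ℝ V) {τ σ : PointedCone ℝ V} (h : τ ≤ σ) :
    dualMonoid p σ ≤ dualMonoid p τ := fun _ hl v hv => hl v (h hv)

lemma hull_induction_nonneg {s : Set (RealSpace N)} (f : Module.Dual ℝ (RealSpace N))
    (h : ∀ v ∈ s, 0 ≤ f v) : ∀ v ∈ PointedCone.hull ℝ s, 0 ≤ f v := by
  intro v hv
  induction hv using Submodule.span_induction with
  | mem v hv => exact h v hv
  | zero => simp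
  | add x y _ _ hx hy => simpa using add_nonneg hx hy
  | smul c x _ hx =>
    have : f (c • x) = (c : ℝ) * f x := by
      rw [show c • x = (c : ℝ) • x from rfl, map_smul, smul_eq_mul]
    rw [this]; exact mul_nonneg c.2 hx

/-- If the face `τ` of `σ` is cut out by `u`, then `τ^∨ ∩ M = σ^∨ ∩ M + ℕ (-u)`. -/
lemma exists_add_nsmul_mem {τ σ : PointedCone ℝ (RealSpace N)}
    (hσ : ∃ s : Finset N, σ = PointedCone.hull ℝ (latticePt '' (s : Set N)))
    {u : DualLattice N} (hu : u ∈ dualMonoid (charPairing N) σ)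
    (hτ : ∀ v, v ∈ τ ↔ v ∈ σ ∧ charPairing N u v = 0)
    {m : DualLattice N} (hm : m ∈ dualMonoid (charPairing N) τ) :
    ∃ n : ℕ, m + n • u ∈ dualMonoid (charPairing N) σ := by
  obtain ⟨s, rfl⟩ := hσ
  have hs : ∀ x ∈ s, latticePt x ∈ PointedCone.hull ℝ (latticePt '' (s : Set N)) :=
    fun x hx => Submodule.subset_span ⟨x, hx, rfl⟩
  have hux : ∀ x ∈ s, 0 ≤ u x := fun x hx => by simpa using hu _ (hs x hx)
  refine ⟨∑ x ∈ s, (m x).natAbs, hull_induction_nonneg _ ?_⟩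
  rintro _ ⟨x, hx, rfl⟩
  rw [charPairing_latticePt]
  have hle : (m x).natAbs ≤ ∑ x ∈ s, (m x).natAbs :=
    Finset.single_le_sum (f := fun x => (m x).natAbs) (fun _ _ => Nat.zero_le _) hx
  generalize ∑ x ∈ s, (m x).natAbs = n at hle
  simp only [LinearMap.add_apply, LinearMap.smul_apply]
  rcases (hux x hx).eq_or_lt with h0 | h0
  · have := hm (latticePt x) ((hτ _).2 ⟨hs x hx, by simp [← h0]⟩)
    rw [charPairing_latticePt] at this
    simpa [← h0] using this
  · have : 0 ≤ m x + n • u x := by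
      have h1 : (n : ℤ) ≤ n * u x := by nlinarith
      rw [nsmul_eq_mul]
      have : ((m x).natAbs : ℤ) ≤ n := by exact_mod_cast hle
      have := neg_abs_le (m x)
      rw [Int.natCast_natAbs] at *
      linarith
    exact_mod_cast this

lemma IsFace.le {τ σ : PointedCone ℝ (RealSpace N)} (h : IsFace τ σ) : τ ≤ σ := by
  obtain ⟨u, _, hτ⟩ := h
  exact fun v hv => ((hτ v).1 hv).1

lemma neg_mem_of_face {τ σ : PointedCone ℝ (RealSpace N)} {u : DualLattice N}
    (hτ : ∀ v, v ∈ τ ↔ v ∈ σ ∧ charPairing N u v = 0) :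
    -u ∈ dualMonoid (charPairing N) τ := fun v hv => by
  simp [((hτ v).1 hv).2]

lemma Fan.isFace_of_le (Δ : Fan N) {τ σ : PointedCone ℝ (RealSpace N)} (hτ : τ ∈ Δ.cones)
    (hσ : σ ∈ Δ.cones) (h : τ ≤ σ) : IsFace τ σ := by
  have := (Δ.inter_isFace σ hσ τ hτ).1
  rwa [inf_eq_right.2 h] at this

lemma Fan.inf_mem (Δ : Fan N) {τ σ : PointedCone ℝ (RealSpace N)} (hτ : τ ∈ Δ.cones)
    (hσ : σ ∈ Δ.cones) : τ ⊓ σ ∈ Δ.cones :=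
  Δ.face_mem τ hτ _ (Δ.inter_isFace τ hτ σ hσ).1

end Fans

/-! ### The toric variety of a fan -/

section ToricVariety

variable {N : Type u} [AddCommGroup N] (k : Type u) [Field k] (Δ : Fan N)

/-- The semigroup `σ_M = σ^∨ ∩ M`. -/
abbrev coneMonoid (σ : PointedCone ℝ (RealSpace N)) : AddSubmonoid (DualLattice N) :=
  dualMonoid (charPairing N) σ

/-- The affine toric variety `U_σ = Spec k[σ_M]`. -/
abbrev affineChart (σ : PointedCone ℝ (RealSpace N)) : Scheme.{u} :=
  Spec (CommRingCat.of (SemigroupRing k (coneMonoid σ)))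

/-- The morphism `U_τ → U_σ` for `τ ⊆ σ`. -/
def chartIncl {τ σ : PointedCone ℝ (RealSpace N)} (h : τ ≤ σ) :
    affineChart k τ ⟶ affineChart k σ :=
  Spec.map (CommRingCat.ofHom (ringIncl k (dualMonoid_anti (charPairing N) h)))

/-- The affine toric varieties `U_σ` for `σ ∈ Δ`, with the inclusions `U_τ ⊆ U_σ`
for `τ` a face of `σ`. -/
def chartFunctor : Δ.cones ⥤ Scheme.{u} where
  obj σ := affineChart k σ.1
  map f := chartIncl k (leOfHom f)
  map_id σ := by
    rw [← Spec.map_id]; unfold chartIncl; congr 1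
    exact CommRingCat.hom_ext (ringIncl_refl k _)
  map_comp f g := by
    unfold chartIncl; rw [← Spec.map_comp]; congr 1
    exact CommRingCat.hom_ext (ringIncl_comp k _ _).symm

lemma isLocalization_of_face {τ σ : PointedCone ℝ (RealSpace N)}
    (hσ : ∃ s : Finset N, σ = PointedCone.hull ℝ (latticePt '' (s : Set N)))
    (hle : τ ≤ σ) {u : DualLattice N} (hu : u ∈ coneMonoid σ)
    (hτ : ∀ v, v ∈ τ ↔ v ∈ σ ∧ charPairing N u v = 0) :
    let _ : Algebra (SemigroupRing k (coneMonoid σ)) (SemigroupRing k (coneMonoid τ)) :=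
      (ringIncl k (dualMonoid_anti (charPairing N) hle)).toAlgebra
    IsLocalization.Away (chi k ⟨u, hu⟩) (SemigroupRing k (coneMonoid τ)) :=
  isLocalization_ringIncl k (dualMonoid_anti (charPairing N) hle) ⟨u, hu⟩ (neg_mem_of_face hτ)
    fun _ hb => exists_add_nsmul_mem hσ hu hτ hb

instance chartFunctor_isOpenImmersion {τ σ : Δ.cones} (f : τ ⟶ σ) :
    IsOpenImmersion ((chartFunctor k Δ).map f) := by
  obtain ⟨u, hu, hτ⟩ := Δ.isFace_of_le τ.2 σ.2 (leOfHom f)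
  let _ : Algebra (SemigroupRing k (coneMonoid σ.1)) (SemigroupRing k (coneMonoid τ.1)) :=
    (ringIncl k (dualMonoid_anti (charPairing N) (leOfHom f))).toAlgebra
  have := isLocalization_of_face k (Δ.rational σ σ.2) (leOfHom f) hu hτ
  exact IsOpenImmersion.of_isLocalization (chi k ⟨u, hu⟩)

lemma range_chartFunctor_map {τ σ : Δ.cones} (f : τ ⟶ σ) {u : DualLattice N}
    (hu : u ∈ coneMonoid σ.1) (hτ : ∀ v, v ∈ τ.1 ↔ v ∈ σ.1 ∧ charPairing N u v = 0) :
    Set.range ((chartFunctor k Δ).map f) = 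
      ((PrimeSpectrum.basicOpen (chi k ⟨u, hu⟩) : Opens (PrimeSpectrum _)) :
        Set (PrimeSpectrum (SemigroupRing k (coneMonoid σ.1)))) := by
  let _ : Algebra (SemigroupRing k (coneMonoid σ.1)) (SemigroupRing k (coneMonoid τ.1)) :=
    (ringIncl k (dualMonoid_anti (charPairing N) (leOfHom f))).toAlgebra
  have := isLocalization_of_face k (Δ.rational σ σ.2) (leOfHom f) hu hτ
  exact PrimeSpectrum.localization_away_comap_range _ (chi k ⟨u, hu⟩)

instance chartFunctor_isLocallyDirected :
    (chartFunctor k Δ ⋙ Scheme.forget).IsLocallyDirected where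
  cond {τ τ' σ} f g x y hxy := by
    obtain ⟨u, hu, hτ⟩ := Δ.isFace_of_le τ.2 σ.2 (leOfHom f)
    obtain ⟨w, hw, hτ'⟩ := Δ.isFace_of_le τ'.2 σ.2 (leOfHom g)
    let ρ : Δ.cones := ⟨τ.1 ⊓ τ'.1, Δ.inf_mem τ.2 τ'.2⟩
    let a : ρ ⟶ τ := homOfLE (show τ.1 ⊓ τ'.1 ≤ τ.1 from inf_le_left)
    let b : ρ ⟶ τ' := homOfLE (show τ.1 ⊓ τ'.1 ≤ τ'.1 from inf_le_right)
    have hρ : ∀ v, v ∈ ρ.1 ↔ v ∈ σ.1 ∧ charPairing N (u + w) v = 0 := by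
      intro v
      change v ∈ τ.1 ∧ v ∈ τ'.1 ↔ _
      rw [hτ, hτ']
      constructor
      · rintro ⟨⟨h1, h2⟩, -, h3⟩
        exact ⟨h1, by simp [h2, h3]⟩
      · rintro ⟨h1, h2⟩
        have h3 := hu v h1
        have h4 := hw v h1
        rw [map_add, LinearMap.add_apply] at h2
        exact ⟨⟨h1, by linarith⟩, h1, by linarith⟩
    have hx : (chartFunctor k Δ).map f x ∈ Set.range ((chartFunctor k Δ).map f) := ⟨x, rfl⟩
    have hy : (chartFunctor k Δ).map g y ∈ Set.range ((chartFunctor k Δ).map g) := ⟨y, rfl⟩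
    have hxy' : (chartFunctor k Δ).map f x = (chartFunctor k Δ).map g y := hxy
    have hz : (chartFunctor k Δ).map f x ∈ Set.range ((chartFunctor k Δ).map (a ≫ f)) := by
      rw [range_chartFunctor_map k Δ (a ≫ f) (add_mem hu hw) hρ]
      rw [← hxy', range_chartFunctor_map k Δ g hw hτ'] at hy
      rw [range_chartFunctor_map k Δ f hu hτ] at hx
      have : chi k (⟨u + w, add_mem hu hw⟩ : coneMonoid σ.1) =
        chi k ⟨u, hu⟩ * chi k ⟨w, hw⟩ := chi_add k ⟨u, hu⟩ ⟨w, hw⟩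
      rw [this, PrimeSpectrum.basicOpen_mul]
      exact ⟨hx, hy⟩
    obtain ⟨z, hz⟩ := hz
    refine ⟨ρ, a, b, z, ?_, ?_⟩
    · apply ((chartFunctor k Δ).map f).isOpenEmbedding.injective
      rw [← hz, Functor.map_comp]
      rfl
    · apply ((chartFunctor k Δ).map g).isOpenEmbedding.injective
      rw [← hxy', ← hz, show a ≫ f = b ≫ g from rfl, Functor.map_comp]
      rfl

/-- The toric variety `X_Δ`: the gluing of the `U_σ`, `σ ∈ Δ`, along the `U_τ` for common faces. -/
def toricVariety : Scheme.{u} := Limits.colimit (chartFunctor k Δ)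

/-- The open immersion `U_σ → X_Δ`. -/
def chartMap (σ : Δ.cones) : affineChart k σ.1 ⟶ toricVariety k Δ :=
  Limits.colimit.ι (chartFunctor k Δ) σ

instance (σ : Δ.cones) : IsOpenImmersion (chartMap k Δ σ) :=
  inferInstanceAs (IsOpenImmersion (Limits.colimit.ι (chartFunctor k Δ) σ))


lemma chart_w {τ σ : Δ.cones} (h : τ.1 ≤ σ.1) :
    chartIncl k h ≫ chartMap k Δ σ = chartMap k Δ τ :=
  Limits.colimit.w (chartFunctor k Δ) (homOfLE h : τ ⟶ σ)

instance {τ σ : Δ.cones} (h : τ.1 ≤ σ.1) : IsOpenImmersion (chartIncl k h) :=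
  chartFunctor_isOpenImmersion k Δ (homOfLE h : τ ⟶ σ)

lemma exists_chart (x : toricVariety k Δ) :
    ∃ σ : Δ.cones, x ∈ (chartMap k Δ σ).opensRange := by
  obtain ⟨σ, y, hy⟩ := Scheme.IsLocallyDirected.ι_jointly_surjective (chartFunctor k Δ) x
  exact ⟨σ, y, hy⟩

/-- Two charts containing `x` both contain a smaller chart around `x`. -/
lemma exists_chart_le {x : toricVariety k Δ} {σ τ : Δ.cones}
    (hσ : x ∈ (chartMap k Δ σ).opensRange) (hτ : x ∈ (chartMap k Δ τ).opensRange) :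
    ∃ ρ : Δ.cones, ρ.1 ≤ σ.1 ∧ ρ.1 ≤ τ.1 ∧ x ∈ (chartMap k Δ ρ).opensRange := by
  obtain ⟨y, rfl⟩ := hσ
  obtain ⟨z, hz⟩ := hτ
  obtain ⟨ρ, f, g, w, rfl, -⟩ :=
    (Scheme.IsLocallyDirected.ι_eq_ι_iff (chartFunctor k Δ)).1 hz.symm
  refine ⟨ρ, leOfHom f, leOfHom g, w, ?_⟩
  rw [← chart_w k Δ (leOfHom f)]
  rfl

/-- The zero cone of the fan; its chart is the torus `T = Spec k[M]`. -/
def zeroCone : Δ.cones := ⟨⊥, Δ.zero_mem⟩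

instance : IsIntegral (toricVariety k Δ) := by
  have : IsReduced (toricVariety k Δ) := by
    exact @IsReduced.of_openCover (toricVariety k Δ)
      (Scheme.IsLocallyDirected.openCover (chartFunctor k Δ))
      (fun σ => inferInstanceAs (AlgebraicGeometry.IsReduced (affineChart k σ.1)))
  have : IrreducibleSpace (toricVariety k Δ) := by
    have h0 : IsIrreducible (Set.range (chartMap k Δ (zeroCone Δ))) := by
      rw [← Set.image_univ]
      exact (IrreducibleSpace.isIrreducible_univ _).image _
        (chartMap k Δ (zeroCone Δ)).continuous.continuousOn
    have h1 : closure (Set.range (chartMap k Δ (zeroCone Δ))) = Set.univ := by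
      rw [Set.eq_univ_iff_forall]
      intro x
      obtain ⟨σ, y, rfl⟩ := exists_chart k Δ x
      have f : (zeroCone Δ).1 ≤ σ.1 := (bot_le : (⊥ : PointedCone ℝ (RealSpace N)) ≤ σ.1)
      have h2 : y ∈ closure (Set.range (chartIncl k f)) :=
        have : IsOpenImmersion (chartIncl k f) := inferInstance
        (chartIncl k f).isOpenEmbedding.isOpen_range.dense
          (Set.range_nonempty _) y
      have h3 := image_closure_subset_closure_image (chartMap k Δ σ).continuous
        (Set.mem_image_of_mem _ h2)
      rw [← Set.range_comp] at h3
      rw [← chart_w k Δ f]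
      simpa using h3
    have := h0.closure
    rw [h1] at this
    have : PreirreducibleSpace (toricVariety k Δ) := ⟨this.2⟩
    exact ⟨⟨h0.1.some⟩⟩
  exact isIntegral_of_irreducibleSpace_of_isReduced _


/-- The structure morphism `X_Δ → Spec k`. -/
def toricStructure : toricVariety k Δ ⟶ Spec (CommRingCat.of k) :=
  Limits.colimit.desc (chartFunctor k Δ)
    { pt := Spec (CommRingCat.of k)
      ι :=
        { app := fun σ => Spec.map (CommRingCat.ofHom
            (algebraMap k (SemigroupRing k (coneMonoid σ.1))))
          naturality := fun τ σ f => by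
            refine ((Spec.map_comp _ _).symm.trans (congrArg Spec.map ?_)).trans
              (Category.comp_id _).symm
            exact CommRingCat.hom_ext (RingHom.ext fun c => ringIncl_single k _ 0 c) } }

end ToricVariety

/-! ### Cartier divisors and the Picard group of an integral scheme -/

section Cartier

variable (X : Scheme.{u}) [IsIntegral X]

/-- `O_{X,x}^×` as a subgroup of `K^×`, where `K` is the function field. -/
def stalkUnits (x : X) : Subgroup (X.functionField)ˣ :=
  (Units.map (algebraMap (X.presheaf.stalk x) X.functionField).toMonoidHom).range

/-- The group of Cartier divisors on an integral scheme `X`, i.e. of the global sections of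
`K^× / O_X^×`: families of classes in `K^× / O_{X,x}^×`, `x ∈ X`, locally given by one
rational function (a local equation). The group is written multiplicatively. -/
def CartierDivisor : Subgroup (∀ x : X, (X.functionField)ˣ ⧸ stalkUnits X x) where
  carrier := {D | ∀ x, ∃ U : X.Opens, x ∈ U ∧ ∃ f : (X.functionField)ˣ, ∀ y ∈ U, D y = f}
  one_mem' x := ⟨⊤, trivial, 1, fun _ _ => rfl⟩
  mul_mem' {D E} hD hE x := by
    obtain ⟨U, hU, f, hf⟩ := hD x
    obtain ⟨V, hV, g, hg⟩ := hE x
    exact ⟨U ⊓ V, ⟨hU, hV⟩, f * g, fun y hy => by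
      rw [Pi.mul_apply, hf y hy.1, hg y hy.2]; rfl⟩
  inv_mem' {D} hD x := by
    obtain ⟨U, hU, f, hf⟩ := hD x
    exact ⟨U, hU, f⁻¹, fun y hy => by rw [Pi.inv_apply, hf y hy]; rfl⟩

instance : CommGroup (CartierDivisor X) :=
  { (inferInstance : Group (CartierDivisor X)) with
    mul_comm := fun a b => Subtype.ext (funext fun x => by
      change a.1 x * b.1 x = b.1 x * a.1 x
      obtain ⟨f, hf⟩ := QuotientGroup.mk_surjective (a.1 x)
      obtain ⟨g, hg⟩ := QuotientGroup.mk_surjective (b.1 x)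
      rw [← hf, ← hg, ← QuotientGroup.mk_mul, ← QuotientGroup.mk_mul, mul_comm]) }

/-- The principal Cartier divisor of a nonzero rational function. -/
def principalDivisor : (X.functionField)ˣ →* CartierDivisor X where
  toFun f := ⟨fun _ => f, fun _ => ⟨⊤, trivial, f, fun _ _ => rfl⟩⟩
  map_one' := rfl
  map_mul' _ _ := rfl

/-- The Picard group of an integral scheme, as the group of Cartier divisors modulo the principal
ones (on an integral scheme `D ↦ O(D)` identifies this quotient with the group of isomorphism
classes of invertible sheaves). Written additively. -/
abbrev Pic : Type u := Additive (CartierDivisor X ⧸ (principalDivisor X).range)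

variable {X}

/-- A Cartier divisor is effective if its local equations are regular. -/
def IsEffective (D : CartierDivisor X) : Prop :=
  ∀ x : X, ∃ f : (X.functionField)ˣ, D.1 x = f ∧
    (f : X.functionField) ∈ (algebraMap (X.presheaf.stalk x) X.functionField).range

/-- The support of a Cartier divisor: the points where the local equation is not a unit of the
local ring. -/
def divisorSupport (D : CartierDivisor X) : Set X := {x | D.1 x ≠ 1}

end Cartier

/-! ### Support functions and invariant Cartier divisors -/

section SupportFunctions

variable {N : Type u} [AddCommGroup N] (k : Type u) [Field k] (Δ : Fan N)

/-- The support `|Δ|` of a fan. -/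
def Fan.support : Set (RealSpace N) := {v | ∃ σ ∈ Δ.cones, v ∈ σ}

/-- The group `SF(N, Δ)` of `Δ`-linear support functions: functions on `|Δ|` which on every cone
of `Δ` agree with some `m ∈ M`. -/
def SupportFunction : AddSubgroup (Δ.support → ℝ) where
  carrier := {h | ∀ σ ∈ Δ.cones, ∃ m : DualLattice N,
    ∀ v : Δ.support, v.1 ∈ σ → h v = charPairing N m v}
  zero_mem' σ _ := ⟨0, by simp⟩
  add_mem' {f g} hf hg σ hσ := by
    obtain ⟨a, ha⟩ := hf σ hσ
    obtain ⟨b, hb⟩ := hg σ hσ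
    exact ⟨a + b, fun v hv => by simp [ha v hv, hb v hv]⟩
  neg_mem' {f} hf σ hσ := by
    obtain ⟨a, ha⟩ := hf σ hσ
    exact ⟨-a, fun v hv => by simp [ha v hv]⟩

variable {Δ} in
/-- `m ∈ M` is a linear function representing `h` on the cone `σ`. -/
def Represents (h : SupportFunction Δ) (σ : Δ.cones) (m : DualLattice N) : Prop :=
  ∀ v : Δ.support, v.1 ∈ σ.1 → h.1 v = charPairing N m v

variable {Δ} in
/-- A choice of `m_σ ∈ M` with `h = m_σ` on `σ`. -/
def localChar (h : SupportFunction Δ) (σ : Δ.cones) : DualLattice N := (h.2 σ.1 σ.2).choose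

variable {Δ} in
lemma represents_localChar (h : SupportFunction Δ) (σ : Δ.cones) :
    Represents h σ (localChar h σ) := (h.2 σ.1 σ.2).choose_spec

instance (σ : Δ.cones) : Nonempty (chartMap k Δ σ ''ᵁ ⊤) :=
  ⟨⟨chartMap k Δ σ (Nonempty.some inferInstance), _, trivial, rfl⟩⟩

/-- The regular functions `k[σ_M]` on the chart `U_σ`. -/
def chartSections (σ : Δ.cones) :
    CommRingCat.of (SemigroupRing k (coneMonoid σ.1)) ⟶
      Γ(toricVariety k Δ, chartMap k Δ σ ''ᵁ ⊤) :=
  (Scheme.ΓSpecIso _).inv ≫ ((chartMap k Δ σ).appIso ⊤).inv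

/-- The inclusion of `k[σ_M]` into the function field of `X_Δ`. -/
def chartToFunctionField (σ : Δ.cones) :
    SemigroupRing k (coneMonoid σ.1) →+* (toricVariety k Δ).functionField :=
  (chartSections k Δ σ ≫
    (toricVariety k Δ).germToFunctionField (chartMap k Δ σ ''ᵁ ⊤)).hom

lemma chartToFunctionField_mem (σ : Δ.cones) {x : toricVariety k Δ}
    (hx : x ∈ (chartMap k Δ σ).opensRange) (a : SemigroupRing k (coneMonoid σ.1)) :
    chartToFunctionField k Δ σ a ∈
      (algebraMap ((toricVariety k Δ).presheaf.stalk x)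
        (toricVariety k Δ).functionField).range := by
  have hx' : x ∈ chartMap k Δ σ ''ᵁ ⊤ := by
    obtain ⟨y, rfl⟩ := hx
    exact ⟨y, trivial, rfl⟩
  exact ⟨_, Scheme.algebraMap_germ_eq_germToFunctionField _ hx' (chartSections k Δ σ a)⟩

lemma chartToFunctionField_comp {τ σ : Δ.cones} (h : τ.1 ≤ σ.1) :
    (chartToFunctionField k Δ τ).comp (ringIncl k (dualMonoid_anti (charPairing N) h)) =
      chartToFunctionField k Δ σ := by
  have hle : chartMap k Δ τ ''ᵁ ⊤ ≤ chartMap k Δ σ ''ᵁ ⊤ := by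
    rintro _ ⟨y, -, rfl⟩
    rw [← chart_w k Δ h]
    exact ⟨_, trivial, rfl⟩
  have key : CommRingCat.ofHom (ringIncl k (dualMonoid_anti (charPairing N) h)) ≫
      chartSections k Δ τ =
      chartSections k Δ σ ≫ (toricVariety k Δ).presheaf.map (homOfLE hle).op := by
    have h1 : CommRingCat.ofHom (ringIncl k (dualMonoid_anti (charPairing N) h)) ≫
        (Scheme.ΓSpecIso _).inv = (Scheme.ΓSpecIso _).inv ≫ (chartIncl k h).appTop :=
      Scheme.ΓSpecIso_inv_naturality _
    have h2 : (chartIncl k h).appTop ≫ ((chartMap k Δ τ).appIso ⊤).inv =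
        ((chartMap k Δ σ).appIso ⊤).inv ≫
          (toricVariety k Δ).presheaf.map (homOfLE hle).op := by
      have e : (⊤ : (affineChart k τ.1).Opens) ≤ chartIncl k h ⁻¹ᵁ ⊤ := le_rfl
      have h3 : (chartIncl k h).appTop = (chartIncl k h).appLE ⊤ ⊤ e :=
        (Scheme.Hom.appLE_eq_app _).symm
      rw [Iso.eq_inv_comp, Scheme.Hom.appIso_hom', ← Category.assoc, h3,
        Scheme.Hom.appLE_comp_appLE]
      simp only [chart_w]
      exact Scheme.Hom.appLE_appIso_inv (chartMap k Δ τ) _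
    unfold chartSections
    rw [reassoc_of% h1, h2, Category.assoc]
  unfold chartToFunctionField
  rw [← CommRingCat.hom_ofHom (ringIncl k (dualMonoid_anti (charPairing N) h)),
    ← CommRingCat.hom_comp, ← Category.assoc, key, Category.assoc]
  congr 2
  exact TopCat.Presheaf.germ_res _ _ _ _

/-- The character `χ(m)`, `m ∈ M`, as a nonzero rational function on `X_Δ`. -/
def charUnit : Multiplicative (DualLattice N) →* ((toricVariety k Δ).functionField)ˣ :=
  have mem (m : DualLattice N) : m ∈ coneMonoid (zeroCone Δ).1 := fun v hv => by
    rw [(Submodule.mem_bot _).1 hv, map_zero]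
  MonoidHom.toHomUnits
    { toFun := fun m => chartToFunctionField k Δ (zeroCone Δ) (chi k ⟨m.toAdd, mem _⟩)
      map_one' := by
        rw [← map_one (chartToFunctionField k Δ (zeroCone Δ))]; rfl
      map_mul' := fun a b => by
        rw [← map_mul, ← chi_add]; rfl }

lemma charUnit_val (σ : Δ.cones) (m : DualLattice N) (hm : m ∈ coneMonoid σ.1) :
    (charUnit k Δ (.ofAdd m) : (toricVariety k Δ).functionField) =
      chartToFunctionField k Δ σ (chi k ⟨m, hm⟩) := by
  rw [← chartToFunctionField_comp k Δ
    (show (zeroCone Δ).1 ≤ σ.1 from (bot_le : (⊥ : PointedCone ℝ (RealSpace N)) ≤ σ.1)),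
    RingHom.comp_apply, ringIncl_chi]
  rfl

/-- A character which vanishes on `σ` is a unit on the chart `U_σ`. -/
lemma charUnit_mem_stalkUnits (σ : Δ.cones) {x : toricVariety k Δ}
    (hx : x ∈ (chartMap k Δ σ).opensRange) (m : DualLattice N)
    (hm : ∀ v ∈ σ.1, charPairing N m v = 0) :
    charUnit k Δ (.ofAdd m) ∈ stalkUnits (toricVariety k Δ) x := by
  have h1 : m ∈ coneMonoid σ.1 := fun v hv => (hm v hv).ge
  have h2 : -m ∈ coneMonoid σ.1 := fun v hv => by simp [hm v hv]
  obtain ⟨a, ha⟩ := chartToFunctionField_mem k Δ σ hx (chi k ⟨m, h1⟩)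
  obtain ⟨b, hb⟩ := chartToFunctionField_mem k Δ σ hx (chi k ⟨-m, h2⟩)
  rw [← charUnit_val] at ha hb
  have hinj : Function.Injective (algebraMap ((toricVariety k Δ).presheaf.stalk x)
    (toricVariety k Δ).functionField) :=
    IsFractionRing.injective _ _
  have hab : a * b = 1 := by
    apply hinj
    rw [map_mul, ha, hb, map_one, ← Units.val_mul, ← map_mul, ← ofAdd_add]
    simp
  refine ⟨⟨a, b, hab, by rw [mul_comm, hab]⟩, Units.ext ha⟩

variable {Δ} in
/-- The underlying family of classes of the Cartier divisor `D_h`. -/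
def divisorFun (h : SupportFunction Δ) (x : toricVariety k Δ) :
    ((toricVariety k Δ).functionField)ˣ ⧸ stalkUnits (toricVariety k Δ) x :=
  charUnit k Δ (.ofAdd (localChar h (exists_chart k Δ x).choose))

variable {Δ} in
/-- On the chart `U_σ` the divisor `D_h` has the local equation `χ(m)`, for any `m ∈ M`
representing `h` on `σ`. -/
lemma divisorFun_eq (h : SupportFunction Δ) (σ : Δ.cones) {x : toricVariety k Δ}
    (hx : x ∈ (chartMap k Δ σ).opensRange) (m : DualLattice N) (hm : Represents h σ m) :
    divisorFun k h x = charUnit k Δ (.ofAdd m) := by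
  obtain ⟨ρ, h1, h2, hρ⟩ := exists_chart_le k Δ (exists_chart k Δ x).choose_spec hx
  refine QuotientGroup.eq.2 ?_
  rw [← map_inv, ← map_mul, ← ofAdd_neg, ← ofAdd_add]
  refine charUnit_mem_stalkUnits k Δ ρ hρ _ fun v hv => ?_
  have h3 := represents_localChar h (exists_chart k Δ x).choose ⟨v, ρ.1, ρ.2, hv⟩ (h1 hv)
  have h4 := hm ⟨v, ρ.1, ρ.2, hv⟩ (h2 hv)
  rw [map_add, map_neg, LinearMap.add_apply, LinearMap.neg_apply, ← h3, ← h4]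
  simp

variable {Δ} in
/-- The `T`-invariant Cartier divisor `D_h` of a support function `h`: its local equation on the
chart `U_σ` is the character `χ(m_σ)`, where `m_σ ∈ M` represents `h` on `σ`. The map `h ↦ D_h`
identifies `SF(N, Δ)` with the group of `T`-invariant Cartier divisors. -/
def invariantDivisor : SupportFunction Δ →+ Additive (CartierDivisor (toricVariety k Δ)) where
  toFun h := .ofMul ⟨divisorFun k h, fun x => by
    obtain ⟨σ, hσ⟩ := exists_chart k Δ x
    exact ⟨(chartMap k Δ σ).opensRange, hσ, _,
      fun y hy => divisorFun_eq k h σ hy _ (represents_localChar h σ)⟩⟩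
  map_zero' := by
    apply Additive.toMul.injective
    refine Subtype.ext (funext fun x => ?_)
    obtain ⟨σ, hσ⟩ := exists_chart k Δ x
    refine (divisorFun_eq k 0 σ hσ 0 fun v _ => by simp).trans ?_
    rw [ofAdd_zero, map_one]; rfl
  map_add' f g := by
    apply Additive.toMul.injective
    refine Subtype.ext (funext fun x => ?_)
    obtain ⟨σ, hσ⟩ := exists_chart k Δ x
    have hf := represents_localChar f σ
    have hg := represents_localChar g σ
    refine (divisorFun_eq k (f + g) σ hσ (localChar f σ + localChar g σ)
      fun v hv => ?_).trans ?_
    · rw [map_add, LinearMap.add_apply, ← hf v hv, ← hg v hv]; rfl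
    · rw [ofAdd_add, map_mul]
      change _ = divisorFun k f x * divisorFun k g x
      rw [divisorFun_eq k f σ hσ _ hf, divisorFun_eq k g σ hσ _ hg]; rfl

end SupportFunctions

/-! ### Rays, prime divisors, and varieties with enough invariant Cartier divisors -/

section Rays

variable {N : Type u} [AddCommGroup N] (k : Type u) [Field k] (Δ : Fan N)

/-- A primitive lattice vector. -/
def IsPrimitive (n : N) : Prop := ∀ (a : ℤ) (n' : N), n = a • n' → IsUnit a

/-- The cone `ℝ≥0 · n`. -/
def rayCone (n : N) : PointedCone ℝ (RealSpace N) := PointedCone.hull ℝ {latticePt n}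

/-- The set `Δ(1)` of rays (one-dimensional cones) of `Δ`, each given by its primitive
generator `n(ρ)`. -/
def Fan.Ray : Type u := {n : N // IsPrimitive n ∧ rayCone n ∈ Δ.cones}

variable {Δ}

/-- The primitive generator `n(ρ)`. -/
def Fan.Ray.gen (ρ : Δ.Ray) : N := ρ.1

/-- The cone `ρ ∈ Δ`. -/
def Fan.Ray.cone (ρ : Δ.Ray) : Δ.cones := ⟨rayCone ρ.1, ρ.2.2⟩

/-- `n(ρ)` as a point of `|Δ|`. -/
def Fan.Ray.genPt (ρ : Δ.Ray) : Δ.support :=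
  ⟨latticePt ρ.gen, ρ.cone.1, ρ.cone.2, Submodule.subset_span rfl⟩

/-- `ρ ∈ σ(1)`. -/
def Fan.Ray.IsRayOf (ρ : Δ.Ray) (σ : Δ.cones) : Prop := ρ.cone.1 ≤ σ.1

/-- The irreducible `T`-invariant Weil divisor `D_ρ`: the closure in `X_Δ` of the closed
`T`-orbit of `U_ρ`, which is cut out by the characters in `ρ_M` not vanishing on `ρ`. -/
def primeDivisor (ρ : Δ.Ray) : Set (toricVariety k Δ) :=
  closure (chartMap k Δ ρ.cone ''
    {y | ∀ m : coneMonoid ρ.cone.1, m.1 ρ.gen ≠ 0 → chi k m ∈ PrimeSpectrum.asIdeal y})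

/-- A `T`-invariant Cartier divisor on `X_Δ`: one whose local equations on the charts `U_σ` are
characters of `T`, i.e. a divisor `D_h`. -/
def IsInvariantDivisor (D : CartierDivisor (toricVariety k Δ)) : Prop :=
  ∃ h : SupportFunction Δ, invariantDivisor k h = .ofMul D

variable (Δ) in
/-- `X_Δ` has enough invariant Cartier divisors: for every `σ ∈ Δ` there is an effective
`T`-invariant Cartier divisor whose support is the union of the `D_ρ` with
`ρ ∈ Δ(1) \ σ(1)`. -/
def HasEnoughInvariantCartierDivisors : Prop :=
  ∀ σ : Δ.cones, ∃ D : CartierDivisor (toricVariety k Δ),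
    IsInvariantDivisor k D ∧ IsEffective D ∧
      divisorSupport D = ⋃ ρ ∈ {ρ : Δ.Ray | ¬ ρ.IsRayOf σ}, primeDivisor k ρ

variable (Δ) in
/-- The fan is not contained in a proper linear subspace of `N_ℝ`. -/
def Fan.SpansSpace : Prop := Submodule.span ℝ Δ.support = ⊤

end Rays

/-! ### The cone `C`, the homogeneous coordinate ring `S` and the irrelevant ideal `B` -/

section CoordinateRing

variable {N : Type u} [AddCommGroup N] (k : Type u) [Field k] (Δ : Fan N)

/-- The real vector space `SF(N, Δ)_ℝ`. -/
abbrev SupportFunctionSpace : Type u := RealSpace (SupportFunction Δ)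

variable {Δ} in
/-- The linear form `h ↦ h(n(ρ))` on `SF(N, Δ)_ℝ`. -/
def rayForm (ρ : Δ.Ray) : Module.Dual ℝ (SupportFunctionSpace Δ) :=
  realExtend ((Pi.evalAddMonoidHom _ ρ.genPt).comp (SupportFunction Δ).subtype)

variable {Δ} in
/-- The half space `H_ρ = {h | h(n(ρ)) ≥ 0}` of `SF(N, Δ)_ℝ`. -/
def halfSpace (ρ : Δ.Ray) : PointedCone ℝ (SupportFunctionSpace Δ) :=
  PointedCone.dual LinearMap.id {rayForm ρ}

/-- The cone `C` in the dual space of `SF(N, Δ)_ℝ`, dual to the intersection of all the `H_ρ`. -/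
def coneC : PointedCone ℝ (Module.Dual ℝ (SupportFunctionSpace Δ)) :=
  PointedCone.dual (Module.Dual.eval ℝ (SupportFunctionSpace Δ))
    ((⨅ ρ : Δ.Ray, halfSpace ρ : PointedCone ℝ (SupportFunctionSpace Δ)) : Set _)

/-- The cone `σ̂` spanned by the rays `ℝ≥0 · l_ρ` for `ρ ∈ σ(1)`, where `ℝ≥0 · l_ρ` is the ray
orthogonal to `H_ρ`, i.e. generated by the linear form `h ↦ h(n(ρ))`. -/
def hatCone (σ : Δ.cones) : PointedCone ℝ (Module.Dual ℝ (SupportFunctionSpace Δ)) :=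
  PointedCone.hull ℝ (rayForm '' {ρ : Δ.Ray | ρ.IsRayOf σ})

/-- The pairing of `SF(N, Δ)`, the character lattice of the big torus, with the dual space of
`SF(N, Δ)_ℝ`. -/
def sfPairing : SupportFunction Δ →+
    Module.Dual ℝ (Module.Dual ℝ (SupportFunctionSpace Δ)) where
  toFun h := Module.Dual.eval ℝ _ (latticePt h)
  map_zero' := by simp [latticePt]
  map_add' a b := by simp [latticePt, TensorProduct.tmul_add]

lemma hatCone_le (σ : Δ.cones) : hatCone Δ σ ≤ coneC Δ := by
  refine Submodule.span_le.2 ?_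
  rintro _ ⟨ρ, -, rfl⟩ x hx
  exact (Submodule.mem_iInf _).1 hx ρ rfl

/-- The semigroup `C^∨ ∩ SF(N, Δ)`. -/
abbrev coxMonoid : AddSubmonoid (SupportFunction Δ) := dualMonoid (sfPairing Δ) (coneC Δ)

/-- The coordinate ring `S = k[C^∨ ∩ SF(N, Δ)]` of the affine toric variety `U_C`. -/
abbrev coxRing : Type u := SemigroupRing k (coxMonoid Δ)

/-- The open subset `U_σ̂` of `U_C = Spec S`. -/
def hatChart (σ : Δ.cones) : Set (PrimeSpectrum (coxRing k Δ)) :=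
  Set.range (PrimeSpectrum.comap (ringIncl k (dualMonoid_anti (sfPairing Δ) (hatCone_le Δ σ))))

/-- The ideal `B_σ` of the complement of `U_σ̂` in `U_C`. -/
def irrelevantPart (σ : Δ.cones) : Ideal (coxRing k Δ) :=
  PrimeSpectrum.vanishingIdeal (hatChart k Δ σ)ᶜ

/-- The irrelevant ideal `B = ∑ B_σ`. -/
def irrelevantIdeal : Ideal (coxRing k Δ) := ⨆ σ : Δ.cones, irrelevantPart k Δ σ

/-- The class in `Pic(X_Δ)` of the divisor `D_h`. -/
def picClass : SupportFunction Δ →+ Pic (toricVariety k Δ) :=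
  (MonoidHom.toAdditive
    (QuotientGroup.mk' (principalDivisor (toricVariety k Δ)).range)).comp (invariantDivisor k)

/-- The `Pic(X_Δ)`-grading of `S`: the character `χ(h)` is homogeneous of degree the class of
`D_h`. -/
abbrev coxGrading : Pic (toricVariety k Δ) → Submodule k (coxRing k Δ) :=
  AddMonoidAlgebra.gradeBy k ((picClass k Δ).comp (coxMonoid Δ).subtype)

end CoordinateRing

/-! ### The toric Proj of a graded ring -/

section TProj

variable {ι k S : Type u} [AddCommGroup ι] [DecidableEq ι] [CommRing k] [CommRing S] [Algebra k S]
  (𝒜 : ι → Submodule k S) [GradedAlgebra 𝒜] (B : Ideal S)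

/-- The homogeneous primes of the graded ring `S` which do not contain the ideal `B`, with the
topology induced by the Zariski topology of `Spec S`. -/
abbrev TProjSpace : Type u :=
  {p : PrimeSpectrum S // p.asIdeal.IsHomogeneous 𝒜 ∧ ¬ B ≤ p.asIdeal}

variable {𝒜 B} in
/-- `S_(p)`: the fractions `f / g` with `f`, `g` homogeneous of the same degree, `g ∉ p`. -/
abbrev TProjSpace.Stalk (p : TProjSpace 𝒜 B) : Type u :=
  HomogeneousLocalization.AtPrime 𝒜 p.1.asIdeal

variable {𝒜 B} in
/-- A section on `U` which is globally of the form `f / g`, with `f`, `g` homogeneous of the same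
degree and `g` outside of all `p ∈ U`. -/
def IsDegreeZeroFraction {U : Opens (TopCat.of (TProjSpace 𝒜 B))}
    (s : ∀ p : U, TProjSpace.Stalk p.1) : Prop :=
  ∃ (i : ι) (f g : 𝒜 i) (hg : ∀ p : U, g.1 ∉ p.1.1.asIdeal),
    ∀ p : U, s p = HomogeneousLocalization.mk ⟨i, f, g, hg p⟩

/-- The sections which are locally degree zero fractions. -/
def locallyFraction : TopCat.LocalPredicate
    (fun p : TopCat.of (TProjSpace 𝒜 B) => TProjSpace.Stalk p) :=
  TopCat.PrelocalPredicate.sheafify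
    { pred := fun s => IsDegreeZeroFraction s
      res := by rintro V U i s ⟨j, f, g, h, w⟩; exact ⟨j, f, g, 
        fun p => h ⟨p.1, leOfHom i p.2⟩, fun p => w ⟨p.1, leOfHom i p.2⟩⟩ }

/-- The sections over `U` which are locally degree zero fractions form a ring. -/
def sectionsSubring (U : Opens (TopCat.of (TProjSpace 𝒜 B))) :
    Subring (∀ p : U, TProjSpace.Stalk p.1) where
  carrier := {s | (locallyFraction 𝒜 B).pred s}
  zero_mem' p := ⟨U, p.2, 𝟙 U, 0, ⟨0, zero_mem _⟩, ⟨1, SetLike.one_mem_graded _⟩,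
    fun q => (Ideal.ne_top_iff_one _).1 q.1.1.isPrime.ne_top, fun _ => rfl⟩
  one_mem' p := ⟨U, p.2, 𝟙 U, 0, ⟨1, SetLike.one_mem_graded _⟩, ⟨1, SetLike.one_mem_graded _⟩,
    fun q => (Ideal.ne_top_iff_one _).1 q.1.1.isPrime.ne_top, fun _ => rfl⟩
  add_mem' {a b} ha hb p := by
    obtain ⟨Va, ma, ia, ja, ⟨ra, hra⟩, ⟨sa, hsa⟩, hwa, wa⟩ := ha p
    obtain ⟨Vb, mb, ib, jb, ⟨rb, hrb⟩, ⟨sb, hsb⟩, hwb, wb⟩ := hb p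
    refine ⟨Va ⊓ Vb, ⟨ma, mb⟩, homOfLE (inf_le_left.trans (leOfHom ia)), ja + jb,
      ⟨sb * ra + sa * rb, add_mem (add_comm jb ja ▸ SetLike.mul_mem_graded hsb hra)
        (SetLike.mul_mem_graded hsa hrb)⟩,
      ⟨sa * sb, SetLike.mul_mem_graded hsa hsb⟩,
      fun q => q.1.1.asIdeal.primeCompl.mul_mem (hwa ⟨q.1, q.2.1⟩) (hwb ⟨q.1, q.2.2⟩), ?_⟩
    intro q
    have h1 := wa ⟨q.1, q.2.1⟩
    have h2 := wb ⟨q.1, q.2.2⟩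
    change a ⟨q.1, _⟩ + b ⟨q.1, _⟩ = _
    change a ⟨q.1, _⟩ = _ at h1
    change b ⟨q.1, _⟩ = _ at h2
    rw [h1, h2]
    simp [HomogeneousLocalization.ext_iff_val, Localization.add_mk, add_comm (sa * rb)]
  neg_mem' {a} ha p := by
    obtain ⟨V, m, i, j, ⟨r, hr⟩, ⟨s, hs⟩, hw, w⟩ := ha p
    refine ⟨V, m, i, j, ⟨-r, neg_mem hr⟩, ⟨s, hs⟩, hw, fun q => ?_⟩
    have h1 := w q
    change a ⟨q.1, _⟩ = _ at h1
    change -a ⟨q.1, _⟩ = _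
    rw [h1]
    simp [HomogeneousLocalization.ext_iff_val, Localization.neg_mk]
  mul_mem' {a b} ha hb p := by
    obtain ⟨Va, ma, ia, ja, ⟨ra, hra⟩, ⟨sa, hsa⟩, hwa, wa⟩ := ha p
    obtain ⟨Vb, mb, ib, jb, ⟨rb, hrb⟩, ⟨sb, hsb⟩, hwb, wb⟩ := hb p
    refine ⟨Va ⊓ Vb, ⟨ma, mb⟩, homOfLE (inf_le_left.trans (leOfHom ia)), ja + jb,
      ⟨ra * rb, SetLike.mul_mem_graded hra hrb⟩,
      ⟨sa * sb, SetLike.mul_mem_graded hsa hsb⟩,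
      fun q => q.1.1.asIdeal.primeCompl.mul_mem (hwa ⟨q.1, q.2.1⟩) (hwb ⟨q.1, q.2.2⟩), ?_⟩
    intro q
    have h1 := wa ⟨q.1, q.2.1⟩
    have h2 := wb ⟨q.1, q.2.2⟩
    change a ⟨q.1, _⟩ * b ⟨q.1, _⟩ = _
    change a ⟨q.1, _⟩ = _ at h1
    change b ⟨q.1, _⟩ = _ at h2
    rw [h1, h2]
    simp [HomogeneousLocalization.ext_iff_val, Localization.mk_mul]

/-- The structure sheaf of the toric Proj, as a sheaf of sets. -/
def structureSheafInType : TopCat.Sheaf (Type u) (TopCat.of (TProjSpace 𝒜 B)) :=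
  TopCat.subsheafToTypes (locallyFraction 𝒜 B)

/-- The structure sheaf of the toric Proj, as a presheaf of rings. -/
def structurePresheaf : TopCat.Presheaf CommRingCat.{u} (TopCat.of (TProjSpace 𝒜 B)) where
  obj U := CommRingCat.of (sectionsSubring 𝒜 B U.unop)
  map {U V} i := CommRingCat.ofHom
    { toFun := (structureSheafInType 𝒜 B).1.map i
      map_zero' := rfl
      map_add' := fun _ _ => rfl
      map_one' := rfl
      map_mul' := fun _ _ => rfl }

/-- The toric Proj: the ringed space of the homogeneous primes of `S` not containing `B`, with the
sheaf of rings of functions `p ↦ s(p) ∈ S_(p)` that are locally degree zero fractions. -/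
def TProj : SheafedSpace CommRingCat.{u} where
  carrier := TopCat.of (TProjSpace 𝒜 B)
  presheaf := structurePresheaf 𝒜 B
  IsSheaf :=
    (TopCat.Presheaf.isSheaf_iff_isSheaf_comp (forget CommRingCat) _).2
      (TopCat.Presheaf.isSheaf_of_iso
        (NatIso.ofComponents (fun _ => Iso.refl _) (by cat_disch) :
          structurePresheaf 𝒜 B ⋙ forget CommRingCat ≅ (structureSheafInType 𝒜 B).1).symm
        (structureSheafInType 𝒜 B).2)

/-- The constants `k → Γ(TProj, O)`. -/
def TProj.constants : CommRingCat.of k ⟶ SheafedSpace.Γ.obj (op (TProj 𝒜 B)) :=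
  CommRingCat.ofHom
    ((RingHom.pi fun p : (⊤ : Opens (TopCat.of (TProjSpace 𝒜 B))) =>
      (HomogeneousLocalization.fromZeroRingHom 𝒜 p.1.1.asIdeal.primeCompl).comp
        (algebraMap k (𝒜 0))).codRestrict (sectionsSubring 𝒜 B ⊤) fun c _ =>
          ⟨⊤, trivial, 𝟙 _, 0, algebraMap k (𝒜 0) c, 1,
            fun q => (Ideal.ne_top_iff_one _).1 q.1.1.isPrime.ne_top, fun _ => rfl⟩)

end TProj

/-- The constants `k → Γ(X_Δ, O)`, given by the structure morphism `X_Δ → Spec k`. -/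
def toricConstants {N : Type u} [AddCommGroup N] (k : Type u) [Field k] (Δ : Fan N) :
    CommRingCat.of k ⟶ SheafedSpace.Γ.obj (op (toricVariety k Δ).toSheafedSpace) :=
  (Scheme.ΓSpecIso (CommRingCat.of k)).inv ≫ (toricStructure k Δ).appTop

open Classical in
/-- The toric Proj of the homogeneous coordinate ring `S` of `X_Δ` with its `Pic(X_Δ)`-grading and
its irrelevant ideal `B`. -/
def toricProj {N : Type u} [AddCommGroup N] (k : Type u) [Field k] (Δ : Fan N) :
    SheafedSpace CommRingCat.{u} :=
  TProj (coxGrading k Δ) (irrelevantIdeal k Δ)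

open Classical in
/-- The constants `k → Γ(Tproj(S), O)`. -/
def toricProjConstants {N : Type u} [AddCommGroup N] (k : Type u) [Field k] (Δ : Fan N) :
    CommRingCat.of k ⟶ SheafedSpace.Γ.obj (op (toricProj k Δ)) :=
  TProj.constants (coxGrading k Δ) (irrelevantIdeal k Δ)

end Toric

end

/-!
Both the toric variety `X` and the toric Proj are described inside the function field `K` of `X`:
a sheaf of subrings of the constant sheaf `K` is determined by its local rings, so an isomorphism of
ringed spaces is a homeomorphism under which the local rings, as subrings of `K`, correspond. This
is `exists_sheafedSpaceIso`; no covering of the toric Proj by affine schemes is needed.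

The link between `S` and the charts `U_σ` is dehomogenization. A divisor `D_h` is principal if and
only if `h` is linear (`picClass_eq_zero_iff`: a rational function with divisor `D_h` is a unit on
the torus, hence a multiple of a character). So, as the fan spans `N_ℝ`, there is an exact sequence
`0 → M → SF(N, Δ) → Pic(X)`. Since `Pic(X)` is free and every class in the image is represented by a
support function vanishing on `σ`, the inclusion of `M` has a retraction `r_σ` such that
`r_σ(h) = h` on `σ` (`nonempty_linearRetraction`). The ring homomorphism `χ(h) ↦ χ(r_σ(h))` from `S` to `k[σ_M]`
is injective on homogeneous elements of a fixed degree, and for two cones these homomorphisms differ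
in each degree only by a character, a unit on the smaller chart.

Enough invariant Cartier divisors provide, for each `σ`, a support function `η_σ` vanishing at the
rays of `σ` and positive at the others (`exists_supportFunction`, by evaluating local equations at
the distinguished points of the charts of rays). Hence `U_σ̂` is the locus where `χ(η_σ)` does
not vanish, a homogeneous prime contains `B` if and only if it contains all `χ(η_σ)`, and `χ(η_σ)`
serves to homogenize elements of `k[σ_M]` (`LinearRetraction.exists_homogenization`). To `q ∈ U_σ`
one assigns the homogeneous core of the preimage of `q` in `S`; it is prime because the free group
`Pic(X)` can be ordered. This identifies `U_σ` with the open set of homogeneous primes not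
containing `χ(η_σ)`, the maps glue, and the result is a homeomorphism (`isHomeomorph_pointMap`).
Injectivity across charts is `mem_opensRange_of_chi_notMem`. Finally, a degree zero fraction `f / g`
has a value in `K` by dehomogenizing on the torus, and the values of the fractions in `S_(p)` are
exactly the elements of the local ring of `X` at the corresponding point (`range_coxValue`).
-/

noncomputable section

namespace Toric

/-! ### Rays of a fan -/

section Polyhedral

variable {N : Type u} [AddCommGroup N]

lemma latticePt_zsmul (c : ℤ) (n : N) : latticePt (c • n) = (c : ℝ) • latticePt n := by
  rw [latticePt, TensorProduct.tmul_smul, latticePt, Int.cast_smul_eq_zsmul]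

lemma latticePt_zero : latticePt (0 : N) = 0 := TensorProduct.tmul_zero _ _

lemma latticePt_ne_zero [Module.Free ℤ N] {n : N} (hn : n ≠ 0) : latticePt n ≠ 0 := by
  intro h
  refine hn ((Module.forall_dual_apply_eq_zero_iff ℤ n).1 fun m => ?_)
  have := charPairing_latticePt m n
  rw [h, map_zero] at this
  exact_mod_cast this.symm

/-- A nonzero lattice vector is a positive multiple of a vector on which some `m ∈ M` takes the
value one: the multiple is the generator of the ideal of all values of linear forms. -/
lemma exists_eq_zsmul_of_ne_zero [Module.Free ℤ N] [Module.Finite ℤ N] {n : N} (hn : n ≠ 0) :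
    ∃ (c : ℤ) (n₀ : N) (m : DualLattice N), 0 < c ∧ n = c • n₀ ∧ m n₀ = 1 := by
  obtain ⟨a, ha⟩ := (IsPrincipalIdealRing.principal
    (LinearMap.range (Module.Dual.eval ℤ N n))).principal
  have hdvd : ∀ m : DualLattice N, |a| ∣ m n := fun m => by
    rw [abs_dvd]
    have : m n ∈ Submodule.span ℤ {a} := ha ▸ ⟨m, rfl⟩
    exact Ideal.mem_span_singleton.1 this
  obtain ⟨m, hm⟩ : ∃ m : DualLattice N, m n = |a| := by
    obtain ⟨m, hm⟩ : a ∈ LinearMap.range (Module.Dual.eval ℤ N n) :=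
      ha ▸ Submodule.mem_span_singleton_self a
    have hm' : m n = a := hm
    rcases abs_choice a with h | h
    · exact ⟨m, by rw [hm', h]⟩
    · exact ⟨-m, by rw [LinearMap.neg_apply, hm', h]⟩
  let b := Module.Free.chooseBasis ℤ N
  have hb : ∀ i, ∃ z, b.repr n i = |a| * z := fun i => hdvd (b.coord i)
  choose z hz using hb
  have hn₀ : n = |a| • ∑ i, z i • b i := by
    rw [Finset.smul_sum]
    conv_lhs => rw [← b.sum_repr n]
    exact Finset.sum_congr rfl fun i _ => by rw [hz, mul_smul]
  have hpos : 0 < |a| := by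
    refine abs_pos.2 fun h => hn ?_
    rw [hn₀, h, abs_zero, zero_smul]
  refine ⟨|a|, _, m, hpos, hn₀, ?_⟩
  rw [hn₀, map_smul, smul_eq_mul] at hm
  exact (mul_eq_left₀ hpos.ne').1 hm

lemma exists_isPrimitive [Module.Free ℤ N] [Module.Finite ℤ N] {n : N} (hn : n ≠ 0) :
    ∃ (c : ℤ) (n₀ : N), 0 < c ∧ IsPrimitive n₀ ∧ n = c • n₀ := by
  obtain ⟨c, n₀, m, hc, h, hm⟩ := exists_eq_zsmul_of_ne_zero hn
  refine ⟨c, n₀, hc, fun a n' h' => ?_, h⟩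
  rw [h', map_smul, smul_eq_mul] at hm
  exact IsUnit.of_mul_eq_one _ hm

lemma IsPrimitive.ne_zero {n : N} (hn : IsPrimitive n) : n ≠ 0 := by
  rintro rfl
  exact not_isUnit_zero (hn 0 0 (by simp))

lemma IsPrimitive.exists_eq_one [Module.Free ℤ N] [Module.Finite ℤ N] {n : N}
    (hn : IsPrimitive n) : ∃ m : DualLattice N, m n = 1 := by
  obtain ⟨c, n₀, m, hc, h, hm⟩ := exists_eq_zsmul_of_ne_zero hn.ne_zero
  have := Int.eq_one_of_dvd_one hc.le (hn c n₀ h).dvd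
  exact ⟨m, by rw [h, this, one_smul, hm]⟩

lemma rayCone_zsmul {c : ℤ} (hc : 0 < c) (n : N) : rayCone (c • n) = rayCone n := by
  have hc' : (0 : ℝ) < c := by exact_mod_cast hc
  apply le_antisymm
  · refine Submodule.span_le.2 ?_
    rintro _ rfl
    rw [latticePt_zsmul]
    exact Submodule.smul_mem _ (⟨(c : ℝ), hc'.le⟩ : {c : ℝ // 0 ≤ c}) (Submodule.subset_span rfl)
  · refine Submodule.span_le.2 ?_
    rintro _ rfl
    have h := Submodule.smul_mem (rayCone (c • n)) (⟨(c : ℝ)⁻¹, by positivity⟩ : {c : ℝ // 0 ≤ c})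
      (Submodule.subset_span rfl)
    have h2 : (⟨(c : ℝ)⁻¹, by positivity⟩ : {c : ℝ // 0 ≤ c}) • latticePt (c • n) =
        latticePt n := by
      change (c : ℝ)⁻¹ • latticePt (c • n) = latticePt n
      rw [latticePt_zsmul, smul_smul, inv_mul_cancel₀ hc'.ne', one_smul]
    rwa [h2] at h

/-- The face of `σ` cut out by `m`. -/
def faceOf (σ : PointedCone ℝ (RealSpace N)) (m : DualLattice N) : PointedCone ℝ (RealSpace N) :=
  σ ⊓ (LinearMap.ker (charPairing N m)).restrictScalars _

lemma mem_faceOf {σ : PointedCone ℝ (RealSpace N)} {m : DualLattice N} {v : RealSpace N} :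
    v ∈ faceOf σ m ↔ v ∈ σ ∧ charPairing N m v = 0 := Iff.rfl

lemma faceOf_le (σ : PointedCone ℝ (RealSpace N)) (m : DualLattice N) : faceOf σ m ≤ σ :=
  inf_le_left

lemma Fan.faceOf_mem (Δ : Fan N) {σ : PointedCone ℝ (RealSpace N)} (hσ : σ ∈ Δ.cones)
    {m : DualLattice N} (hm : m ∈ coneMonoid σ) : faceOf σ m ∈ Δ.cones :=
  Δ.face_mem σ hσ _ ⟨m, hm, fun _ => Iff.rfl⟩

/-- Strong convexity: some `u ∈ M` is strictly positive on `σ` away from the origin. -/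
lemma Fan.exists_pos (Δ : Fan N) {σ : PointedCone ℝ (RealSpace N)} (hσ : σ ∈ Δ.cones) :
    ∃ u : DualLattice N, ∀ v ∈ σ, v ≠ 0 → 0 < charPairing N u v := by
  obtain ⟨u, hu, h⟩ := Δ.isFace_of_le Δ.zero_mem hσ bot_le
  refine ⟨u, fun v hv hv0 => (hu v hv).lt_of_ne fun h0 => hv0 ?_⟩
  exact (Submodule.mem_bot _).1 ((h v).2 ⟨hv, h0.symm⟩)

lemma exists_latticePt_mem_ne_zero {Δ : Fan N} {σ : PointedCone ℝ (RealSpace N)} (hσ : σ ∈ Δ.cones)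
    (hne : σ ≠ ⊥) : ∃ n : N, latticePt n ∈ σ ∧ latticePt n ≠ 0 := by
  obtain ⟨s, rfl⟩ := Δ.rational σ hσ
  by_contra! h
  refine hne (eq_bot_iff.2 (Submodule.span_le.2 ?_))
  rintro _ ⟨x, hx, rfl⟩
  exact (Submodule.mem_bot _).2 (h x (Submodule.subset_span ⟨x, hx, rfl⟩))

/-- Let `y` minimize the ratio `m / u` among the generators of `σ`. Then `u(y) m - m(y) u` is
nonnegative on `σ`; it vanishes at `y`, so it cuts out a nonzero face, on which `m / u` is
constant. -/
lemma Fan.exists_min_ratio (Δ : Fan N) {σ : PointedCone ℝ (RealSpace N)} (hσ : σ ∈ Δ.cones)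
    (hne : σ ≠ ⊥) {u : DualLattice N} (hu : ∀ v ∈ σ, v ≠ 0 → 0 < charPairing N u v)
    (m : DualLattice N) :
    ∃ y : N, latticePt y ∈ σ ∧ latticePt y ≠ 0 ∧
      (u y • m - m y • u) ∈ coneMonoid σ := by
  obtain ⟨s, hs⟩ := Δ.rational σ hσ
  have hmem : ∀ x ∈ s, latticePt x ∈ σ := fun x hx => by
    rw [hs]; exact Submodule.subset_span ⟨x, hx, rfl⟩
  classical
  have hs0 : (s.filter fun x => latticePt x ≠ 0).Nonempty := by
    by_contra h
    rw [Finset.not_nonempty_iff_eq_empty, Finset.filter_eq_empty_iff] at h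
    refine hne (eq_bot_iff.2 ?_)
    rw [hs]
    refine Submodule.span_le.2 ?_
    rintro _ ⟨x, hx, rfl⟩
    exact (Submodule.mem_bot _).2 (not_not.1 (h hx))
  obtain ⟨y, hy, hmin⟩ := Finset.exists_min_image _ (fun x => (m x : ℝ) / u x) hs0
  rw [Finset.mem_filter] at hy
  refine ⟨y, hmem y hy.1, hy.2, ?_⟩
  have hpos : ∀ x ∈ s, latticePt x ≠ 0 → (0 : ℝ) < u x := fun x hx h0 => by
    simpa using hu _ (hmem x hx) h0
  rw [hs]
  refine hull_induction_nonneg _ ?_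
  rintro _ ⟨x, hx, rfl⟩
  by_cases hx0 : latticePt x = 0
  · rw [hx0, map_zero]
  have h1 := hmin x (Finset.mem_filter.2 ⟨hx, hx0⟩)
  rw [div_le_div_iff₀ (hpos y hy.1 hy.2) (hpos x hx hx0)] at h1
  rw [charPairing_latticePt]
  simp only [LinearMap.sub_apply, LinearMap.smul_apply, smul_eq_mul]
  push_cast
  linarith

lemma Fan.Ray.genPt_mem {Δ : Fan N} (ρ : Δ.Ray) : latticePt ρ.gen ∈ ρ.cone.1 :=
  Submodule.subset_span rfl

lemma Fan.Ray.latticePt_gen_ne_zero [Module.Free ℤ N] {Δ : Fan N} (ρ : Δ.Ray) :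
    latticePt ρ.gen ≠ 0 :=
  latticePt_ne_zero ρ.2.1.ne_zero

variable [Module.Free ℤ N] [Module.Finite ℤ N]

/-- Every nonzero cone of a fan contains a ray of the fan: a minimal nonzero cone is a ray, because
all ratios of linear forms are constant on it. -/
lemma Fan.exists_ray_le (Δ : Fan N) {σ : PointedCone ℝ (RealSpace N)} (hσ : σ ∈ Δ.cones)
    (hne : σ ≠ ⊥) : ∃ ρ : Δ.Ray, ρ.cone.1 ≤ σ := by
  obtain ⟨τ, hτ⟩ := (Δ.finite.subset (Set.sep_subset _ fun τ => τ ≤ σ ∧ τ ≠ ⊥)).exists_minimal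
    ⟨σ, hσ, le_rfl, hne⟩
  obtain ⟨⟨hτΔ, hτσ, hτ0⟩, hmin⟩ := hτ
  obtain ⟨u, hu⟩ := Δ.exists_pos hτΔ
  obtain ⟨x, hx, hx0⟩ := exists_latticePt_mem_ne_zero hτΔ hτ0
  have hprop : ∀ z : N, latticePt z ∈ τ → u x • z = u z • x := by
    intro z hz
    refine sub_eq_zero.1 ((Module.forall_dual_apply_eq_zero_iff ℤ _).1 fun m => ?_)
    obtain ⟨y, hy, hy0, hm⟩ := Δ.exists_min_ratio hτΔ hτ0 hu m
    have hF := Δ.faceOf_mem hτΔ hm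
    have hle : τ ≤ faceOf τ (u y • m - m y • u) := by
      refine hmin ⟨hF, (faceOf_le _ _).trans hτσ, fun h => hy0 ?_⟩ (faceOf_le _ _)
      rw [← Submodule.mem_bot {c : ℝ // 0 ≤ c}, ← h]
      refine mem_faceOf.2 ⟨hy, ?_⟩
      rw [charPairing_latticePt]
      simp [mul_comm]
    have h1 := (mem_faceOf.1 (hle hz)).2
    have h2 := (mem_faceOf.1 (hle hx)).2
    have h3 := hu _ hy hy0
    rw [charPairing_latticePt] at h1 h2 h3
    simp only [LinearMap.sub_apply, LinearMap.smul_apply, smul_eq_mul, Int.cast_eq_zero,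
      Int.cast_pos] at h1 h2 h3
    simp only [map_sub, map_smul, smul_eq_mul]
    refine (mul_eq_zero.1 (?_ : u y * _ = 0)).resolve_left h3.ne'
    linear_combination u x * h1 - u z * h2
  have hux : 0 < u x := by simpa using hu _ hx hx0
  have hray : τ = rayCone x := by
    apply le_antisymm
    · obtain ⟨s, hs⟩ := Δ.rational τ hτΔ
      conv_lhs => rw [hs]
      refine Submodule.span_le.2 ?_
      rintro _ ⟨z, hz, rfl⟩
      have hzτ : latticePt z ∈ τ := by rw [hs]; exact Submodule.subset_span ⟨z, hz, rfl⟩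
      have h1 := congrArg latticePt (hprop z hzτ)
      rw [latticePt_zsmul, latticePt_zsmul] at h1
      have hux' : (0 : ℝ) < u x := by exact_mod_cast hux
      have huz : (0 : ℝ) ≤ u z := by
        by_cases h0 : latticePt z = 0
        · have := charPairing_latticePt u z
          rw [h0, map_zero] at this
          exact this.le
        · simpa using (hu _ hzτ h0).le
      have h2 : latticePt z = ((u z : ℝ) / u x) • latticePt x := by
        rw [div_eq_inv_mul, mul_smul, ← h1, smul_smul, inv_mul_cancel₀ hux'.ne', one_smul]
      rw [h2]
      exact Submodule.smul_mem _ (⟨_, div_nonneg huz hux'.le⟩ : {c : ℝ // 0 ≤ c})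
        (Submodule.subset_span rfl)
    · refine Submodule.span_le.2 ?_
      rintro _ rfl
      exact hx
  obtain ⟨c, n₀, hc, hn₀, rfl⟩ := exists_isPrimitive
    (show x ≠ 0 from fun h => hx0 (by rw [h, latticePt_zero]))
  rw [rayCone_zsmul hc] at hray
  exact ⟨⟨n₀, hn₀, hray ▸ hτΔ⟩, (hray.symm.le : rayCone n₀ ≤ τ).trans hτσ⟩

/-- A linear form which is nonnegative on the rays of a cone is nonnegative on the cone. -/
lemma mem_coneMonoid_of_rays {Δ : Fan N} (σ : Δ.cones) {m : DualLattice N}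
    (h : ∀ ρ : Δ.Ray, ρ.IsRayOf σ → 0 ≤ m ρ.gen) : m ∈ coneMonoid σ.1 := by
  obtain ⟨u, hu⟩ := Δ.exists_pos σ.2
  by_cases hne : σ.1 = ⊥
  · rw [hne]
    intro v hv
    rw [(Submodule.mem_bot _).1 hv, map_zero]
  obtain ⟨y, hy, hy0, hm⟩ := Δ.exists_min_ratio σ.2 hne hu m
  have huy : 0 < u y := by simpa using hu _ hy hy0
  by_cases hmy : 0 ≤ m y
  · intro v hv
    by_cases hv0 : v = 0
    · rw [hv0, map_zero]
    have h1 := hm v hv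
    have h2 := hu v hv hv0
    simp only [map_sub, map_zsmul, LinearMap.sub_apply, LinearMap.smul_apply] at h1
    rw [zsmul_eq_mul, zsmul_eq_mul] at h1
    have h3 : (0 : ℝ) ≤ m y := by exact_mod_cast hmy
    have h4 : (0 : ℝ) < u y := by exact_mod_cast huy
    have h5 : 0 ≤ (u y : ℝ) * charPairing N m v := by nlinarith
    exact nonneg_of_mul_nonneg_right h5 h4
  · exfalso
    obtain ⟨ρ, hρ⟩ := Δ.exists_ray_le (Δ.faceOf_mem σ.2 hm) (fun h => hy0 (by
      rw [← Submodule.mem_bot {c : ℝ // 0 ≤ c}, ← h]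
      refine mem_faceOf.2 ⟨hy, ?_⟩
      rw [charPairing_latticePt]
      simp [mul_comm]))
    have h1 := (mem_faceOf.1 (hρ ρ.genPt_mem))
    have h2 := hu _ h1.1 ρ.latticePt_gen_ne_zero
    have h3 := h ρ (hρ.trans (faceOf_le _ _))
    have h1 := h1.2
    rw [charPairing_latticePt] at h1 h2
    simp only [LinearMap.sub_apply, LinearMap.smul_apply, smul_eq_mul, Int.cast_eq_zero,
      Int.cast_pos] at h1 h2
    nlinarith

end Polyhedral

/-! ### Support functions -/

section SupportFunctions

variable {N : Type u} [AddCommGroup N] {Δ : Fan N}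

variable (Δ) in
/-- The inclusion `M → SF(N, Δ)` of the globally linear support functions. -/
def linearSF : DualLattice N →+ SupportFunction Δ where
  toFun m := ⟨fun v => charPairing N m v, fun _ _ => ⟨m, fun _ _ => rfl⟩⟩
  map_zero' := by ext; simp
  map_add' a b := by ext; simp

lemma represents_linearSF (m : DualLattice N) (σ : Δ.cones) : Represents (linearSF Δ m) σ m :=
  fun _ _ => rfl

lemma linearSF_injective [Module.Free ℤ N] (hspan : Δ.SpansSpace) :
    Function.Injective (linearSF Δ) := by
  refine (injective_iff_map_eq_zero _).2 fun m hm => ?_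
  have h0 : charPairing N m = 0 := by
    refine LinearMap.ext_on hspan fun v hv => ?_
    exact congrFun (congrArg Subtype.val hm) ⟨v, hv⟩
  ext n
  have := charPairing_latticePt m n
  rw [h0, LinearMap.zero_apply] at this
  exact_mod_cast this.symm

lemma sfPairing_rayForm (h : SupportFunction Δ) (ρ : Δ.Ray) :
    sfPairing Δ h (rayForm ρ) = h.1 ρ.genPt := by
  change rayForm ρ (latticePt h) = _
  simp [rayForm]

lemma Represents.gen {h : SupportFunction Δ} {σ : Δ.cones} {m : DualLattice N}
    (hm : Represents h σ m) {ρ : Δ.Ray} (hρ : ρ.IsRayOf σ) : h.1 ρ.genPt = m ρ.gen := by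
  rw [hm ρ.genPt (hρ (Submodule.subset_span rfl)), ← charPairing_latticePt]
  rfl

lemma mem_coxMonoid_iff {h : SupportFunction Δ} :
    h ∈ coxMonoid Δ ↔ ∀ ρ : Δ.Ray, 0 ≤ h.1 ρ.genPt := by
  constructor
  · intro hh ρ
    rw [← sfPairing_rayForm]
    refine hh _ fun x hx => ?_
    exact (Submodule.mem_iInf _).1 hx ρ rfl
  · intro hh v hv
    refine hv ((Submodule.mem_iInf _).2 fun ρ => ?_)
    rintro _ rfl
    change 0 ≤ rayForm ρ (latticePt h)
    rw [show rayForm ρ (latticePt h) = _ from sfPairing_rayForm h ρ]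
    exact hh ρ

lemma mem_hatMonoid_iff {h : SupportFunction Δ} {σ : Δ.cones} :
    h ∈ dualMonoid (sfPairing Δ) (hatCone Δ σ) ↔
      ∀ ρ : Δ.Ray, ρ.IsRayOf σ → 0 ≤ h.1 ρ.genPt := by
  constructor
  · intro hh ρ hρ
    rw [← sfPairing_rayForm]
    exact hh _ (Submodule.subset_span ⟨ρ, hρ, rfl⟩)
  · intro hh v hv
    induction hv using Submodule.span_induction with
    | mem v hv =>
      obtain ⟨ρ, hρ, rfl⟩ := hv
      rw [sfPairing_rayForm]
      exact hh ρ hρ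
    | zero => simp
    | add x y _ _ hx hy => simpa using add_nonneg hx hy
    | smul c x _ hx =>
      rw [show c • x = (c : ℝ) • x from rfl, map_smul, smul_eq_mul]
      exact mul_nonneg c.2 hx

variable [Module.Free ℤ N] [Module.Finite ℤ N]

/-- A primitive generator is determined by its ray. -/
lemma Fan.Ray.cone_injective : Function.Injective (Fan.Ray.cone : Δ.Ray → Δ.cones) := by
  intro ρ ρ' h
  have hmem : latticePt ρ'.gen ∈ rayCone ρ.gen := by
    have := ρ'.genPt_mem
    rwa [← h] at this
  obtain ⟨r, hr⟩ := Submodule.mem_span_singleton.1 hmem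
  have hr' : (r : ℝ) • latticePt ρ.gen = latticePt ρ'.gen := hr
  obtain ⟨m, hm⟩ := ρ.2.1.exists_eq_one
  have key : ∀ m' : DualLattice N, (m' ρ'.gen : ℝ) = r * m' ρ.gen := fun m' => by
    rw [← charPairing_latticePt, ← charPairing_latticePt, ← hr', map_smul, smul_eq_mul]
  have h1 : (m ρ'.gen : ℝ) = r := by rw [key m, Fan.Ray.gen, hm, Int.cast_one, mul_one]
  have h2 : ρ'.gen = m ρ'.gen • ρ.gen := by
    refine sub_eq_zero.1 ((Module.forall_dual_apply_eq_zero_iff ℤ _).1 fun m' => ?_)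
    rw [map_sub, map_smul, smul_eq_mul, sub_eq_zero]
    have := key m'
    rw [← h1] at this
    exact_mod_cast this
  have h3 : m ρ'.gen = 1 := by
    refine Int.eq_one_of_dvd_one ?_ (ρ'.2.1 _ _ h2).dvd
    have : (0 : ℝ) ≤ m ρ'.gen := h1 ▸ r.2
    exact_mod_cast this
  rw [h3, one_smul] at h2
  exact Subtype.ext h2.symm

instance finite_ray : Finite Δ.Ray :=
  have : Finite Δ.cones := Δ.finite
  Finite.of_injective _ Fan.Ray.cone_injective

/-- The linear function representing `h` on `σ` is nonnegative if `h` is nonnegative at the rays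
of `σ`. -/
lemma nonneg_of_rays {h : SupportFunction Δ} {σ : Δ.cones}
    (hh : ∀ ρ : Δ.Ray, ρ.IsRayOf σ → 0 ≤ h.1 ρ.genPt) {m : DualLattice N}
    (hm : Represents h σ m) : m ∈ coneMonoid σ.1 :=
  mem_coneMonoid_of_rays σ fun ρ hρ => by
    have := hh ρ hρ
    rw [hm.gen hρ] at this
    exact_mod_cast this

/-- A support function is determined by its values at the primitive generators of the rays. -/
lemma supportFunction_ext {h h' : SupportFunction Δ} (H : ∀ ρ : Δ.Ray, h.1 ρ.genPt = h'.1 ρ.genPt) :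
    h = h' := by
  refine Subtype.ext (funext ?_)
  rintro ⟨v, σ, hσ, hv⟩
  have h1 := represents_localChar h ⟨σ, hσ⟩
  have h2 := represents_localChar h' ⟨σ, hσ⟩
  have key : ∀ ρ : Δ.Ray, ρ.IsRayOf ⟨σ, hσ⟩ →
      localChar h ⟨σ, hσ⟩ ρ.gen = localChar h' ⟨σ, hσ⟩ ρ.gen := fun ρ hρ => by
    have := H ρ
    rw [h1.gen hρ, h2.gen hρ] at this
    exact_mod_cast this
  have h3 := mem_coneMonoid_of_rays (m := localChar h ⟨σ, hσ⟩ - localChar h' ⟨σ, hσ⟩) ⟨σ, hσ⟩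
    (fun ρ hρ => by rw [LinearMap.sub_apply, key ρ hρ, sub_self]) v hv
  have h4 := mem_coneMonoid_of_rays (m := localChar h' ⟨σ, hσ⟩ - localChar h ⟨σ, hσ⟩) ⟨σ, hσ⟩
    (fun ρ hρ => by rw [LinearMap.sub_apply, key ρ hρ, sub_self]) v hv
  rw [map_sub, LinearMap.sub_apply] at h3 h4
  rw [h1 _ hv, h2 _ hv]
  linarith

/-- A support function is determined by its values at the finitely many primitive generators, and
these values are integers. -/
instance finite_supportFunction : Module.Finite ℤ (SupportFunction Δ) := by
  let f : SupportFunction Δ →ₗ[ℤ] (Δ.Ray → ℝ) := AddMonoidHom.toIntLinearMap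
    { toFun := fun h ρ => h.1 ρ.genPt
      map_zero' := rfl
      map_add' := fun _ _ => rfl }
  let g : (Δ.Ray → ℤ) →ₗ[ℤ] (Δ.Ray → ℝ) := AddMonoidHom.toIntLinearMap
    { toFun := fun a ρ => (a ρ : ℝ)
      map_zero' := by ext; simp
      map_add' := fun _ _ => by ext; simp }
  have hfg : ∀ h, f h ∈ LinearMap.range g := fun h =>
    ⟨fun ρ => localChar h ρ.cone ρ.gen, funext fun ρ =>
      ((represents_localChar h ρ.cone).gen le_rfl).symm⟩
  exact Module.Finite.of_injective (f.codRestrict _ hfg) fun a b hab =>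
    supportFunction_ext fun ρ => congrFun (congrArg Subtype.val hab) ρ

end SupportFunctions

/-! ### Local rings of the toric variety inside its function field -/

section Stalks

variable {N : Type u} [AddCommGroup N] (k : Type u) [Field k] (Δ : Fan N)

/-- The local ring `O_{X,x}` as a subring of the function field of `X`. -/
def localSubring (X : Scheme.{u}) [IsIntegral X] (x : X) : Subring X.functionField :=
  (algebraMap (X.presheaf.stalk x) X.functionField).range

lemma chart_mem (σ : Δ.cones) (q : affineChart k σ.1) :
    chartMap k Δ σ q ∈ chartMap k Δ σ ''ᵁ ⊤ := ⟨q, trivial, rfl⟩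

lemma algebraMap_germ_chartSections (σ : Δ.cones) (q : affineChart k σ.1)
    (a : SemigroupRing k (coneMonoid σ.1)) :
    algebraMap ((toricVariety k Δ).presheaf.stalk (chartMap k Δ σ q))
      (toricVariety k Δ).functionField
      ((toricVariety k Δ).presheaf.germ (chartMap k Δ σ ''ᵁ ⊤) (chartMap k Δ σ q)
        (chart_mem k Δ σ q) (chartSections k Δ σ a)) = chartToFunctionField k Δ σ a :=
  Scheme.algebraMap_germ_eq_germToFunctionField _ (chart_mem k Δ σ q) (chartSections k Δ σ a)

lemma isUnit_germ_chartSections_iff (σ : Δ.cones) (q : affineChart k σ.1)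
    (a : SemigroupRing k (coneMonoid σ.1)) :
    IsUnit ((toricVariety k Δ).presheaf.germ (chartMap k Δ σ ''ᵁ ⊤) (chartMap k Δ σ q)
        (chart_mem k Δ σ q) (chartSections k Δ σ a)) ↔ a ∉ PrimeSpectrum.asIdeal q := by
  rw [← Scheme.mem_basicOpen]
  have h : (toricVariety k Δ).basicOpen (chartSections k Δ σ a) =
      chartMap k Δ σ ''ᵁ ((affineChart k σ.1).basicOpen ((Scheme.ΓSpecIso _).inv a)) :=
    (Scheme.image_basicOpen (chartMap k Δ σ) _).symm
  rw [h, basicOpen_eq_of_affine]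
  constructor
  · rintro ⟨y, hy, hyq⟩
    rw [(chartMap k Δ σ).isOpenEmbedding.injective hyq] at hy
    exact hy
  · exact fun hq => ⟨q, hq, rfl⟩

lemma chartSections_bijective (σ : Δ.cones) :
    Function.Bijective (chartSections k Δ σ) := by
  unfold chartSections
  exact ConcreteCategory.bijective_of_isIso _

lemma chartToFunctionField_injective (σ : Δ.cones) :
    Function.Injective (chartToFunctionField k Δ σ) := by
  intro a b hab
  exact (chartSections_bijective k Δ σ).1 (Scheme.germToFunctionField_injective _ _ hab)

/-- The local ring of `X_Δ` at a point `q` of `U_σ` is the localization of `k[σ_M]` at `q`. -/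
lemma mem_localSubring_iff (σ : Δ.cones) (q : affineChart k σ.1)
    (z : (toricVariety k Δ).functionField) :
    z ∈ localSubring (toricVariety k Δ) (chartMap k Δ σ q) ↔
      ∃ a b : SemigroupRing k (coneMonoid σ.1), b ∉ PrimeSpectrum.asIdeal q ∧
        z * chartToFunctionField k Δ σ b = chartToFunctionField k Δ σ a := by
  constructor
  · rintro ⟨t, rfl⟩
    have hU : IsAffineOpen (chartMap k Δ σ ''ᵁ ⊤) :=
      (isAffineOpen_top _).image_of_isOpenImmersion _
    let := (toricVariety k Δ).presheaf.algebra_section_stalk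
      (⟨_, chart_mem k Δ σ q⟩ : chartMap k Δ σ ''ᵁ ⊤)
    have := hU.isLocalization_stalk ⟨_, chart_mem k Δ σ q⟩
    obtain ⟨⟨a, b⟩, hab⟩ := IsLocalization.surj
      (hU.primeIdealOf ⟨_, chart_mem k Δ σ q⟩).asIdeal.primeCompl t
    have hb := IsLocalization.map_units
      ((toricVariety k Δ).presheaf.stalk (chartMap k Δ σ q)) b
    obtain ⟨a', rfl⟩ := (chartSections_bijective k Δ σ).2 a
    obtain ⟨b, hb'⟩ := b
    obtain ⟨b', rfl⟩ := (chartSections_bijective k Δ σ).2 b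
    refine ⟨a', b', (isUnit_germ_chartSections_iff k Δ σ q b').1 hb, ?_⟩
    rw [← algebraMap_germ_chartSections k Δ σ q, ← algebraMap_germ_chartSections k Δ σ q,
      ← map_mul]
    exact congrArg _ hab
  · rintro ⟨a, b, hb, h⟩
    have hu := (isUnit_germ_chartSections_iff k Δ σ q b).2 hb
    rw [← algebraMap_germ_chartSections k Δ σ q, ← algebraMap_germ_chartSections k Δ σ q] at h
    obtain ⟨u, hu⟩ := hu
    refine ⟨(toricVariety k Δ).presheaf.germ (chartMap k Δ σ ''ᵁ ⊤) (chartMap k Δ σ q)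
      (chart_mem k Δ σ q) (chartSections k Δ σ a) *
        (↑u⁻¹ : (toricVariety k Δ).presheaf.stalk (chartMap k Δ σ q)), ?_⟩
    rw [map_mul, ← h, ← hu, mul_assoc, ← map_mul, Units.mul_inv, map_one, mul_one]

lemma mem_stalkUnits_iff (X : Scheme.{u}) [IsIntegral X] (x : X) (z : X.functionFieldˣ) :
    z ∈ stalkUnits X x ↔ (z : X.functionField) ∈ localSubring X x ∧
      ((z⁻¹ : X.functionFieldˣ) : X.functionField) ∈ localSubring X x := by
  constructor
  · rintro ⟨t, rfl⟩
    exact ⟨⟨t, rfl⟩, ⟨(t⁻¹ : (X.presheaf.stalk x)ˣ), by rw [← map_inv]; rfl⟩⟩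
  · rintro ⟨⟨a, ha⟩, ⟨b, hb⟩⟩
    have hinj : Function.Injective (algebraMap (X.presheaf.stalk x) X.functionField) :=
      IsFractionRing.injective _ _
    have hab : a * b = 1 := hinj (by rw [map_mul, ha, hb, map_one, Units.mul_inv])
    exact ⟨⟨a, b, hab, by rw [mul_comm, hab]⟩, Units.ext ha⟩

end Stalks

/-! ### Distinguished points, and invariant divisors -/

section Distinguished

variable {N : Type u} [AddCommGroup N] (k : Type u) [Field k] {Δ : Fan N}

/-- `m` vanishes on the cone `σ`. -/
def VanishesOn (m : DualLattice N) (σ : PointedCone ℝ (RealSpace N)) : Prop :=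
  ∀ v ∈ σ, charPairing N m v = 0

lemma vanishesOn_add_iff {σ : PointedCone ℝ (RealSpace N)} {a b : DualLattice N}
    (ha : a ∈ coneMonoid σ) (hb : b ∈ coneMonoid σ) :
    VanishesOn (a + b) σ ↔ VanishesOn a σ ∧ VanishesOn b σ := by
  constructor
  · intro h
    refine ⟨fun v hv => ?_, fun v hv => ?_⟩ <;>
    · have h1 := h v hv
      have h2 := ha v hv
      have h3 := hb v hv
      rw [map_add, LinearMap.add_apply] at h1
      linarith
  · rintro ⟨h1, h2⟩ v hv
    rw [map_add, LinearMap.add_apply, h1 v hv, h2 v hv, add_zero]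

lemma VanishesOn.mem {m : DualLattice N} {σ : PointedCone ℝ (RealSpace N)}
    (h : VanishesOn m σ) : m ∈ coneMonoid σ := fun v hv => (h v hv).ge

lemma VanishesOn.neg {m : DualLattice N} {σ : PointedCone ℝ (RealSpace N)}
    (h : VanishesOn m σ) : VanishesOn (-m) σ := fun v hv => by
  rw [map_neg, LinearMap.neg_apply, h v hv, neg_zero]

lemma VanishesOn.isUnit_chi {m : DualLattice N} {σ : PointedCone ℝ (RealSpace N)}
    (h : VanishesOn m σ) : IsUnit (chi k (⟨m, h.mem⟩ : coneMonoid σ)) := by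
  refine IsUnit.of_mul_eq_one (chi k (⟨-m, h.neg.mem⟩ : coneMonoid σ)) ?_
  rw [← chi_add, ← chi_zero]
  congr 1
  ext
  simp

open Classical in
/-- The distinguished point of `U_σ` as a homomorphism `k[σ_M] → k`: it sends `χ(m)` to one if `m`
vanishes on `σ` and to zero otherwise. -/
def distinguishedHom (σ : PointedCone ℝ (RealSpace N)) :
    SemigroupRing k (coneMonoid σ) →ₐ[k] k :=
  AddMonoidAlgebra.lift k k (coneMonoid σ)
    { toFun := fun m => if VanishesOn m.toAdd.1 σ then 1 else 0
      map_one' := if_pos fun v _ => by simp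
      map_mul' := fun a b => by
        have := vanishesOn_add_iff a.toAdd.2 b.toAdd.2
        simp only [toAdd_mul, AddSubmonoid.coe_add, this]
        split_ifs <;> simp_all }

lemma distinguishedHom_chi_of_not {σ : PointedCone ℝ (RealSpace N)} {m : coneMonoid σ}
    (h : ¬ VanishesOn m.1 σ) : distinguishedHom k σ (chi k m) = 0 := by
  rw [distinguishedHom, chi, AddMonoidAlgebra.lift_single, one_smul]
  exact if_neg h

lemma exists_vanishesOn_of_distinguishedHom_ne {σ : PointedCone ℝ (RealSpace N)}
    {f : SemigroupRing k (coneMonoid σ)} (h : distinguishedHom k σ f ≠ 0) :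
    ∃ m, f.coeff m ≠ 0 ∧ VanishesOn m.1 σ := by
  by_contra! H
  refine h ?_
  rw [distinguishedHom, AddMonoidAlgebra.lift_apply]
  refine Finset.sum_eq_zero fun m hm => ?_
  exact (congrArg (f.coeff m • ·) (if_neg (H m (Finsupp.mem_support_iff.1 hm)))).trans
    (smul_zero _)

/-- The distinguished point `x_σ` of the chart `U_σ`. -/
def distinguishedPt (σ : Δ.cones) : affineChart k σ.1 :=
  (⟨RingHom.ker (distinguishedHom k σ.1), RingHom.ker_isPrime _⟩ : PrimeSpectrum _)

lemma charUnit_mul_chartToFunctionField (m : DualLattice N) (σ : Δ.cones)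
    (hm : m ∈ coneMonoid σ.1) (f : SemigroupRing k (coneMonoid σ.1)) :
    (charUnit k Δ (.ofAdd m) : (toricVariety k Δ).functionField) * chartToFunctionField k Δ σ f =
      chartToFunctionField k Δ σ (chi k ⟨m, hm⟩ * f) := by
  rw [map_mul, charUnit_val k Δ σ m hm]

lemma mem_coneMonoid_zeroCone (m : DualLattice N) : m ∈ coneMonoid (zeroCone Δ).1 :=
  fun v hv => by rw [(Submodule.mem_bot _).1 hv, map_zero]

lemma zeroCone_le (σ : Δ.cones) : (zeroCone Δ).1 ≤ σ.1 :=
  (bot_le : (⊥ : PointedCone ℝ (RealSpace N)) ≤ σ.1)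

lemma coeff_ringIncl {L : Type u} [AddCommGroup L] {A B : AddSubmonoid L} (h : A ≤ B)
    (f : SemigroupRing k A) (a : A) :
    (ringIncl k h f).coeff (AddSubmonoid.inclusion h a) = f.coeff a :=
  Finsupp.mapDomain_apply (AddSubmonoid.inclusion_injective h) _ _

lemma mem_of_coeff_ringIncl_ne {L : Type u} [AddCommGroup L] {A B : AddSubmonoid L} (h : A ≤ B)
    {f : SemigroupRing k A} {b : B} (hb : (ringIncl k h f).coeff b ≠ 0) : b.1 ∈ A := by
  by_contra hn
  refine hb (Finsupp.mapDomain_of_notMem_range _ _ ?_)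
  rintro ⟨a, rfl⟩
  exact hn a.2

/-- A character is regular at the distinguished point of `U_σ` if and only if it is nonnegative
on `σ`. -/
lemma charUnit_mem_localSubring_distinguishedPt (σ : Δ.cones) (m : DualLattice N) :
    (charUnit k Δ (.ofAdd m) : (toricVariety k Δ).functionField) ∈
      localSubring (toricVariety k Δ) (chartMap k Δ σ (distinguishedPt k σ)) ↔
    m ∈ coneMonoid σ.1 := by
  constructor
  · intro h
    obtain ⟨a, b, hb, hab⟩ := (mem_localSubring_iff k Δ σ _ _).1 h
    obtain ⟨m', hm', hv⟩ := exists_vanishesOn_of_distinguishedHom_ne k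
      (show distinguishedHom k σ.1 b ≠ 0 from hb)
    rw [← chartToFunctionField_comp k Δ (zeroCone_le σ), RingHom.comp_apply, RingHom.comp_apply,
      charUnit_mul_chartToFunctionField k m _ (mem_coneMonoid_zeroCone m)] at hab
    have hab := chartToFunctionField_injective k Δ _ hab
    have hinc := dualMonoid_anti (charPairing N) (zeroCone_le σ)
    let e : coneMonoid (zeroCone Δ).1 := ⟨m, mem_coneMonoid_zeroCone m⟩
    have hc : (ringIncl k hinc a).coeff (e + AddSubmonoid.inclusion hinc m') ≠ 0 := by
      rw [← hab, chi, AddMonoidAlgebra.coeff_single_mul_eq_mul_coeff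
        (AddSubmonoid.inclusion hinc m'), one_mul, coeff_ringIncl]
      · exact hm'
      · intro x _
        rw [Subtype.ext_iff, Subtype.ext_iff]
        exact add_right_inj m
    have hmem := mem_of_coeff_ringIncl_ne k hinc hc
    intro v hv'
    have h1 := hmem v hv'
    have h2 := hv v hv'
    change 0 ≤ charPairing N (m + m'.1) v at h1
    rw [map_add, LinearMap.add_apply, h2, add_zero] at h1
    exact h1
  · intro h
    rw [charUnit_val k Δ σ m h]
    exact chartToFunctionField_mem k Δ σ ⟨_, rfl⟩ _

/-- A character is invertible at the distinguished point of `U_σ` if and only if it vanishes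
on `σ`. -/
lemma charUnit_mem_stalkUnits_distinguishedPt (σ : Δ.cones) (m : DualLattice N) :
    charUnit k Δ (.ofAdd m) ∈
      stalkUnits (toricVariety k Δ) (chartMap k Δ σ (distinguishedPt k σ)) ↔
    VanishesOn m σ.1 := by
  rw [mem_stalkUnits_iff, ← map_inv, ← ofAdd_neg, charUnit_mem_localSubring_distinguishedPt,
    charUnit_mem_localSubring_distinguishedPt]
  constructor
  · rintro ⟨h1, h2⟩ v hv
    have h3 := h1 v hv
    have h4 := h2 v hv
    rw [map_neg, LinearMap.neg_apply] at h4
    linarith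
  · exact fun h => ⟨h.mem, h.neg.mem⟩

/-- The distinguished point of `U_ρ` lies on `D_ρ`. -/
lemma distinguishedPt_mem_primeDivisor (ρ : Δ.Ray) :
    chartMap k Δ ρ.cone (distinguishedPt k ρ.cone) ∈ primeDivisor k ρ := by
  refine subset_closure ⟨_, fun m hm => ?_, rfl⟩
  refine distinguishedHom_chi_of_not k fun h => hm ?_
  have := h _ ρ.genPt_mem
  rw [charPairing_latticePt] at this
  exact_mod_cast this

/-- If the closed orbit of `U_ρ` meets `U_τ`, then `ρ` is a ray of `τ`. -/
lemma isRayOf_of_mem_opensRange {ρ : Δ.Ray} {τ : Δ.cones} {y : affineChart k ρ.cone.1}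
    (hy : ∀ m : coneMonoid ρ.cone.1, m.1 ρ.gen ≠ 0 → chi k m ∈ PrimeSpectrum.asIdeal y)
    (h : chartMap k Δ ρ.cone y ∈ (chartMap k Δ τ).opensRange) : ρ.IsRayOf τ := by
  obtain ⟨π, h1, h2, z, hz⟩ := exists_chart_le k Δ (⟨y, rfl⟩ :
    chartMap k Δ ρ.cone y ∈ (chartMap k Δ ρ.cone).opensRange) h
  obtain ⟨u, hu, hπ⟩ := Δ.isFace_of_le π.2 ρ.cone.2 h1
  have hzy : chartIncl k h1 z = y := by
    apply (chartMap k Δ ρ.cone).isOpenEmbedding.injective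
    rw [← hz, ← chart_w k Δ h1]
    rfl
  have hyr : y ∈ Set.range ((chartFunctor k Δ).map (homOfLE h1 : π ⟶ ρ.cone)) := ⟨z, hzy⟩
  rw [range_chartFunctor_map k Δ (homOfLE h1 : π ⟶ ρ.cone) hu hπ] at hyr
  have hu0 : u ρ.gen = 0 := not_not.1 fun h0 => hyr (hy ⟨u, hu⟩ h0)
  have hmem : latticePt ρ.gen ∈ π.1 := (hπ _).2 ⟨ρ.genPt_mem, by
    rw [charPairing_latticePt, hu0, Int.cast_zero]⟩
  refine Submodule.span_le.2 ?_
  rintro _ rfl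
  exact h2 hmem

/-- `D_ρ` does not meet the charts `U_τ` with `ρ ∉ τ(1)`. -/
lemma isRayOf_of_mem_primeDivisor {ρ : Δ.Ray} {τ : Δ.cones} {x : toricVariety k Δ}
    (hx : x ∈ (chartMap k Δ τ).opensRange) (h : x ∈ primeDivisor k ρ) : ρ.IsRayOf τ := by
  obtain ⟨_, hz, ⟨y, hy, rfl⟩⟩ :=
    mem_closure_iff.1 h _ (chartMap k Δ τ).opensRange.isOpen hx
  exact isRayOf_of_mem_opensRange k hy hz

lemma Fan.Ray.vanishesOn_iff {ρ : Δ.Ray} {m : DualLattice N} :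
    VanishesOn m ρ.cone.1 ↔ m ρ.gen = 0 := by
  constructor
  · intro h
    have := h _ ρ.genPt_mem
    rw [charPairing_latticePt] at this
    exact_mod_cast this
  · intro h v hv
    obtain ⟨r, rfl⟩ := Submodule.mem_span_singleton.1 hv
    change charPairing N m ((r : ℝ) • latticePt ρ.1) = 0
    rw [map_smul, charPairing_latticePt, show m ρ.1 = 0 from h, Int.cast_zero, smul_zero]

/-- If `X_Δ` has enough invariant Cartier divisors, then for every `σ ∈ Δ` some support function
vanishes at the rays of `σ` and is positive at all other rays. -/
lemma exists_supportFunction (henough : HasEnoughInvariantCartierDivisors k Δ) (σ : Δ.cones) :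
    ∃ h : SupportFunction Δ, (∀ ρ : Δ.Ray, ρ.IsRayOf σ → h.1 ρ.genPt = 0) ∧
      ∀ ρ : Δ.Ray, ¬ ρ.IsRayOf σ → 0 < h.1 ρ.genPt := by
  obtain ⟨D, ⟨h, hD⟩, heff, hsupp⟩ := henough σ
  have hD' : D = (invariantDivisor k h).toMul := by rw [hD]; rfl
  -- the local equation of `D` at the distinguished point of `U_ρ` is a character, whose regularity
  -- and invertibility there are governed by the sign of `h(n(ρ))`
  have hloc : ∀ ρ : Δ.Ray, D.1 (chartMap k Δ ρ.cone (distinguishedPt k ρ.cone)) =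
      charUnit k Δ (.ofAdd (localChar h ρ.cone)) := fun ρ => by
    rw [hD']
    exact divisorFun_eq k h ρ.cone ⟨_, rfl⟩ _ (represents_localChar h _)
  have hval : ∀ ρ : Δ.Ray, h.1 ρ.genPt = localChar h ρ.cone ρ.gen := fun ρ =>
    (represents_localChar h ρ.cone).gen le_rfl
  have hzero : ∀ ρ : Δ.Ray, h.1 ρ.genPt = 0 ↔
      chartMap k Δ ρ.cone (distinguishedPt k ρ.cone) ∉ divisorSupport D := fun ρ => by
    rw [hval, Int.cast_eq_zero, ← Fan.Ray.vanishesOn_iff,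
      ← charUnit_mem_stalkUnits_distinguishedPt k, divisorSupport, Set.mem_ofPred_eq, not_not, hloc]
    exact (QuotientGroup.eq_one_iff _).symm
  have hnonneg : ∀ ρ : Δ.Ray, 0 ≤ h.1 ρ.genPt := fun ρ => by
    obtain ⟨f, hf, hreg⟩ := heff (chartMap k Δ ρ.cone (distinguishedPt k ρ.cone))
    rw [hloc] at hf
    have hu := (mem_stalkUnits_iff _ _ _).1 (QuotientGroup.eq.1 hf.symm)
    have hmem := mul_mem hreg hu.1
    rw [← Units.val_mul, mul_inv_cancel_left] at hmem
    have := (charUnit_mem_localSubring_distinguishedPt k ρ.cone _).1 hmem _ ρ.genPt_mem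
    rw [charPairing_latticePt] at this
    rw [hval]
    exact this
  refine ⟨h, fun ρ hρ => ?_, fun ρ hρ => (hnonneg ρ).lt_of_ne fun h0 => ?_⟩
  · rw [hzero, hsupp]
    simp only [Set.mem_iUnion, not_exists]
    intro ρ' hρ' hmem
    exact hρ' ((isRayOf_of_mem_primeDivisor k ⟨_, rfl⟩ hmem).trans hρ)
  · refine (hzero ρ).1 h0.symm ?_
    rw [hsupp]
    exact Set.mem_biUnion (show ρ ∈ {ρ : Δ.Ray | ¬ ρ.IsRayOf σ} from hρ)
      (distinguishedPt_mem_primeDivisor k ρ)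

end Distinguished

/-! ### The kernel of the class map -/

section ClassMap

/-- A unit of `k[A]` is a monomial: otherwise the product with its inverse has two terms which
do not cancel. -/
lemma exists_eq_single_of_mul_eq_one {k A : Type u} [Field k] [AddCommMonoid A] [TwoUniqueSums A]
    {a b : AddMonoidAlgebra k A} (hab : a * b = 1) :
    ∃ (m : A) (c : k), c ≠ 0 ∧ a = AddMonoidAlgebra.single m c := by
  have ha : a ≠ 0 := left_ne_zero_of_mul_eq_one hab
  have hcard : ¬ 1 < a.coeff.support.card * b.coeff.support.card := by
    intro h
    obtain ⟨p, hp, q, hq, hpq, hup, huq⟩ := TwoUniqueSums.uniqueAdd_of_one_lt_card h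
    rw [Finset.mem_product] at hp hq
    have key : ∀ r : A × A, r.1 ∈ a.coeff.support → r.2 ∈ b.coeff.support →
        UniqueAdd a.coeff.support b.coeff.support r.1 r.2 → r.1 + r.2 = 0 := by
      intro r h1 h2 hr
      have h3 := AddMonoidAlgebra.coeff_mul_add_of_uniqueAdd hr
      rw [hab, AddMonoidAlgebra.one_def, AddMonoidAlgebra.coeff_single] at h3
      by_contra h0
      rw [Finsupp.single_eq_of_ne h0] at h3
      exact mul_ne_zero (Finsupp.mem_support_iff.1 h1) (Finsupp.mem_support_iff.1 h2) h3.symm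
    have h1 := key p hp.1 hp.2 hup
    have h2 := key q hq.1 hq.2 huq
    have := hup hq.1 hq.2 (h2.trans h1.symm)
    exact hpq (Prod.ext this.1.symm this.2.symm)
  have hb : b ≠ 0 := right_ne_zero_of_mul_eq_one hab
  have hb' : 0 < b.coeff.support.card := Finset.card_pos.2 (Finsupp.support_nonempty_iff.2
    (AddMonoidAlgebra.coeff_eq_zero.not.2 hb))
  have ha' : a.coeff.support.card ≤ 1 := by nlinarith
  have ha'' : 0 < a.coeff.support.card := Finset.card_pos.2 (Finsupp.support_nonempty_iff.2
    (AddMonoidAlgebra.coeff_eq_zero.not.2 ha))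
  obtain ⟨m, c, hc, h⟩ := Finsupp.card_support_eq_one'.1 (le_antisymm ha' ha'')
  exact ⟨m, c, hc, AddMonoidAlgebra.coeff_injective h⟩

variable {N : Type u} [AddCommGroup N] (k : Type u) [Field k] {Δ : Fan N}

/-- A rational function which is regular on the chart `U_σ` lies in `k[σ_M]`. -/
lemma exists_chartToFunctionField_eq (σ : Δ.cones) (z : (toricVariety k Δ).functionField)
    (hz : ∀ q, z ∈ localSubring (toricVariety k Δ) (chartMap k Δ σ q)) :
    ∃ a, chartToFunctionField k Δ σ a = z := by
  -- the ideal of denominators of `z`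
  let I : Ideal (SemigroupRing k (coneMonoid σ.1)) :=
    { carrier := {b | ∃ a, chartToFunctionField k Δ σ a = z * chartToFunctionField k Δ σ b}
      zero_mem' := ⟨0, by simp⟩
      add_mem' := by
        rintro b b' ⟨a, ha⟩ ⟨a', ha'⟩
        exact ⟨a + a', by rw [map_add, map_add, ha, ha', mul_add]⟩
      smul_mem' := by
        rintro c b ⟨a, ha⟩
        exact ⟨c * a, by rw [smul_eq_mul, map_mul, map_mul, ha, mul_left_comm]⟩ }
  have hI : I = ⊤ := by
    by_contra h
    obtain ⟨P, hP, hle⟩ := Ideal.exists_le_maximal I h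
    obtain ⟨a, b, hb, hab⟩ := (mem_localSubring_iff k Δ σ
      (⟨P, hP.isPrime⟩ : PrimeSpectrum _) z).1 (hz _)
    exact hb (hle ⟨a, hab.symm⟩)
  obtain ⟨a, ha⟩ := (Ideal.eq_top_iff_one I).1 hI
  exact ⟨a, by rw [ha, map_one, mul_one]⟩

lemma chartToFunctionField_algebraMap (σ : Δ.cones) (c : k) :
    chartToFunctionField k Δ σ (algebraMap k _ c) =
      chartToFunctionField k Δ (zeroCone Δ) (algebraMap k _ c) := by
  rw [← chartToFunctionField_comp k Δ (zeroCone_le σ), RingHom.comp_apply]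
  congr 1
  exact ringIncl_single k _ 0 c

lemma invariantDivisor_linearSF (m : DualLattice N) :
    (invariantDivisor k (linearSF Δ m)).toMul =
      principalDivisor (toricVariety k Δ) (charUnit k Δ (.ofAdd m)) := by
  refine Subtype.ext (funext fun x => ?_)
  obtain ⟨σ, hσ⟩ := exists_chart k Δ x
  exact divisorFun_eq k (linearSF Δ m) σ hσ m (represents_linearSF m σ)

/-- The divisor `D_h` is principal if and only if `h` is linear: a rational function with divisor
`D_h` is a unit on the torus, hence a multiple of a character. -/
lemma picClass_eq_zero_iff (h : SupportFunction Δ) :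
    picClass k Δ h = 0 ↔ ∃ m, linearSF Δ m = h := by
  have hpic : picClass k Δ h = 0 ↔ (invariantDivisor k h).toMul ∈
      (principalDivisor (toricVariety k Δ)).range := QuotientGroup.eq_one_iff _
  rw [hpic]
  constructor
  · rintro ⟨f, hf⟩
    have hloc : ∀ (σ : Δ.cones) (q), (charUnit k Δ (.ofAdd (localChar h σ)))⁻¹ * f ∈
        stalkUnits (toricVariety k Δ) (chartMap k Δ σ q) := fun σ q => by
      refine QuotientGroup.eq.1 ?_
      rw [← divisorFun_eq k h σ ⟨q, rfl⟩ _ (represents_localChar h σ)]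
      exact (congrFun (congrArg Subtype.val hf) _).symm
    have hf0 : ∀ q, f ∈ stalkUnits (toricVariety k Δ) (chartMap k Δ (zeroCone Δ) q) := fun q => by
      have := mul_mem (charUnit_mem_stalkUnits k Δ (zeroCone Δ) ⟨q, rfl⟩
        (localChar h (zeroCone Δ)) fun v hv => by
          rw [(Submodule.mem_bot _).1 hv, map_zero]) (hloc (zeroCone Δ) q)
      rwa [mul_inv_cancel_left] at this
    obtain ⟨a, ha⟩ := exists_chartToFunctionField_eq k (zeroCone Δ) _
      fun q => ((mem_stalkUnits_iff _ _ _).1 (hf0 q)).1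
    obtain ⟨b, hb⟩ := exists_chartToFunctionField_eq k (zeroCone Δ) _
      fun q => ((mem_stalkUnits_iff _ _ _).1 (hf0 q)).2
    have hab : a * b = 1 := chartToFunctionField_injective k Δ _ (by
      rw [map_mul, ha, hb, map_one, Units.mul_inv])
    have : TwoUniqueSums (coneMonoid (zeroCone Δ).1) :=
      TwoUniqueSums.of_injective_addHom
        (f := ({ toFun := fun a n => a.1 n, map_add' := fun _ _ => rfl } :
          coneMonoid (zeroCone Δ).1 →ₙ+ (N → ℤ)))
        (fun _ _ h => Subtype.ext (LinearMap.ext fun n => congrFun h n)) inferInstance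
    obtain ⟨m, c, hc, rfl⟩ := exists_eq_single_of_mul_eq_one hab
    have hconst : ∀ c : k, ∀ (σ : Δ.cones) (q), chartToFunctionField k Δ (zeroCone Δ)
        (algebraMap k _ c) ∈ localSubring (toricVariety k Δ) (chartMap k Δ σ q) := fun c σ q => by
      rw [← chartToFunctionField_algebraMap k σ]
      exact chartToFunctionField_mem k Δ σ ⟨q, rfl⟩ _
    let u : (toricVariety k Δ).functionFieldˣ :=
      Units.map ((chartToFunctionField k Δ (zeroCone Δ)).comp (algebraMap k _)).toMonoidHom
        (Units.mk0 c hc)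
    have hu : ∀ (σ : Δ.cones) (q), u ∈ stalkUnits (toricVariety k Δ) (chartMap k Δ σ q) :=
      fun σ q => (mem_stalkUnits_iff _ _ _).2 ⟨hconst c σ q, hconst c⁻¹ σ q⟩
    have hfu : f = charUnit k Δ (.ofAdd m.1) * u := by
      refine Units.ext ?_
      rw [← ha, Units.val_mul, charUnit_val k Δ _ _ m.2]
      change _ = _ * chartToFunctionField k Δ (zeroCone Δ) (algebraMap k _ c)
      rw [← map_mul]
      congr 1
      change _ = AddMonoidAlgebra.single m 1 * AddMonoidAlgebra.single 0 c
      rw [AddMonoidAlgebra.single_mul_single, add_zero, one_mul]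
    refine ⟨m.1, Subtype.ext (funext ?_)⟩
    rintro ⟨v, σ, hσ, hv⟩
    have h1 := mul_mem (hloc ⟨σ, hσ⟩ (distinguishedPt k ⟨σ, hσ⟩))
      (inv_mem (hu ⟨σ, hσ⟩ (distinguishedPt k ⟨σ, hσ⟩)))
    rw [hfu, mul_assoc, mul_inv_cancel_right, ← map_inv, ← map_mul, ← ofAdd_neg, ← ofAdd_add,
      charUnit_mem_stalkUnits_distinguishedPt] at h1
    have h2 := h1 v hv
    rw [map_add, map_neg, LinearMap.add_apply, LinearMap.neg_apply, neg_add_eq_zero] at h2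
    rw [represents_localChar h ⟨σ, hσ⟩ _ hv]
    exact h2.symm
  · rintro ⟨m, rfl⟩
    exact ⟨_, (invariantDivisor_linearSF k m).symm⟩

end ClassMap

/-! ### Separating support functions and the irrelevant ideal -/

section Separating

variable {N : Type u} [AddCommGroup N] {Δ : Fan N}

/-- `h` vanishes at the rays of `σ` and is positive at all other rays, i.e. `D_h` is effective with
support the union of the `D_ρ`, `ρ ∉ σ(1)`. -/
structure IsSeparating (σ : Δ.cones) (h : SupportFunction Δ) : Prop where
  eq_zero : ∀ ρ : Δ.Ray, ρ.IsRayOf σ → h.1 ρ.genPt = 0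
  pos : ∀ ρ : Δ.Ray, ¬ ρ.IsRayOf σ → 0 < h.1 ρ.genPt

lemma IsSeparating.mem {σ : Δ.cones} {h : SupportFunction Δ} (hh : IsSeparating σ h) :
    h ∈ coxMonoid Δ := mem_coxMonoid_iff.2 fun ρ => by
  by_cases hρ : ρ.IsRayOf σ
  · exact (hh.eq_zero ρ hρ).ge
  · exact (hh.pos ρ hρ).le

lemma neg_mem_hatMonoid {σ : Δ.cones} {h : SupportFunction Δ}
    (hh : ∀ ρ : Δ.Ray, ρ.IsRayOf σ → h.1 ρ.genPt = 0) :
    -h ∈ dualMonoid (sfPairing Δ) (hatCone Δ σ) :=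
  mem_hatMonoid_iff.2 fun ρ hρ => by
    change 0 ≤ -h.1 ρ.genPt
    rw [hh ρ hρ, neg_zero]

variable [Module.Free ℤ N] [Module.Finite ℤ N]

lemma IsSeparating.exists_add_nsmul_mem {σ : Δ.cones} {h : SupportFunction Δ}
    (hh : IsSeparating σ h) {b : SupportFunction Δ}
    (hb : b ∈ dualMonoid (sfPairing Δ) (hatCone Δ σ)) :
    ∃ n : ℕ, b + n • h ∈ coxMonoid Δ := by
  have hb := mem_hatMonoid_iff.1 hb
  have H : ∀ ρ : Δ.Ray, ∃ n : ℕ, ∀ n' ≥ n, 0 ≤ b.1 ρ.genPt + n' * h.1 ρ.genPt := by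
    intro ρ
    by_cases hρ : ρ.IsRayOf σ
    · exact ⟨0, fun n' _ => by rw [hh.eq_zero ρ hρ, mul_zero, add_zero]; exact hb ρ hρ⟩
    · obtain ⟨n, hn⟩ := exists_nat_ge (-b.1 ρ.genPt / h.1 ρ.genPt)
      refine ⟨n, fun n' hn' => ?_⟩
      have h1 : (n : ℝ) ≤ n' := by exact_mod_cast hn'
      have h2 := (div_le_iff₀ (hh.pos ρ hρ)).1 (hn.trans h1)
      linarith
  choose n hn using H
  have := Fintype.ofFinite Δ.Ray
  refine ⟨∑ ρ, n ρ, mem_coxMonoid_iff.2 fun ρ => ?_⟩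
  have := hn ρ (∑ ρ, n ρ) (Finset.single_le_sum (f := n) (fun _ _ => Nat.zero_le _)
    (Finset.mem_univ ρ))
  simpa using this

variable (k : Type u) [Field k]

/-- `U_σ̂` is the principal open subset of `Spec S` on which `χ(h)` is invertible. -/
lemma IsSeparating.hatChart_eq {σ : Δ.cones} {h : SupportFunction Δ} (hh : IsSeparating σ h) :
    hatChart k Δ σ = (PrimeSpectrum.basicOpen (chi k (⟨h, hh.mem⟩ : coxMonoid Δ)) :
      Set (PrimeSpectrum (coxRing k Δ))) := by
  let _ : Algebra (coxRing k Δ) (SemigroupRing k (dualMonoid (sfPairing Δ) (hatCone Δ σ))) :=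
    (ringIncl k (dualMonoid_anti (sfPairing Δ) (hatCone_le Δ σ))).toAlgebra
  have := isLocalization_ringIncl k (dualMonoid_anti (sfPairing Δ) (hatCone_le Δ σ))
    ⟨h, hh.mem⟩ (neg_mem_hatMonoid hh.eq_zero) fun _ hb => hh.exists_add_nsmul_mem hb
  exact PrimeSpectrum.localization_away_comap_range _ (chi k (⟨h, hh.mem⟩ : coxMonoid Δ))

lemma IsSeparating.irrelevantPart_le_iff {σ : Δ.cones} {h : SupportFunction Δ}
    (hh : IsSeparating σ h) (p : PrimeSpectrum (coxRing k Δ)) :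
    irrelevantPart k Δ σ ≤ p.asIdeal ↔ chi k (⟨h, hh.mem⟩ : coxMonoid Δ) ∈ p.asIdeal := by
  have h1 : irrelevantPart k Δ σ ≤ p.asIdeal ↔
      p ∈ PrimeSpectrum.zeroLocus (irrelevantPart k Δ σ : Set (coxRing k Δ)) := Iff.rfl
  rw [h1, irrelevantPart, PrimeSpectrum.zeroLocus_vanishingIdeal_eq_closure, hh.hatChart_eq k,
    (PrimeSpectrum.basicOpen _).isOpen.isClosed_compl.closure_eq]
  exact not_not

lemma irrelevantIdeal_le_iff {η : Δ.cones → SupportFunction Δ} (hη : ∀ σ, IsSeparating σ (η σ))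
    (p : PrimeSpectrum (coxRing k Δ)) :
    irrelevantIdeal k Δ ≤ p.asIdeal ↔
      ∀ σ, chi k (⟨η σ, (hη σ).mem⟩ : coxMonoid Δ) ∈ p.asIdeal := by
  rw [irrelevantIdeal, iSup_le_iff]
  exact forall_congr' fun σ => (hη σ).irrelevantPart_le_iff k p

instance isDomain_coxRing : IsDomain (coxRing k Δ) :=
  have : UniqueSums (coxMonoid Δ) := UniqueSums.of_injective_addHom
    (f := ({ toFun := fun a => a.1.1, map_add' := fun _ _ => rfl } :
      coxMonoid Δ →ₙ+ (Δ.support → ℝ)))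
    (fun _ _ h => Subtype.ext (Subtype.ext h)) inferInstance
  NoZeroDivisors.to_isDomain _

end Separating

/-! ### Dehomogenization -/

section Dehomogenization

variable {N : Type u} [AddCommGroup N] {Δ : Fan N}

/-- A retraction of `M → SF(N, Δ)` which computes the restriction of support functions
to the cone `σ`. -/
structure LinearRetraction (σ : Δ.cones) where
  toHom : SupportFunction Δ →+ DualLattice N
  apply_linearSF : ∀ m, toHom (linearSF Δ m) = m
  represents : ∀ h, Represents h σ (toHom h)

/-- A homomorphism to a free group whose image is already attained on a subgroup `V` has a
section on its image with values in `V`. -/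
lemma exists_section {A P : Type u} [AddCommGroup A] [Module.Finite ℤ A] [AddCommGroup P]
    [Module.Free ℤ P] (d : A →+ P) (V : AddSubgroup A) (hV : ∀ a, ∃ v ∈ V, d v = d a) :
    ∃ s : A →+ A, ∀ a, s a ∈ V ∧ d (s a) = d a ∧ (d a = 0 → s a = 0) := by
  let d' : A →ₗ[ℤ] P := d.toIntLinearMap
  have : Module.Finite ℤ d'.range := inferInstance
  have : Module.Free ℤ d'.range := Module.free_of_finite_type_torsion_free'
  let g : V →ₗ[ℤ] d'.range :=
    (d'.rangeRestrict.toAddMonoidHom.comp V.subtype).toIntLinearMap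
  have hsurj : Function.Surjective g := by
    rintro ⟨_, a, rfl⟩
    obtain ⟨v, hv, hva⟩ := hV a
    exact ⟨⟨v, hv⟩, Subtype.ext hva⟩
  obtain ⟨s, hs⟩ := Module.projective_lifting_property g LinearMap.id hsurj
  refine ⟨V.subtype.comp (s.toAddMonoidHom.comp d'.rangeRestrict.toAddMonoidHom), fun a =>
    ⟨(s _).2, congrArg Subtype.val (LinearMap.congr_fun hs (d'.rangeRestrict a)), fun ha => ?_⟩⟩
  have h0 : d'.rangeRestrict a = 0 := Subtype.ext ha
  change (s (d'.rangeRestrict a)).1 = 0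
  rw [h0, map_zero]
  rfl

/-- As `Pic(X_Δ)` is free, the image of `SF(N, Δ)` in it lifts to the support functions
vanishing on `σ`, which splits `M → SF(N, Δ)`. -/
lemma nonempty_linearRetraction [Module.Free ℤ N] [Module.Finite ℤ N] {k : Type u} [Field k]
    (hspan : Δ.SpansSpace) (hfree : Module.Free ℤ (Pic (toricVariety k Δ))) (σ : Δ.cones) :
    Nonempty (LinearRetraction σ) := by
  let V : AddSubgroup (SupportFunction Δ) :=
    { carrier := {h | ∀ v : Δ.support, v.1 ∈ σ.1 → h.1 v = 0}
      zero_mem' := fun v _ => rfl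
      add_mem' := fun {a b} ha hb v hv => by
        change a.1 v + b.1 v = 0
        rw [ha v hv, hb v hv, add_zero]
      neg_mem' := fun {a} ha v hv => by
        change -a.1 v = 0
        rw [ha v hv, neg_zero] }
  obtain ⟨s, hs⟩ := exists_section (picClass k Δ) V fun h => by
    refine ⟨h - linearSF Δ (localChar h σ), fun v hv => ?_, ?_⟩
    · change h.1 v - charPairing N _ v = 0
      rw [represents_localChar h σ v hv, sub_self]
    · rw [map_sub, (picClass_eq_zero_iff k (linearSF Δ (localChar h σ))).2 ⟨_, rfl⟩, sub_zero]
  have hker : ∀ h, ∃ m, linearSF Δ m = h - s h := fun h => by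
    refine (picClass_eq_zero_iff k _).1 ?_
    rw [map_sub, (hs h).2.1, sub_self]
  choose r hr using hker
  -- `h - s(h)` is linear; this linear function is the value of the retraction at `h`
  have hinj := linearSF_injective hspan
  refine ⟨⟨⟨⟨r, hinj ?_⟩, fun a b => hinj ?_⟩, fun m => hinj ?_, fun h v hv => ?_⟩⟩
  · simp [hr]
  · simp only [hr, map_add]
    abel
  · change linearSF Δ (r _) = _
    rw [hr, (hs _).2.2 ((picClass_eq_zero_iff k (linearSF Δ m)).2 ⟨m, rfl⟩), sub_zero]
  · have h1 : (linearSF Δ (r h)).1 v = h.1 v - (s h).1 v := by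
      rw [hr]; rfl
    rw [(hs h).1 v hv, sub_zero] at h1
    exact h1.symm

lemma single_mem_coxGrading {k : Type u} [Field k] {i : Pic (toricVariety k Δ)} {h : coxMonoid Δ}
    (hi : picClass k Δ h.1 = i) (c : k) :
    (AddMonoidAlgebra.single h c : coxRing k Δ) ∈ coxGrading k Δ i := by
  intro x hx
  obtain rfl := Finset.mem_singleton.1 (Finsupp.support_single_subset hx)
  exact hi

lemma chi_pow_mem_coxGrading (k : Type u) [Field k] (h : coxMonoid Δ) (n : ℕ) :
    chi k h ^ n ∈ coxGrading k Δ (picClass k Δ (n • h.1)) := by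
  rw [← chi_nsmul]
  exact single_mem_coxGrading (congrArg (picClass k Δ) (AddSubmonoidClass.coe_nsmul h n)) 1

lemma mul_chi_pow_mem_coxGrading (k : Type u) [Field k] (h : coxMonoid Δ) {m n : ℕ}
    {f : coxRing k Δ} (hf : f ∈ coxGrading k Δ (picClass k Δ (m • h.1))) :
    f * chi k h ^ n ∈ coxGrading k Δ (picClass k Δ ((m + n) • h.1)) := by
  have e : picClass k Δ (m • h.1) + picClass k Δ (n • h.1) = picClass k Δ ((m + n) • h.1) :=
    (map_add (picClass k Δ) _ _).symm.trans (congrArg _ (add_nsmul h.1 m n).symm)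
  exact e ▸ SetLike.GradedMul.mul_mem hf (chi_pow_mem_coxGrading k h n)

/-- Additive maps on `S` which agree on the monomials of degree `i` agree on all homogeneous
elements of degree `i`. -/
lemma homogeneous_hom_ext (k : Type u) [Field k] {A : Type u} [AddCommMonoid A]
    {F G : coxRing k Δ →+ A} {i : Pic (toricVariety k Δ)}
    (H : ∀ (h : coxMonoid Δ) (c : k), picClass k Δ h.1 = i →
      F (AddMonoidAlgebra.single h c) = G (AddMonoidAlgebra.single h c))
    {f : coxRing k Δ} (hf : f ∈ coxGrading k Δ i) : F f = G f := by
  rw [← AddMonoidAlgebra.sum_coeff_single f, Finsupp.sum, map_sum, map_sum]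
  exact Finset.sum_congr rfl fun h hh => H h _ (hf h hh)

/-- The difference of the values of two retractions depends only on the class in `Pic(X_Δ)`. -/
lemma LinearRetraction.sub_eq {k : Type u} [Field k] {σ τ : Δ.cones} (R : LinearRetraction σ)
    (R' : LinearRetraction τ)
    {h h' : SupportFunction Δ} (hd : picClass k Δ h = picClass k Δ h') :
    R.toHom h - R'.toHom h = R.toHom h' - R'.toHom h' := by
  obtain ⟨m, hm⟩ := (picClass_eq_zero_iff k (h - h')).1 (by rw [map_sub, hd, sub_self])
  have h1 := R.apply_linearSF m
  have h2 := R'.apply_linearSF m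
  rw [hm, map_sub] at h1 h2
  rw [sub_eq_sub_iff_sub_eq_sub, h1, h2]

variable [Module.Free ℤ N] [Module.Finite ℤ N] {σ : Δ.cones} (R : LinearRetraction σ)
  (k : Type u) [Field k]

/-- The restriction of `C^∨ ∩ SF(N, Δ)` to `σ`. -/
def LinearRetraction.monoidHom : coxMonoid Δ →+ coneMonoid σ.1 where
  toFun h := ⟨R.toHom h.1, nonneg_of_rays (fun ρ _ => mem_coxMonoid_iff.1 h.2 ρ) (R.represents h)⟩
  map_zero' := Subtype.ext (map_zero R.toHom)
  map_add' a b := Subtype.ext (map_add R.toHom a.1 b.1)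

/-- The dehomogenization `S → k[σ_M]`, `χ(h) ↦ χ(r(h))`. It identifies the homogeneous elements of a
given degree with elements of `k[σ_M]`. -/
def LinearRetraction.dehom : coxRing k Δ →+* SemigroupRing k (coneMonoid σ.1) :=
  AddMonoidAlgebra.mapDomainRingHom k R.monoidHom

@[simp] lemma LinearRetraction.dehom_single (h : coxMonoid Δ) (c : k) :
    R.dehom k (AddMonoidAlgebra.single h c) = AddMonoidAlgebra.single (R.monoidHom h) c := by
  simp [dehom]

lemma LinearRetraction.dehom_chi (h : coxMonoid Δ) :
    R.dehom k (chi k h) = chi k (R.monoidHom h) := R.dehom_single k h 1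

lemma LinearRetraction.dehom_algebraMap (c : k) :
    R.dehom k (algebraMap k _ c) = algebraMap k _ c :=
  (R.dehom_single k 0 c).trans (by rw [map_zero]; rfl)

/-- On homogeneous elements of a fixed degree, the dehomogenizations with respect to two cones
differ by a character, which is a unit on the chart of the smaller cone. -/
lemma LinearRetraction.exists_unit_dehom {τ : Δ.cones} (R' : LinearRetraction τ) (hle : τ.1 ≤ σ.1)
    (i : Pic (toricVariety k Δ)) :
    ∃ m : DualLattice N, ∃ hm : VanishesOn m τ.1, ∀ f ∈ coxGrading k Δ i,
      ringIncl k (dualMonoid_anti (charPairing N) hle) (R.dehom k f) =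
        chi k (⟨m, hm.mem⟩ : coneMonoid τ.1) * R'.dehom k f := by
  by_cases hi : ∃ h : coxMonoid Δ, picClass k Δ h.1 = i
  · obtain ⟨h₀, hh₀⟩ := hi
    have hm : VanishesOn (R.toHom h₀ - R'.toHom h₀) τ.1 := fun v hv => by
      have h1 := R.represents h₀ ⟨v, τ.1, τ.2, hv⟩ (hle hv)
      have h2 := R'.represents h₀ ⟨v, τ.1, τ.2, hv⟩ hv
      rw [map_sub, LinearMap.sub_apply, ← h1, ← h2, sub_self]
    refine ⟨_, hm, fun f hf => ?_⟩
    refine homogeneous_hom_ext k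
      (F := ((ringIncl k (dualMonoid_anti (charPairing N) hle)).comp (R.dehom k)).toAddMonoidHom)
      (G := (AddMonoidHom.mulLeft (chi k _)).comp (R'.dehom k).toAddMonoidHom) ?_ hf
    intro h c hh
    change ringIncl k _ (R.dehom k _) = chi k _ * R'.dehom k _
    rw [dehom_single, dehom_single, ringIncl_single, chi, AddMonoidAlgebra.single_mul_single,
      one_mul]
    congr 1
    refine Subtype.ext ?_
    change R.toHom h = R.toHom h₀ - R'.toHom h₀ + R'.toHom h
    rw [← sub_eq R R' (hh.trans hh₀.symm), sub_add_cancel]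
  · -- there are no monomials, hence no nonzero elements, of degree `i`
    refine ⟨0, fun v _ => by simp, fun f hf => ?_⟩
    refine homogeneous_hom_ext k
      (F := ((ringIncl k (dualMonoid_anti (charPairing N) hle)).comp (R.dehom k)).toAddMonoidHom)
      (G := (AddMonoidHom.mulLeft (chi k _)).comp (R'.dehom k).toAddMonoidHom) ?_ hf
    exact fun h c hh => (hi ⟨h, hh⟩).elim

/-- Distinct monomials of the same degree restrict to distinct characters, so dehomogenization is
injective on homogeneous elements. -/
lemma LinearRetraction.dehom_injOn {i : Pic (toricVariety k Δ)} {f : coxRing k Δ}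
    (hf : f ∈ coxGrading k Δ i) (h0 : R.dehom k f = 0) : f = 0 := by
  have hinj : Set.InjOn R.monoidHom (f.coeff.support : Set (coxMonoid Δ)) := by
    intro h hh h' hh' heq
    have heq : R.toHom h.1 = R.toHom h'.1 := congrArg Subtype.val heq
    obtain ⟨m, hm⟩ := (picClass_eq_zero_iff k (h.1 - h'.1)).1 (by
      rw [map_sub]
      exact sub_eq_zero.2 ((hf h hh).trans (hf h' hh').symm))
    have hm0 : m = 0 := by rw [← R.apply_linearSF m, hm, map_sub, heq, sub_self]
    rw [hm0, map_zero] at hm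
    exact Subtype.ext (sub_eq_zero.1 hm.symm)
  by_contra hne
  obtain ⟨h, hh⟩ := Finsupp.support_nonempty_iff.2 (AddMonoidAlgebra.coeff_eq_zero.not.2 hne)
  have h1 : Finsupp.mapDomain R.monoidHom f.coeff (R.monoidHom h) = f.coeff h :=
    Finsupp.mapDomain_apply' _ f.coeff subset_rfl hinj hh
  have h2 : (R.dehom k f).coeff (R.monoidHom h) = f.coeff h := h1
  rw [h0] at h2
  exact Finsupp.mem_support_iff.1 hh h2.symm

/-- Homogenization: after multiplication with a power of `χ(η)` every element of `k[σ_M]` comes from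
a homogeneous element. -/
lemma LinearRetraction.exists_homogenization {η : SupportFunction Δ} (hη : IsSeparating σ η)
    (a : SemigroupRing k (coneMonoid σ.1)) :
    ∃ (n : ℕ), ∃ f ∈ coxGrading k Δ (picClass k Δ (n • η)),
      R.dehom k f = a * R.dehom k (chi k ⟨η, hη.mem⟩) ^ n := by
  induction a using AddMonoidAlgebra.induction_linear with
  | zero => exact ⟨0, 0, zero_mem _, by simp⟩
  | add a b ha hb =>
    obtain ⟨n, f, hf, hfa⟩ := ha
    obtain ⟨n', f', hf', hfb⟩ := hb
    refine ⟨n + n', f * chi k ⟨η, hη.mem⟩ ^ n' + f' * chi k ⟨η, hη.mem⟩ ^ n, ?_, ?_⟩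
    · refine add_mem (mul_chi_pow_mem_coxGrading k ⟨η, hη.mem⟩ hf) ?_
      rw [add_comm n n']
      exact mul_chi_pow_mem_coxGrading k ⟨η, hη.mem⟩ hf'
    · rw [map_add, map_mul, map_mul, map_pow, map_pow, hfa, hfb]
      ring
  | single m c =>
    have hmem : linearSF Δ m.1 ∈ dualMonoid (sfPairing Δ) (hatCone Δ σ) :=
      mem_hatMonoid_iff.2 fun ρ hρ => m.2 _ (hρ ρ.genPt_mem)
    obtain ⟨n, hn⟩ := hη.exists_add_nsmul_mem hmem
    refine ⟨n, AddMonoidAlgebra.single ⟨_, hn⟩ c, ?_, ?_⟩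
    · refine single_mem_coxGrading ?_ c
      rw [map_add, (picClass_eq_zero_iff k _).2 ⟨m.1, rfl⟩, zero_add]
    · rw [dehom_chi, ← chi_nsmul, dehom_single, chi, AddMonoidAlgebra.single_mul_single, mul_one]
      congr 1
      refine Subtype.ext ?_
      change R.toHom (linearSF Δ m.1 + n • η) = m.1 + n • R.toHom η
      rw [map_add, map_nsmul, R.apply_linearSF]

/-- `χ(η)` is invertible on `U_σ`. -/
lemma LinearRetraction.isUnit_dehom_chi {η : SupportFunction Δ} (hη : IsSeparating σ η) :
    IsUnit (R.dehom k (chi k ⟨η, hη.mem⟩)) := by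
  rw [dehom_chi]
  refine VanishesOn.isUnit_chi k (m := R.toHom η) (σ := σ.1) fun v hv => le_antisymm ?_ ?_
  · have h1 : -R.toHom η ∈ coneMonoid σ.1 := mem_coneMonoid_of_rays σ fun ρ hρ => by
      have := (R.represents η).gen hρ
      rw [hη.eq_zero ρ hρ] at this
      rw [LinearMap.neg_apply, show R.toHom η ρ.gen = 0 by exact_mod_cast this.symm, neg_zero]
    have := h1 v hv
    rw [map_neg, LinearMap.neg_apply] at this
    linarith
  · exact (R.monoidHom ⟨η, hη.mem⟩).2 v hv

end Dehomogenization

/-! ### Homogeneous primes and points of the charts -/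

section HomogeneousPrimes

/-- A free abelian group carries a translation invariant linear order (the lexicographic order with
respect to an ordered basis). -/
lemma exists_isOrderedCancelAddMonoid (P : Type u) [AddCommGroup P] [Module.Free ℤ P] :
    ∃ _ : LinearOrder P, IsOrderedCancelAddMonoid P := by
  let l : LinearOrder (Module.Free.ChooseBasisIndex ℤ P) := IsWellOrder.linearOrder WellOrderingRel
  let b := Module.Free.chooseBasis ℤ P
  let f : P → Lex (Module.Free.ChooseBasisIndex ℤ P →₀ ℤ) := fun x => toLex (b.repr x)
  have hf : Function.Injective f := toLex.injective.comp b.repr.injective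
  let o : LinearOrder P := LinearOrder.lift' f hf
  have hle : ∀ x y : P, x ≤ y ↔ f x ≤ f y := fun _ _ => Iff.rfl
  have hadd : ∀ x y : P, f (x + y) = f x + f y := fun x y => by
    change toLex (b.repr (x + y)) = _
    rw [map_add]
    rfl
  refine ⟨o, ?_⟩
  have : IsOrderedAddMonoid P := ⟨fun x y h z => by
    rw [hle, hadd, hadd]
    exact add_le_add_left ((hle _ _).1 h) _, fun x y h z => by
    rw [hle, hadd, hadd]
    exact add_le_add_right ((hle _ _).1 h) _⟩
  infer_instance

/-- For a grading by a free abelian group the homogeneous core of a prime ideal is prime, because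
the group can be ordered. -/
lemma isPrime_homogeneousCore {P K A : Type u} [AddCommGroup P] [Module.Free ℤ P]
    [inst : DecidableEq P] [CommRing K] [CommRing A] [Algebra K A] (𝒜 : P → Submodule K A)
    [GradedAlgebra 𝒜] {I : Ideal A} (hI : I.IsPrime) :
    (I.homogeneousCore 𝒜).toIdeal.IsPrime := by
  obtain ⟨o, ho⟩ := exists_isOrderedCancelAddMonoid P
  obtain rfl : inst = o.toDecidableEq := Subsingleton.elim _ _
  exact hI.homogeneousCore

lemma isHomogeneous_eq_of_mem_iff {P K A : Type u} [AddCommGroup P]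
    [DecidableEq P] [CommRing K] [CommRing A] [Algebra K A] {𝒜 : P → Submodule K A}
    [GradedAlgebra 𝒜] {I J : Ideal A} (hI : I.IsHomogeneous 𝒜) (hJ : J.IsHomogeneous 𝒜)
    (h : ∀ i, ∀ f ∈ 𝒜 i, f ∈ I ↔ f ∈ J) : I = J := by
  ext f
  rw [hI.mem_iff, hJ.mem_iff]
  exact forall_congr' fun i => h i _ (SetLike.coe_mem _)

end HomogeneousPrimes

section ChartPoints

open scoped Classical

lemma chi_mem_coxGrading {N : Type u} [AddCommGroup N] (k : Type u) [Field k] {Δ : Fan N}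
    (h : coxMonoid Δ) : chi k h ∈ coxGrading k Δ (picClass k Δ h.1) :=
  single_mem_coxGrading rfl 1

variable {N : Type u} [AddCommGroup N] (k : Type u) [Field k] (Δ : Fan N)

/-- The underlying space of the toric Proj. -/
abbrev CoxSpace : Type u := TProjSpace (coxGrading k Δ) (irrelevantIdeal k Δ)

variable {Δ} in
lemma coxSpace_ext {p p' : CoxSpace k Δ}
    (h : ∀ i, ∀ f ∈ coxGrading k Δ i, f ∈ p.1.asIdeal ↔ f ∈ p'.1.asIdeal) : p = p' :=
  Subtype.ext (PrimeSpectrum.ext (isHomogeneous_eq_of_mem_iff p.2.1 p'.2.1 h))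

variable {Δ} [Module.Free ℤ N] [Module.Finite ℤ N] [Module.Free ℤ (Pic (toricVariety k Δ))]
  {σ : Δ.cones} (R : LinearRetraction σ) {η : SupportFunction Δ} (hη : IsSeparating σ η)

/-- The homogeneous prime of `S` corresponding to a point `q` of `U_σ`: it is spanned by the
homogeneous elements whose dehomogenization lies in `q`. -/
def chartPoint (q : PrimeSpectrum (SemigroupRing k (coneMonoid σ.1))) : CoxSpace k Δ :=
  ⟨⟨((q.asIdeal.comap (R.dehom k)).homogeneousCore (coxGrading k Δ)).toIdeal,
    isPrime_homogeneousCore _ (Ideal.IsPrime.comap _ (hK := q.isPrime))⟩,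
    HomogeneousIdeal.isHomogeneous _, fun hle => by
      have h1 := ((hη.irrelevantPart_le_iff k ⟨_, _⟩).1 ((le_iSup _ σ).trans hle))
      have h2 : R.dehom k (chi k ⟨η, hη.mem⟩) ∈ q.asIdeal :=
        Ideal.toIdeal_homogeneousCore_le (coxGrading k Δ) (q.asIdeal.comap (R.dehom k)) h1
      exact (q.isPrime).ne_top
        (Ideal.eq_top_of_isUnit_mem _ h2 (R.isUnit_dehom_chi k hη))⟩

lemma mem_chartPoint_iff (q : PrimeSpectrum (SemigroupRing k (coneMonoid σ.1)))
    {i : Pic (toricVariety k Δ)} {f : coxRing k Δ} (hf : f ∈ coxGrading k Δ i) :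
    f ∈ (chartPoint k R hη q).1.asIdeal ↔ R.dehom k f ∈ q.asIdeal :=
  ⟨fun h => Ideal.toIdeal_homogeneousCore_le (coxGrading k Δ) (q.asIdeal.comap (R.dehom k)) h,
    fun h => Ideal.mem_homogeneousCore_of_homogeneous_of_mem ⟨i, hf⟩ h⟩

lemma chi_notMem_chartPoint (q : PrimeSpectrum (SemigroupRing k (coneMonoid σ.1))) :
    chi k (⟨η, hη.mem⟩ : coxMonoid Δ) ∉ (chartPoint k R hη q).1.asIdeal := by
  rw [mem_chartPoint_iff k R hη q (chi_mem_coxGrading k _)]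
  exact fun h => (q.isPrime).ne_top
    (Ideal.eq_top_of_isUnit_mem _ h (R.isUnit_dehom_chi k hη))

/-- The maps `U_σ → Tproj(S)` are compatible with the inclusions of charts. -/
lemma chartPoint_chartIncl {τ : Δ.cones} (R' : LinearRetraction τ) {η' : SupportFunction Δ}
    (hη' : IsSeparating τ η') (hle : τ.1 ≤ σ.1)
    (q : PrimeSpectrum (SemigroupRing k (coneMonoid τ.1))) :
    chartPoint k R hη
      (PrimeSpectrum.comap (ringIncl k (dualMonoid_anti (charPairing N) hle)) q) =
        chartPoint k R' hη' q := by
  refine coxSpace_ext k fun i f hf => ?_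
  rw [mem_chartPoint_iff k R hη _ hf, mem_chartPoint_iff k R' hη' _ hf]
  obtain ⟨m, hm, H⟩ := R.exists_unit_dehom k R' hle i
  have h1 : R.dehom k f ∈ (PrimeSpectrum.comap
      (ringIncl k (dualMonoid_anti (charPairing N) hle)) q).asIdeal ↔
      ringIncl k (dualMonoid_anti (charPairing N) hle) (R.dehom k f) ∈ q.asIdeal :=
    Iff.rfl
  rw [h1, H f hf, Ideal.unit_mul_mem_iff_mem _ (hm.isUnit_chi k)]

lemma mem_iff_of_dehom_eq (q : PrimeSpectrum (SemigroupRing k (coneMonoid σ.1))) {n : ℕ}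
    {f : coxRing k Δ} {a : SemigroupRing k (coneMonoid σ.1)}
    (hf : f ∈ coxGrading k Δ (picClass k Δ (n • η)))
    (hfa : R.dehom k f = a * R.dehom k (chi k ⟨η, hη.mem⟩) ^ n) :
    f ∈ (chartPoint k R hη q).1.asIdeal ↔ a ∈ q.asIdeal := by
  rw [mem_chartPoint_iff k R hη q hf, hfa,
    Ideal.mul_unit_mem_iff_mem _ ((R.isUnit_dehom_chi k hη).pow n)]

lemma chartPoint_injective : Function.Injective (chartPoint k R hη) := by
  intro q q' h
  refine PrimeSpectrum.ext (Ideal.ext fun a => ?_)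
  obtain ⟨n, f, hf, hfa⟩ := R.exists_homogenization k hη a
  rw [← mem_iff_of_dehom_eq k R hη q hf hfa, ← mem_iff_of_dehom_eq k R hη q' hf hfa, h]

lemma continuous_chartPoint : Continuous (chartPoint k R hη) := by
  refine continuous_induced_rng.2
    ((PrimeSpectrum.isTopologicalBasis_basic_opens.continuous_iff).2 ?_)
  rintro _ ⟨f, rfl⟩
  have : (Subtype.val ∘ chartPoint k R hη) ⁻¹' (PrimeSpectrum.basicOpen f : Set _) =
      ⋃ i, (PrimeSpectrum.basicOpen (R.dehom k
        (DirectSum.decompose (coxGrading k Δ) f i : coxRing k Δ)) : Set (PrimeSpectrum _)) := by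
    ext q
    rw [Set.mem_iUnion]
    change f ∉ (chartPoint k R hη q).1.asIdeal ↔ ∃ i, _ ∉ q.asIdeal
    rw [(chartPoint k R hη q).2.1.mem_iff, not_forall]
    exact exists_congr fun i => not_congr (mem_chartPoint_iff k R hη q (SetLike.coe_mem _))
  rw [this]
  exact isOpen_iUnion fun i => (PrimeSpectrum.basicOpen _).isOpen

/-- The homogeneous primes not containing `χ(η)` are the points of `U_σ`. -/
lemma exists_chartPoint_eq (p : CoxSpace k Δ)
    (hp : chi k (⟨η, hη.mem⟩ : coxMonoid Δ) ∉ p.1.asIdeal) : ∃ q, chartPoint k R hη q = p := by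
  have hmem : p.1 ∈ hatChart k Δ σ := by
    rw [hη.hatChart_eq k]
    exact hp
  obtain ⟨Q, hQ⟩ := hmem
  -- pulling back along `k[σ_M] → k[σ̂^∨ ∩ SF(N, Δ)]` gives the required point of `U_σ`
  let ι : SemigroupRing k (coneMonoid σ.1) →+*
      SemigroupRing k (dualMonoid (sfPairing Δ) (hatCone Δ σ)) :=
    AddMonoidAlgebra.mapDomainRingHom k
      ({ toFun := fun m => ⟨linearSF Δ m.1, mem_hatMonoid_iff.2 fun ρ hρ =>
          m.2 _ (hρ ρ.genPt_mem)⟩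
         map_zero' := Subtype.ext (map_zero (linearSF Δ))
         map_add' := fun a b => Subtype.ext (map_add (linearSF Δ) a.1 b.1) } :
        coneMonoid σ.1 →+ dualMonoid (sfPairing Δ) (hatCone Δ σ))
  have hι : ∀ m c, ι (AddMonoidAlgebra.single m c) = AddMonoidAlgebra.single
      (⟨linearSF Δ m.1, mem_hatMonoid_iff.2 fun ρ hρ => m.2 _ (hρ ρ.genPt_mem)⟩ :
        dualMonoid (sfPairing Δ) (hatCone Δ σ)) c := fun m c => by
    simp [ι]
  refine ⟨PrimeSpectrum.comap ι Q, coxSpace_ext k fun i f hf => ?_⟩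
  rw [mem_chartPoint_iff k R hη _ hf, ← hQ]
  change ι (R.dehom k f) ∈ Q.asIdeal ↔
    ringIncl k (dualMonoid_anti (sfPairing Δ) (hatCone_le Δ σ)) f ∈ Q.asIdeal
  -- on `U_σ̂`, a homogeneous element and its dehomogenization differ by an invertible character
  suffices H : ∃ u, IsUnit u ∧ ι (R.dehom k f) =
      u * ringIncl k (dualMonoid_anti (sfPairing Δ) (hatCone_le Δ σ)) f by
    obtain ⟨u, hu, H⟩ := H
    rw [H, Ideal.unit_mul_mem_iff_mem _ hu]
  by_cases hi : ∃ h : coxMonoid Δ, picClass k Δ h.1 = i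
  · obtain ⟨h₀, hh₀⟩ := hi
    have hz : ∀ ρ : Δ.Ray, ρ.IsRayOf σ →
        (linearSF Δ (R.toHom h₀) - h₀.1).1 ρ.genPt = 0 := fun ρ hρ => by
      change charPairing N (R.toHom h₀) ρ.genPt - h₀.1.1 ρ.genPt = 0
      rw [R.represents h₀.1 ρ.genPt (hρ ρ.genPt_mem), sub_self]
    let g : dualMonoid (sfPairing Δ) (hatCone Δ σ) :=
      ⟨linearSF Δ (R.toHom h₀) - h₀.1, mem_hatMonoid_iff.2 fun ρ hρ => (hz ρ hρ).ge⟩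
    refine ⟨chi k g, IsUnit.of_mul_eq_one (chi k ⟨-g.1, neg_mem_hatMonoid hz⟩) ?_, ?_⟩
    · rw [← chi_add, ← chi_zero]
      congr 1
      exact Subtype.ext (add_neg_cancel g.1)
    refine homogeneous_hom_ext k (F := (ι.comp (R.dehom k)).toAddMonoidHom)
      (G := (AddMonoidHom.mulLeft (chi k g)).comp
        (ringIncl k (dualMonoid_anti (sfPairing Δ) (hatCone_le Δ σ))).toAddMonoidHom) ?_ hf
    intro h c hh
    change ι (R.dehom k _) = chi k g * ringIncl k _ _
    rw [R.dehom_single, hι, ringIncl_single, chi, AddMonoidAlgebra.single_mul_single, one_mul]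
    congr 1
    refine Subtype.ext ?_
    change linearSF Δ (R.toHom h) = linearSF Δ (R.toHom h₀) - h₀.1 + h.1
    obtain ⟨m, hm⟩ := (picClass_eq_zero_iff k (h.1 - h₀.1)).1 (by
      rw [map_sub]
      exact sub_eq_zero.2 (hh.trans hh₀.symm))
    have h1 := R.apply_linearSF m
    rw [hm, map_sub] at h1
    rw [← h1, map_sub] at hm
    rw [sub_add_eq_add_sub, eq_sub_iff_add_eq, ← sub_eq_sub_iff_add_eq_add]
    exact sub_eq_sub_iff_sub_eq_sub.2 hm
  · refine ⟨1, isUnit_one, ?_⟩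
    rw [one_mul]
    exact homogeneous_hom_ext k (F := (ι.comp (R.dehom k)).toAddMonoidHom)
      (G := (ringIncl k (dualMonoid_anti (sfPairing Δ) (hatCone_le Δ σ))).toAddMonoidHom)
      (fun h c hh => (hi ⟨h, hh⟩).elim) hf

lemma isOpenMap_chartPoint : IsOpenMap (chartPoint k R hη) := by
  refine PrimeSpectrum.isTopologicalBasis_basic_opens.isOpenMap_iff.2 ?_
  rintro _ ⟨a, rfl⟩
  obtain ⟨n, f, hf, hfa⟩ := R.exists_homogenization k hη a
  have : chartPoint k R hη '' (PrimeSpectrum.basicOpen a : Set _) = Subtype.val ⁻¹'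
      (PrimeSpectrum.basicOpen (f * chi k (⟨η, hη.mem⟩ : coxMonoid Δ)) :
        Set (PrimeSpectrum (coxRing k Δ))) := by
    rw [PrimeSpectrum.basicOpen_mul]
    ext p
    constructor
    · rintro ⟨q, hq, rfl⟩
      exact ⟨(mem_iff_of_dehom_eq k R hη q hf hfa).not.2 hq, chi_notMem_chartPoint k R hη q⟩
    · rintro ⟨h1, h2⟩
      obtain ⟨q, rfl⟩ := exists_chartPoint_eq k R hη p h2
      exact ⟨q, (mem_iff_of_dehom_eq k R hη q hf hfa).not.1 h1, rfl⟩
  rw [this]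
  exact (PrimeSpectrum.basicOpen _).isOpen.preimage continuous_subtype_val

/-- If the homogeneous prime of a point of `U_σ` does not contain `χ(η')`, where `η'` is separating
for `τ`, then the point lies in `U_τ`: the face of `σ` on which `η'` vanishes lies in `τ`. -/
lemma mem_opensRange_of_chi_notMem {τ : Δ.cones} {η' : SupportFunction Δ}
    (hη' : IsSeparating τ η') (q : PrimeSpectrum (SemigroupRing k (coneMonoid σ.1)))
    (hq : chi k (⟨η', hη'.mem⟩ : coxMonoid Δ) ∉ (chartPoint k R hη q).1.asIdeal) :
    chartMap k Δ σ q ∈ (chartMap k Δ τ).opensRange := by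
  rw [mem_chartPoint_iff k R hη q (chi_mem_coxGrading k (⟨η', hη'.mem⟩ : coxMonoid Δ)),
    R.dehom_chi] at hq
  have hu : R.toHom η' ∈ coneMonoid σ.1 := (R.monoidHom ⟨η', hη'.mem⟩).2
  let F : Δ.cones := ⟨faceOf σ.1 (R.toHom η'), Δ.faceOf_mem σ.2 hu⟩
  have hFσ : F.1 ≤ σ.1 := faceOf_le _ _
  obtain ⟨w, hw, hwF⟩ := (Δ.inter_isFace F.1 F.2 τ.1 τ.2).1
  -- the rays of `F` are rays of `τ`, so the form `w` cutting out `F ∩ τ` from `F` vanishes on `F`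
  have hrays : ∀ ρ : Δ.Ray, ρ.IsRayOf F → w ρ.gen = 0 := by
    intro ρ hρ
    have h0 := (mem_faceOf.1 (hρ ρ.genPt_mem)).2
    have h1 : η'.1 ρ.genPt = 0 := by
      rw [(R.represents η').gen (hρ.trans hFσ), ← charPairing_latticePt]
      exact h0
    have h2 : ρ.IsRayOf τ := by
      by_contra hn
      exact (hη'.pos ρ hn).ne' h1
    have h3 := ((hwF _).1 ⟨hρ ρ.genPt_mem, h2 ρ.genPt_mem⟩).2
    rw [charPairing_latticePt] at h3
    exact_mod_cast h3
  have hneg : -w ∈ coneMonoid F.1 := mem_coneMonoid_of_rays F fun ρ hρ => by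
    rw [LinearMap.neg_apply, hrays ρ hρ, neg_zero]
  have hFτ : F.1 ≤ τ.1 := fun v hv => by
    refine ((hwF v).2 ⟨hv, le_antisymm ?_ (hw v hv)⟩).2
    have := hneg v hv
    rw [map_neg, LinearMap.neg_apply] at this
    linarith
  have hr : q ∈ Set.range ((chartFunctor k Δ).map (homOfLE hFσ : F ⟶ σ)) := by
    rw [range_chartFunctor_map k Δ (homOfLE hFσ : F ⟶ σ) hu fun _ => Iff.rfl]
    exact hq
  obtain ⟨z, hz⟩ := hr
  have hz : chartIncl k hFσ z = q := hz
  have h1 : chartMap k Δ σ (chartIncl k hFσ z) = chartMap k Δ τ (chartIncl k hFτ z) := by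
    have e1 : (chartIncl k hFσ ≫ chartMap k Δ σ) z = (chartIncl k hFτ ≫ chartMap k Δ τ) z := by
      rw [chart_w k Δ hFσ, chart_w k Δ hFτ]
    exact e1
  rw [← hz, h1]
  exact ⟨_, rfl⟩

end ChartPoints

/-! ### The homeomorphism between the toric variety and the toric Proj -/

section PointMap

open scoped Classical

variable {N : Type u} [AddCommGroup N] [Module.Free ℤ N] [Module.Finite ℤ N] (k : Type u) [Field k]
  {Δ : Fan N} [Module.Free ℤ (Pic (toricVariety k Δ))]
  (R : ∀ σ : Δ.cones, LinearRetraction σ) {η : Δ.cones → SupportFunction Δ}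
  (hη : ∀ σ, IsSeparating σ (η σ))

/-- The map `X_Δ → Tproj(S)` glued from the maps `U_σ → Tproj(S)`. -/
def pointMap (x : toricVariety k Δ) : CoxSpace k Δ :=
  chartPoint k (R (exists_chart k Δ x).choose) (hη _) (exists_chart k Δ x).choose_spec.choose

lemma pointMap_chartMap (σ : Δ.cones) (q : PrimeSpectrum (SemigroupRing k (coneMonoid σ.1))) :
    pointMap k R hη (chartMap k Δ σ q) = chartPoint k (R σ) (hη σ) q := by
  have h1 := (exists_chart k Δ (chartMap k Δ σ q)).choose_spec.choose_spec
  generalize (exists_chart k Δ (chartMap k Δ σ q)).choose_spec.choose = q' at h1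
  obtain ⟨ρ, h2, h3, z, hz⟩ := exists_chart_le k Δ
    (exists_chart k Δ (chartMap k Δ σ q)).choose_spec
    (⟨q, rfl⟩ : chartMap k Δ σ q ∈ (chartMap k Δ σ).opensRange)
  have key : ∀ (τ : Δ.cones) (hle : ρ.1 ≤ τ.1)
      (y : PrimeSpectrum (SemigroupRing k (coneMonoid τ.1))),
      chartMap k Δ τ y = chartMap k Δ σ q →
      chartPoint k (R τ) (hη τ) y = chartPoint k (R ρ) (hη ρ) z := by
    intro τ hle y hy
    have h4 : chartIncl k hle z = y := by
      apply (chartMap k Δ τ).isOpenEmbedding.injective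
      rw [hy, ← hz, ← chart_w k Δ hle]
      rfl
    rw [← h4]
    exact chartPoint_chartIncl k (R τ) (hη τ) (R ρ) (hη ρ) hle z
  exact (key _ h2 _ (exists_chart k Δ (chartMap k Δ σ q)).choose_spec.choose_spec).trans
    (key σ h3 q rfl).symm

lemma isHomeomorph_pointMap : IsHomeomorph (pointMap k R hη) where
  continuous := by
    refine continuous_iff_continuousAt.2 fun x => ?_
    obtain ⟨σ, q, rfl⟩ := exists_chart k Δ x
    refine (chartMap k Δ σ).isOpenEmbedding.continuousAt_iff.1 ?_
    have : pointMap k R hη ∘ chartMap k Δ σ = chartPoint k (R σ) (hη σ) :=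
      funext (pointMap_chartMap k R hη σ)
    rw [this]
    exact (continuous_chartPoint k (R σ) (hη σ)).continuousAt
  isOpenMap := by
    intro U hU
    have : pointMap k R hη '' U =
        ⋃ σ, chartPoint k (R σ) (hη σ) '' (chartMap k Δ σ ⁻¹' U) := by
      ext p
      simp only [Set.mem_iUnion]
      constructor
      · rintro ⟨x, hx, rfl⟩
        obtain ⟨σ, q, rfl⟩ := exists_chart k Δ x
        exact ⟨σ, q, hx, (pointMap_chartMap k R hη σ q).symm⟩
      · rintro ⟨σ, q, hq, rfl⟩
        exact ⟨_, hq, pointMap_chartMap k R hη σ q⟩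
    rw [this]
    exact isOpen_iUnion fun σ => isOpenMap_chartPoint k (R σ) (hη σ) _
      (hU.preimage (chartMap k Δ σ).continuous)
  bijective := by
    constructor
    · intro x y hxy
      obtain ⟨σ, q, rfl⟩ := exists_chart k Δ x
      obtain ⟨τ, q', rfl⟩ := exists_chart k Δ y
      have h1 := hxy
      rw [pointMap_chartMap k R hη σ q, pointMap_chartMap k R hη τ q'] at h1
      have h2 := chi_notMem_chartPoint k (R τ) (hη τ) q'
      rw [← h1] at h2
      obtain ⟨z, hz⟩ := mem_opensRange_of_chi_notMem k (R σ) (hη σ) (hη τ) q h2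
      rw [← hz, pointMap_chartMap k R hη τ z, pointMap_chartMap k R hη τ q'] at hxy
      rw [← hz, chartPoint_injective k (R τ) (hη τ) hxy]
    · intro p
      have hp := p.2.2
      rw [irrelevantIdeal_le_iff k hη, not_forall] at hp
      obtain ⟨σ, hσ⟩ := hp
      obtain ⟨q, hq⟩ := exists_chartPoint_eq k (R σ) (hη σ) p hσ
      exact ⟨chartMap k Δ σ q, (pointMap_chartMap k R hη σ q).trans hq⟩

end PointMap

/-! ### Degree zero fractions as elements of a field -/

section Fractions

variable {ι A K : Type u} [AddCommGroup ι] [DecidableEq ι] [CommRing A] [IsDomain A] [Field K]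
  {k : Type u} [CommRing k] [Algebra k A] (𝒜 : ι → Submodule k A) [GradedAlgebra 𝒜]
  (F : A →+* K) (hF : ∀ i, ∀ f ∈ 𝒜 i, F f = 0 → f = 0)

/-- The value `F(f) / F(g)` of a degree zero fraction `f / g` under a ring homomorphism `F` to a
field which is injective on homogeneous elements. -/
def fractionValue (p : Ideal A) [p.IsPrime] : HomogeneousLocalization.AtPrime 𝒜 p →+* K :=
  have hden : ∀ c : HomogeneousLocalization.NumDenSameDeg 𝒜 p.primeCompl, F c.den ≠ 0 :=
    fun c h0 => c.den_mem (by
      rw [hF _ _ c.den.2 h0]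
      exact p.zero_mem)
  { toFun := fun z => Quotient.liftOn' z (fun c => F c.num / F c.den) (by
      intro c d hcd
      have h1 : Localization.mk _ _ = Localization.mk _ _ := hcd
      rw [Localization.mk_eq_mk_iff, Localization.r_iff_exists] at h1
      obtain ⟨e, he⟩ := h1
      have he0 : (e : A) ≠ 0 := fun h => e.2 (by rw [h]; exact p.zero_mem)
      have h2 := congrArg F (mul_left_cancel₀ he0 he)
      rw [map_mul, map_mul] at h2
      rw [div_eq_div_iff (hden c) (hden d), mul_comm, h2, mul_comm])
    map_one' := by
      change F 1 / F 1 = 1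
      rw [map_one, div_one]
    map_zero' := by
      change F 0 / F 1 = 0
      rw [map_zero, zero_div]
    map_mul' := fun x y => by
      obtain ⟨c, rfl⟩ := HomogeneousLocalization.mk_surjective x
      obtain ⟨d, rfl⟩ := HomogeneousLocalization.mk_surjective y
      change F (c.num * d.num) / F (c.den * d.den) = F c.num / F c.den * (F d.num / F d.den)
      rw [map_mul, map_mul, mul_div_mul_comm]
    map_add' := fun x y => by
      obtain ⟨c, rfl⟩ := HomogeneousLocalization.mk_surjective x
      obtain ⟨d, rfl⟩ := HomogeneousLocalization.mk_surjective y
      change F (c.den * d.num + d.den * c.num) / F (c.den * d.den) =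
        F c.num / F c.den + F d.num / F d.den
      have h1 := hden c
      have h2 := hden d
      rw [map_add, map_mul, map_mul, map_mul]
      field_simp
      ring }

lemma fractionValue_mk (p : Ideal A) [p.IsPrime]
    (c : HomogeneousLocalization.NumDenSameDeg 𝒜 p.primeCompl) :
    fractionValue 𝒜 F hF p (HomogeneousLocalization.mk c) = F c.num / F c.den := rfl

lemma fractionValue_injective (p : Ideal A) [p.IsPrime] :
    Function.Injective (fractionValue 𝒜 F hF p) := by
  refine (injective_iff_map_eq_zero _).2 fun x hx => ?_
  obtain ⟨c, rfl⟩ := HomogeneousLocalization.mk_surjective x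
  rw [fractionValue_mk, div_eq_zero_iff] at hx
  have h0 : (c.num : A) = 0 := hx.elim (hF _ _ c.num.2) fun h => (c.den_mem (by
    rw [hF _ _ c.den.2 h]
    exact p.zero_mem)).elim
  apply HomogeneousLocalization.val_injective
  rw [HomogeneousLocalization.val_mk, HomogeneousLocalization.val_zero, h0, Localization.mk_zero]

end Fractions

/-! ### Comparison of the local rings -/

section LocalRings

open scoped Classical

variable {N : Type u} [AddCommGroup N] [Module.Free ℤ N] [Module.Finite ℤ N] (k : Type u) [Field k]
  {Δ : Fan N}

/-- The homomorphism from `S` to the function field of `X_Δ` obtained by dehomogenization on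
the torus. -/
def toFunctionField (R₀ : LinearRetraction (zeroCone Δ)) :
    coxRing k Δ →+* (toricVariety k Δ).functionField :=
  (chartToFunctionField k Δ (zeroCone Δ)).comp (R₀.dehom k)

lemma toFunctionField_eq_zero (R₀ : LinearRetraction (zeroCone Δ)) (i : Pic (toricVariety k Δ))
    (f : coxRing k Δ) (hf : f ∈ coxGrading k Δ i) (h : toFunctionField k R₀ f = 0) : f = 0 :=
  R₀.dehom_injOn k hf ((injective_iff_map_eq_zero _).1
    (chartToFunctionField_injective k Δ (zeroCone Δ)) _ h)

/-- The value in the function field of `X_Δ` of an element of `S_(p)`. -/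
def coxValue (R₀ : LinearRetraction (zeroCone Δ)) (p : CoxSpace k Δ) :
    p.Stalk →+* (toricVariety k Δ).functionField :=
  fractionValue (coxGrading k Δ) (toFunctionField k R₀) (toFunctionField_eq_zero k R₀) p.1.asIdeal

/-- In each degree, dehomogenization on `U_σ` and on the torus differ by a nonzero factor. -/
lemma exists_unit_toFunctionField (R₀ : LinearRetraction (zeroCone Δ)) {σ : Δ.cones}
    (R : LinearRetraction σ) (i : Pic (toricVariety k Δ)) :
    ∃ u : (toricVariety k Δ).functionField, u ≠ 0 ∧ ∀ f ∈ coxGrading k Δ i,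
      chartToFunctionField k Δ σ (R.dehom k f) = u * toFunctionField k R₀ f := by
  obtain ⟨m, hm, H⟩ := R.exists_unit_dehom k R₀ (zeroCone_le σ) i
  refine ⟨chartToFunctionField k Δ (zeroCone Δ) (chi k ⟨m, hm.mem⟩),
    ((hm.isUnit_chi k).map _).ne_zero, fun f hf => ?_⟩
  rw [← chartToFunctionField_comp k Δ (zeroCone_le σ), RingHom.comp_apply, H f hf, map_mul]
  rfl

lemma coxValue_mk (R₀ : LinearRetraction (zeroCone Δ)) (p : CoxSpace k Δ)
    (c : HomogeneousLocalization.NumDenSameDeg (coxGrading k Δ) p.1.asIdeal.primeCompl) :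
    coxValue k R₀ p (HomogeneousLocalization.mk c) =
      toFunctionField k R₀ c.num / toFunctionField k R₀ c.den := rfl

lemma toFunctionField_ne_zero (R₀ : LinearRetraction (zeroCone Δ)) (p : CoxSpace k Δ)
    {i : Pic (toricVariety k Δ)} {g : coxRing k Δ} (hg : g ∈ coxGrading k Δ i)
    (hgp : g ∉ p.1.asIdeal) : toFunctionField k R₀ g ≠ 0 := fun h0 => hgp (by
  rw [toFunctionField_eq_zero k R₀ i g hg h0]
  exact p.1.asIdeal.zero_mem)

/-- The value at `p` of a fraction `f / g` is computed by the dehomogenizations of `f` and `g` on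
any chart. -/
lemma toFunctionField_div_mul (R₀ : LinearRetraction (zeroCone Δ)) {σ : Δ.cones}
    (R : LinearRetraction σ) (p : CoxSpace k Δ) {i : Pic (toricVariety k Δ)} {f g : coxRing k Δ}
    (hf : f ∈ coxGrading k Δ i) (hg : g ∈ coxGrading k Δ i) (hgp : g ∉ p.1.asIdeal) :
    toFunctionField k R₀ f / toFunctionField k R₀ g * chartToFunctionField k Δ σ (R.dehom k g) =
      chartToFunctionField k Δ σ (R.dehom k f) := by
  obtain ⟨u, -, H⟩ := exists_unit_toFunctionField k R₀ R i
  have hd := toFunctionField_ne_zero k R₀ p hg hgp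
  have h1 := H f hf
  have h2 := H g hg
  generalize chartToFunctionField k Δ σ (R.dehom k f) = x at h1 ⊢
  generalize chartToFunctionField k Δ σ (R.dehom k g) = y at h2 ⊢
  generalize toFunctionField k R₀ f = z at h1 ⊢
  generalize toFunctionField k R₀ g = w at h2 hd ⊢
  rw [h1, h2]
  field_simp

lemma toFunctionField_dehom_ne_zero (R₀ : LinearRetraction (zeroCone Δ)) {σ : Δ.cones}
    (R : LinearRetraction σ) (p : CoxSpace k Δ) {i : Pic (toricVariety k Δ)} {g : coxRing k Δ}
    (hg : g ∈ coxGrading k Δ i) (hgp : g ∉ p.1.asIdeal) :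
    chartToFunctionField k Δ σ (R.dehom k g) ≠ 0 := by
  obtain ⟨u, hu, H⟩ := exists_unit_toFunctionField k R₀ R i
  rw [H g hg]
  exact mul_ne_zero hu (toFunctionField_ne_zero k R₀ p hg hgp)

/-- Two regular functions on `U_σ` can be homogenized to the same degree, a multiple of `[D_η]`. -/
lemma LinearRetraction.exists_homogenization_pair {σ : Δ.cones} (R : LinearRetraction σ)
    {η : SupportFunction Δ} (hη : IsSeparating σ η) (a b : SemigroupRing k (coneMonoid σ.1)) :
    ∃ n : ℕ, ∃ f ∈ coxGrading k Δ (picClass k Δ (n • η)),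
      ∃ g ∈ coxGrading k Δ (picClass k Δ (n • η)),
      R.dehom k f = a * R.dehom k (chi k (⟨η, hη.mem⟩ : coxMonoid Δ)) ^ n ∧
      R.dehom k g = b * R.dehom k (chi k (⟨η, hη.mem⟩ : coxMonoid Δ)) ^ n := by
  obtain ⟨n, f, hf, hfa⟩ := R.exists_homogenization k hη a
  obtain ⟨n', g, hg, hgb⟩ := R.exists_homogenization k hη b
  have hf' := mul_chi_pow_mem_coxGrading k ⟨η, hη.mem⟩ (n := n') hf
  have hg' := mul_chi_pow_mem_coxGrading k ⟨η, hη.mem⟩ (n := n) hg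
  rw [add_comm n' n] at hg'
  refine ⟨n + n', _, hf', _, hg', ?_, ?_⟩
  · rw [map_mul, hfa, map_pow, mul_assoc, ← pow_add]
  · rw [map_mul, hgb, map_pow, mul_assoc, ← pow_add, add_comm n' n]

variable [Module.Free ℤ (Pic (toricVariety k Δ))]

lemma coxValue_mem_localSubring (R₀ : LinearRetraction (zeroCone Δ)) {σ : Δ.cones}
    (R : LinearRetraction σ) {η : SupportFunction Δ} (hη : IsSeparating σ η)
    (q : PrimeSpectrum (SemigroupRing k (coneMonoid σ.1))) (x : (chartPoint k R hη q).Stalk) :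
    coxValue k R₀ (chartPoint k R hη q) x ∈
      localSubring (toricVariety k Δ) (chartMap k Δ σ q) := by
  obtain ⟨c, rfl⟩ := HomogeneousLocalization.mk_surjective x
  rw [mem_localSubring_iff k Δ σ q]
  exact ⟨R.dehom k c.num, R.dehom k c.den,
    (mem_chartPoint_iff k R hη q c.den.2).not.1 c.den_mem,
    toFunctionField_div_mul k R₀ R _ c.num.2 c.den.2 c.den_mem⟩

lemma exists_coxValue_eq (R₀ : LinearRetraction (zeroCone Δ)) {σ : Δ.cones}
    (R : LinearRetraction σ) {η : SupportFunction Δ} (hη : IsSeparating σ η)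
    (q : PrimeSpectrum (SemigroupRing k (coneMonoid σ.1)))
    {z : (toricVariety k Δ).functionField}
    (hz : z ∈ localSubring (toricVariety k Δ) (chartMap k Δ σ q)) :
    ∃ x, coxValue k R₀ (chartPoint k R hη q) x = z := by
  obtain ⟨a, b, hb, hab⟩ := (mem_localSubring_iff k Δ σ q z).1 hz
  obtain ⟨n, f, hf, g, hg, hfa, hgb⟩ := R.exists_homogenization_pair k hη a b
  have hgp : g ∉ (chartPoint k R hη q).1.asIdeal :=
    (mem_iff_of_dehom_eq k R hη q hg hgb).not.2 hb
  refine ⟨HomogeneousLocalization.mk ⟨_, ⟨f, hf⟩, ⟨g, hg⟩, hgp⟩, ?_⟩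
  rw [coxValue_mk]
  have key := toFunctionField_div_mul k R₀ R (chartPoint k R hη q) hf hg hgp
  have hw := toFunctionField_dehom_ne_zero k R₀ R (chartPoint k R hη q) hg hgp
  refine mul_right_cancel₀ hw (key.trans ?_)
  rw [hfa, hgb, map_mul, map_mul, ← mul_assoc, hab]

/-- At corresponding points, the local rings of `X_Δ` and of the toric Proj agree as subrings of the
function field. -/
lemma range_coxValue (R₀ : LinearRetraction (zeroCone Δ)) {σ : Δ.cones} (R : LinearRetraction σ)
    {η : SupportFunction Δ} (hη : IsSeparating σ η)
    (q : PrimeSpectrum (SemigroupRing k (coneMonoid σ.1))) :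
    (coxValue k R₀ (chartPoint k R hη q)).range =
      localSubring (toricVariety k Δ) (chartMap k Δ σ q) := by
  ext z
  constructor
  · rintro ⟨x, rfl⟩
    exact coxValue_mem_localSubring k R₀ R hη q x
  · exact exists_coxValue_eq k R₀ R hη q

end LocalRings

/-! ### Sections as functions with values in the function field -/

section Values

/-- The function `f : U → K` is locally constant, with `f(x) ∈ L_x` for all `x ∈ U`. -/
def IsLocallyConstantIn {X K : Type*} [TopologicalSpace X] [Ring K] (L : X → Subring K)
    (U : Opens X) (f : U → K) : Prop :=
  ∀ x : U, ∃ V : Opens X, x.1 ∈ V ∧ ∃ z, ∀ y : U, y.1 ∈ V → f y = z ∧ z ∈ L y.1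

variable (X : Scheme.{u}) [IsIntegral X]

lemma algebraMap_stalk_injective (x : X) :
    Function.Injective (algebraMap (X.presheaf.stalk x) X.functionField) :=
  IsFractionRing.injective _ _

/-- A section `t` of `O_X` as the function assigning to `x` the germ `t_x`, seen in the function
field. -/
def regularValues (U : X.Opens) : Γ(X, U) →+* (U → X.functionField) :=
  RingHom.pi fun x => (algebraMap (X.presheaf.stalk x.1) X.functionField).comp
    (X.presheaf.germ U x.1 x.2).hom

lemma regularValues_apply (U : X.Opens) (t : Γ(X, U)) (x : U) :
    regularValues X U t x = algebraMap (X.presheaf.stalk x.1) X.functionField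
      (X.presheaf.germ U x.1 x.2 t) := rfl

lemma regularValues_eq (U : X.Opens) [Nonempty U] (t : Γ(X, U)) (x : U) :
    regularValues X U t x = X.germToFunctionField U t :=
  Scheme.algebraMap_germ_eq_germToFunctionField X x.2 t

lemma regularValues_res {U V : X.Opens} (i : V ⟶ U) (t : Γ(X, U)) (x : V) :
    regularValues X V (X.presheaf.map i.op t) x = regularValues X U t ⟨x.1, i.le x.2⟩ :=
  congrArg _ (TopCat.Presheaf.germ_res_apply X.presheaf i x.1 x.2 t)

lemma regularValues_injective (U : X.Opens) : Function.Injective (regularValues X U) := by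
  intro s t h
  exact TopCat.Presheaf.section_ext X.sheaf U s t fun x hx =>
    algebraMap_stalk_injective X x (congrFun h ⟨x, hx⟩)

/-- The sheaf `O_X` consists of the locally constant functions with values in the local rings. -/
lemma mem_range_regularValues (U : X.Opens) (f : U → X.functionField) :
    f ∈ (regularValues X U).range ↔ IsLocallyConstantIn (localSubring X) U f := by
  constructor
  · rintro ⟨t, rfl⟩ x
    have : Nonempty U := ⟨⟨x.1, x.2⟩⟩
    refine ⟨U, x.2, X.germToFunctionField U t, fun y hy => ⟨regularValues_eq X U t y, ?_⟩⟩
    rw [← regularValues_eq X U t y]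
    exact ⟨_, rfl⟩
  · intro hf
    choose V hxV z hz using hf
    have h1 : ∀ x : U, ∃ W ≤ U ⊓ V x, ∃ (_ : x.1 ∈ W) (s : Γ(X, W)),
        ∀ y : W, regularValues X W s y = z x := by
      intro x
      obtain ⟨t, ht⟩ := (hz x x (hxV x)).2
      obtain ⟨W, hW, m, s, hs⟩ := X.presheaf.exists_le_germ_eq t
        (V := U ⊓ V x) ⟨x.2, hxV x⟩
      have : Nonempty W := ⟨⟨x.1, m⟩⟩
      refine ⟨W, hW, m, s, fun y => ?_⟩
      rw [regularValues_eq, ← regularValues_eq X W s ⟨x.1, m⟩, regularValues_apply]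
      exact (congrArg _ hs).trans ht
    choose W hW hm s hs using h1
    have hfW : ∀ (x : U) (y : X) (hy : y ∈ W x), f ⟨y, (hW x hy).1⟩ = z x :=
      fun x y hy => (hz x ⟨y, (hW x hy).1⟩ (hW x hy).2).1
    obtain ⟨t, ht, -⟩ := X.sheaf.existsUnique_gluing' W U
      (fun x => homOfLE ((hW x).trans inf_le_left))
      (fun x hx => Opens.mem_iSup.2 ⟨⟨x, hx⟩, hm _⟩) s (by
        intro x x'
        refine regularValues_injective X _ (funext fun y => ?_)
        refine (regularValues_res X _ (s x) y).trans
          (Eq.trans ?_ (regularValues_res X _ (s x') y).symm)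
        rw [hs, hs, ← hfW x y.1 y.2.1, ← hfW x' y.1 y.2.2])
    refine ⟨t, funext fun x => ?_⟩
    have h2 := regularValues_res X (homOfLE ((hW x).trans inf_le_left)) t ⟨x.1, hm x⟩
    have h3 : X.presheaf.map (homOfLE ((hW x).trans inf_le_left)).op t = s x := ht x
    rw [h3, hs] at h2
    exact h2.symm.trans (hfW x x.1 (hm x)).symm

variable {ι A K : Type u} [AddCommGroup ι] [DecidableEq ι] [CommRing A] [IsDomain A] [Field K]
  {k : Type u} [CommRing k] [Algebra k A] (𝒜 : ι → Submodule k A) [GradedAlgebra 𝒜] (B : Ideal A)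
  (F : A →+* K) (hF : ∀ i, ∀ f ∈ 𝒜 i, F f = 0 → f = 0)

/-- A section of the structure sheaf of the toric Proj as a function with values in a field, by
means of `fractionValue`. -/
def fractionValues (U : Opens (TopCat.of (TProjSpace 𝒜 B))) :
    sectionsSubring 𝒜 B U →+* (U → K) :=
  RingHom.pi fun p => (fractionValue 𝒜 F hF p.1.1.asIdeal).comp
    ((Pi.evalRingHom (fun p : U => TProjSpace.Stalk p.1) p).comp (sectionsSubring 𝒜 B U).subtype)

lemma fractionValues_injective (U : Opens (TopCat.of (TProjSpace 𝒜 B))) :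
    Function.Injective (fractionValues 𝒜 B F hF U) := fun _ _ h =>
  Subtype.ext (funext fun p => fractionValue_injective 𝒜 F hF _ (congrFun h p))

/-- The structure sheaf of the toric Proj consists of the locally constant functions with values in
the rings `S_(p)`. -/
lemma mem_range_fractionValues (U : Opens (TopCat.of (TProjSpace 𝒜 B)))
    (f : U → K) :
    f ∈ (fractionValues 𝒜 B F hF U).range ↔
      IsLocallyConstantIn (fun p : TProjSpace 𝒜 B => (fractionValue 𝒜 F hF p.1.asIdeal).range)
        U f := by
  constructor
  · rintro ⟨s, rfl⟩ p
    obtain ⟨V, hpV, i, j, a, b, hb, h⟩ := s.2 p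
    refine ⟨V, hpV, F a / F b, fun q hq => ?_⟩
    have h1 : fractionValues 𝒜 B F hF U s q = F a / F b :=
      congrArg (fractionValue 𝒜 F hF q.1.1.asIdeal) (h ⟨q.1, hq⟩)
    exact ⟨h1, s.1 q, h1⟩
  · intro hf
    choose V hpV z hz using hf
    have h1 : ∀ p : U, ∃ x, fractionValue 𝒜 F hF p.1.1.asIdeal x = f p := fun p =>
      (hz p p (hpV p)).1 ▸ (hz p p (hpV p)).2
    choose s hs using h1
    refine ⟨⟨s, fun p => ?_⟩, funext hs⟩
    obtain ⟨c, hc⟩ := HomogeneousLocalization.mk_surjective (s p)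
    let D : Opens (TopCat.of (TProjSpace 𝒜 B)) := ⟨{q | c.den.1 ∉ q.1.asIdeal},
      (PrimeSpectrum.basicOpen c.den.1).2.preimage continuous_subtype_val⟩
    refine ⟨U ⊓ V p ⊓ D, ⟨⟨p.2, hpV p⟩, c.den_mem⟩,
      homOfLE (inf_le_left.trans inf_le_left), c.deg, c.num, c.den, fun q => q.2.2, fun q => ?_⟩
    refine fractionValue_injective 𝒜 F hF _ ((hs ⟨q.1, q.2.1.1⟩).trans ?_)
    rw [(hz p ⟨q.1, q.2.1.1⟩ q.2.1.2).1, ← (hz p p (hpV p)).1, ← hs p, ← hc, fractionValue_mk,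
      fractionValue_mk]

end Values

/-! ### The isomorphism of ringed spaces -/

section Comparison

/-- Two subrings of the same ring with equal images are isomorphic over this ring. -/
lemma exists_ringEquiv_of_range_eq {A B C : Type*} [Ring A] [Ring B] [Ring C] (f : A →+* C)
    (g : B →+* C) (hf : Function.Injective f) (hg : Function.Injective g)
    (h : f.range = g.range) : ∃ e : A ≃+* B, ∀ a, g (e a) = f a := by
  let e₁ : A ≃+* f.range := RingEquiv.ofBijective f.rangeRestrict
    ⟨fun _ _ hab => hf (congrArg Subtype.val hab), f.rangeRestrict_surjective⟩
  let e₂ : B ≃+* g.range := RingEquiv.ofBijective g.rangeRestrict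
    ⟨fun _ _ hab => hg (congrArg Subtype.val hab), g.rangeRestrict_surjective⟩
  let e₃ : f.range ≃+* g.range := RingEquiv.subringCongr h
  refine ⟨(e₁.trans e₃).trans e₂.symm, fun a => ?_⟩
  exact congrArg Subtype.val (e₂.apply_symm_apply (e₃ (e₁ a)))

variable {ι A : Type u} [AddCommGroup ι] [DecidableEq ι] [CommRing A] [IsDomain A]
  {k : Type u} [CommRing k] [Algebra k A] (𝒜 : ι → Submodule k A) [GradedAlgebra 𝒜] (B : Ideal A)
  (X : Scheme.{u}) [IsIntegral X] (F : A →+* X.functionField)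
  (hF : ∀ i, ∀ f ∈ 𝒜 i, F f = 0 → f = 0) (φ : X ≃ₜ TProjSpace 𝒜 B)

/-- The preimage `φ⁻¹(U)`. -/
def preimageOpens {X Y : Type*} [TopologicalSpace X] [TopologicalSpace Y] (φ : X ≃ₜ Y)
    (U : Opens Y) : Opens X := ⟨φ ⁻¹' U, U.2.preimage φ.continuous⟩

/-- `fractionValues`, followed by pulling back functions along `φ`. -/
def pulledBackValues (U : Opens (TopCat.of (TProjSpace 𝒜 B))) :
    sectionsSubring 𝒜 B U →+*
      (preimageOpens φ U → X.functionField) :=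
  RingHom.pi fun x => (Pi.evalRingHom (fun _ : U => (X.functionField : Type u))
    ⟨φ x.1, x.2⟩).comp (fractionValues 𝒜 B F hF U)

lemma pulledBackValues_apply (U : Opens (TopCat.of (TProjSpace 𝒜 B))) (s : sectionsSubring 𝒜 B U)
    (x : preimageOpens φ U) :
    pulledBackValues 𝒜 B X F hF φ U s x = fractionValues 𝒜 B F hF U s ⟨φ x.1, x.2⟩ := rfl

lemma pulledBackValues_injective (U : Opens (TopCat.of (TProjSpace 𝒜 B))) :
    Function.Injective (pulledBackValues 𝒜 B X F hF φ U) := by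
  intro s t h
  refine fractionValues_injective 𝒜 B F hF U (funext fun p => ?_)
  obtain ⟨p, hp⟩ := p
  obtain ⟨x, rfl⟩ := φ.surjective p
  exact congrFun h ⟨x, hp⟩

lemma range_pulledBackValues
    (hφ : ∀ x, (fractionValue 𝒜 F hF (φ x).1.asIdeal).range = localSubring X x)
    (U : Opens (TopCat.of (TProjSpace 𝒜 B))) :
    (pulledBackValues 𝒜 B X F hF φ U).range =
      (regularValues X (preimageOpens φ U)).range := by
  ext f
  rw [mem_range_regularValues]
  constructor
  · rintro ⟨s, rfl⟩ x
    obtain ⟨V, hxV, z, hz⟩ :=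
      (mem_range_fractionValues 𝒜 B F hF U _).1 ⟨s, rfl⟩ ⟨φ x.1, x.2⟩
    refine ⟨preimageOpens φ V, hxV, z, fun y hy => ?_⟩
    rw [← hφ]
    exact hz ⟨φ y.1, y.2⟩ hy
  · intro hf
    have hU : ∀ p : U, φ.symm p.1 ∈ preimageOpens φ U := fun p => by
      change φ (φ.symm p.1) ∈ U
      rw [φ.apply_symm_apply]
      exact p.2
    obtain ⟨s, hs⟩ := (mem_range_fractionValues 𝒜 B F hF U
      (fun p => f ⟨φ.symm p.1, hU p⟩)).2 (by
        intro p
        obtain ⟨V, hxV, z, hz⟩ := hf ⟨φ.symm p.1, hU p⟩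
        refine ⟨preimageOpens φ.symm V, hxV, z, fun q hq => ?_⟩
        have h1 := hz ⟨φ.symm q.1, hU q⟩ hq
        rwa [← hφ, φ.apply_symm_apply] at h1)
    refine ⟨s, funext fun x => ?_⟩
    rw [pulledBackValues_apply, hs]
    exact congrArg f (Subtype.ext (φ.symm_apply_apply x.1))

lemma fractionValue_constants (c : k) (p : (⊤ : Opens (TopCat.of (TProjSpace 𝒜 B)))) :
    fractionValues 𝒜 B F hF ⊤ (TProj.constants 𝒜 B c) p = F (algebraMap k A c) := by
  change F (algebraMap k A c) / F 1 = _
  rw [map_one, div_one]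

/-- If the homeomorphism `φ` identifies the local rings of `X` and of the toric Proj, as subrings of
the function field, then `φ` underlies an isomorphism of ringed spaces. It respects the constants
as soon as their values in the function field agree. -/
lemma exists_sheafedSpaceIso
    (hφ : ∀ x, (fractionValue 𝒜 F hF (φ x).1.asIdeal).range = localSubring X x)
    (κ : CommRingCat.of k ⟶ SheafedSpace.Γ.obj (op X.toSheafedSpace))
    (hκ : ∀ c x, regularValues X ⊤ (κ c) x = F (algebraMap k A c)) :
    ∃ e : X.toSheafedSpace ≅ TProj 𝒜 B,
      TProj.constants 𝒜 B ≫ SheafedSpace.Γ.map e.hom.op = κ := by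
  choose e he using fun U => exists_ringEquiv_of_range_eq _ _
    (pulledBackValues_injective 𝒜 B X F hF φ U) (regularValues_injective X _)
    (range_pulledBackValues 𝒜 B X F hF φ hφ U)
  let α : (TProj 𝒜 B).presheaf ≅ (TopCat.isoOfHomeo φ).hom _* X.presheaf :=
    NatIso.ofComponents (fun U => (e U.unop).toCommRingCatIso) (by
      intro U V i
      refine CommRingCat.hom_ext (RingHom.ext fun s => ?_)
      refine regularValues_injective X _ ?_
      refine (he V.unop _).trans (funext fun x => Eq.symm ?_)
      refine (regularValues_res X ((Opens.map (TopCat.isoOfHomeo φ).hom).map i.unop)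
        (e U.unop s) x).trans ?_
      exact congrFun (he U.unop s) _)
  refine ⟨SheafedSpace.isoMk (PresheafedSpace.isoOfComponents (TopCat.isoOfHomeo φ) α.symm),
    CommRingCat.hom_ext (RingHom.ext fun c => regularValues_injective X _ (funext fun x => ?_))⟩
  refine (congrFun (he ⊤ (TProj.constants 𝒜 B c)) x).trans (Eq.trans ?_ (hκ c x).symm)
  exact fractionValue_constants 𝒜 B X F hF c ⟨φ x.1, trivial⟩

end Comparison

/-! ### Constants -/

section Constants

variable {N : Type u} [AddCommGroup N] (k : Type u) [Field k] (Δ : Fan N)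

/-- The structure morphism `X_Δ → Spec k` is given on `U_σ` by the inclusion `k → k[σ_M]`. -/
lemma toricConstants_res (σ : Δ.cones) :
    toricConstants k Δ ≫ (toricVariety k Δ).presheaf.map
      (homOfLE le_top : chartMap k Δ σ ''ᵁ ⊤ ⟶ ⊤).op =
    CommRingCat.ofHom (algebraMap k (SemigroupRing k (coneMonoid σ.1))) ≫ chartSections k Δ σ := by
  have h1 : CommRingCat.ofHom (algebraMap k (SemigroupRing k (coneMonoid σ.1))) ≫
      (Scheme.ΓSpecIso _).inv = (Scheme.ΓSpecIso _).inv ≫ (Spec.map (CommRingCat.ofHom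
        (algebraMap k (SemigroupRing k (coneMonoid σ.1))))).appTop :=
    Scheme.ΓSpecIso_inv_naturality _
  have h2 : Spec.map (CommRingCat.ofHom (algebraMap k (SemigroupRing k (coneMonoid σ.1)))) =
      chartMap k Δ σ ≫ toricStructure k Δ := by
    unfold chartMap toricStructure
    refine Eq.symm ?_
    exact Limits.colimit.ι_desc _ _
  have h3 : (chartMap k Δ σ).appTop ≫ ((chartMap k Δ σ).appIso ⊤).inv =
      (toricVariety k Δ).presheaf.map (homOfLE le_top : chartMap k Δ σ ''ᵁ ⊤ ⟶ ⊤).op := by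
    have e : (⊤ : (affineChart k σ.1).Opens) ≤ chartMap k Δ σ ⁻¹ᵁ ⊤ := le_rfl
    have h4 : (chartMap k Δ σ).appTop = (chartMap k Δ σ).appLE ⊤ ⊤ e :=
      (Scheme.Hom.appLE_eq_app _).symm
    rw [h4]
    exact Scheme.Hom.appLE_appIso_inv (chartMap k Δ σ) _
  change ((Scheme.ΓSpecIso (CommRingCat.of k)).inv ≫ (toricStructure k Δ).appTop) ≫
    (toricVariety k Δ).presheaf.map (homOfLE le_top : chartMap k Δ σ ''ᵁ ⊤ ⟶ ⊤).op = _
  unfold chartSections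
  rw [reassoc_of% h1, h2, Scheme.Hom.comp_appTop, Category.assoc, Category.assoc, h3]

lemma regularValues_eq_of_res (σ : Δ.cones) (t : Γ(toricVariety k Δ, ⊤))
    (a : SemigroupRing k (coneMonoid σ.1))
    (h : (toricVariety k Δ).presheaf.map (homOfLE le_top : chartMap k Δ σ ''ᵁ ⊤ ⟶ ⊤).op t =
      chartSections k Δ σ a) (x : (⊤ : (toricVariety k Δ).Opens)) :
    regularValues (toricVariety k Δ) ⊤ t x = chartToFunctionField k Δ σ a := by
  have : Nonempty (⊤ : (toricVariety k Δ).Opens) := ⟨x⟩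
  let q : affineChart k σ.1 := Nonempty.some inferInstance
  have h1 := regularValues_res (toricVariety k Δ)
    (homOfLE le_top : chartMap k Δ σ ''ᵁ ⊤ ⟶ ⊤) t ⟨chartMap k Δ σ q, chart_mem k Δ σ q⟩
  rw [h] at h1
  refine (regularValues_eq (toricVariety k Δ) ⊤ t x).trans
    ((regularValues_eq (toricVariety k Δ) ⊤ t _).symm.trans (h1.symm.trans ?_))
  exact algebraMap_germ_chartSections k Δ σ q a

lemma regularValues_toricConstants (c : k) (x : (⊤ : (toricVariety k Δ).Opens)) :
    regularValues (toricVariety k Δ) ⊤ (toricConstants k Δ c) x =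
      chartToFunctionField k Δ (zeroCone Δ) (algebraMap k _ c) :=
  regularValues_eq_of_res k Δ (zeroCone Δ) _ _
    congr($(toricConstants_res k Δ (zeroCone Δ)) c) x

variable {Δ} [Module.Free ℤ N] [Module.Finite ℤ N]

lemma toFunctionField_algebraMap (R₀ : LinearRetraction (zeroCone Δ)) (c : k) :
    toFunctionField k R₀ (algebraMap k _ c) =
      chartToFunctionField k Δ (zeroCone Δ) (algebraMap k _ c) :=
  congrArg (chartToFunctionField k Δ (zeroCone Δ)) (R₀.dehom_algebraMap k c)

end Constants

/-! ### The toric Proj of the homogeneous coordinate ring -/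

section Isomorphism

open scoped Classical

variable {N : Type u} [AddCommGroup N] [Module.Free ℤ N] [Module.Finite ℤ N] (k : Type u) [Field k]
  {Δ : Fan N} [Module.Free ℤ (Pic (toricVariety k Δ))]

lemma range_fractionValue_pointMap (R : ∀ σ : Δ.cones, LinearRetraction σ)
    {η : Δ.cones → SupportFunction Δ} (hη : ∀ σ, IsSeparating σ (η σ)) (x : toricVariety k Δ) :
    (fractionValue (coxGrading k Δ) (toFunctionField k (R (zeroCone Δ)))
      (toFunctionField_eq_zero k (R (zeroCone Δ))) (pointMap k R hη x).1.asIdeal).range =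
        localSubring (toricVariety k Δ) x := by
  obtain ⟨σ, q, rfl⟩ := exists_chart k Δ x
  have h := range_coxValue k (R (zeroCone Δ)) (R σ) (hη σ) q
  rw [← pointMap_chartMap k R hη σ q] at h
  exact h

lemma exists_toricProjIso (R : ∀ σ : Δ.cones, LinearRetraction σ)
    {η : Δ.cones → SupportFunction Δ} (hη : ∀ σ, IsSeparating σ (η σ)) :
    ∃ e : (toricVariety k Δ).toSheafedSpace ≅ toricProj k Δ,
      toricProjConstants k Δ ≫ SheafedSpace.Γ.map e.hom.op = toricConstants k Δ :=
  exists_sheafedSpaceIso (coxGrading k Δ)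
    (irrelevantIdeal k Δ) (toricVariety k Δ) (toFunctionField k (R (zeroCone Δ)))
    (toFunctionField_eq_zero k (R (zeroCone Δ)))
    ((isHomeomorph_pointMap k R hη).homeomorph (pointMap k R hη))
    (range_fractionValue_pointMap k R hη) (toricConstants k Δ) fun c x =>
      (regularValues_toricConstants k Δ c x).trans
        (toFunctionField_algebraMap k (R (zeroCone Δ)) c).symm

end Isomorphism

end Toric

end

/-- The toric Proj of the homogeneous coordinate ring of a toric variety `X_Δ` with enough invariant
Cartier divisors and free Picard group is a scheme, isomorphic over `k` to `X_Δ`. -/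
theorem mainTheorem1 {k : Type u} [Field k] [IsAlgClosed k]
    {N : Type u} [AddCommGroup N] [Module.Free ℤ N] [Module.Finite ℤ N]
    (Δ : Toric.Fan N) (hspan : Δ.SpansSpace)
    (henough : Toric.HasEnoughInvariantCartierDivisors k Δ)
    (hfree : Module.Free ℤ (Toric.Pic (Toric.toricVariety k Δ))) :
    ∃ (Y : Scheme.{u}) (i : Toric.toricProj k Δ ≅ Y.toSheafedSpace)
      (f : Y ≅ Toric.toricVariety k Δ),
      Toric.toricConstants k Δ ≫
          SheafedSpace.Γ.map (i.hom ≫ f.hom.toShHom).op =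
        Toric.toricProjConstants k Δ := by
  classical
  have R : ∀ σ, Toric.LinearRetraction σ := fun σ =>
    (Toric.nonempty_linearRetraction hspan hfree σ).some
  choose η hη₀ hη₁ using fun σ => Toric.exists_supportFunction k henough σ
  have hη : ∀ σ, Toric.IsSeparating σ (η σ) := fun σ => ⟨hη₀ σ, hη₁ σ⟩
  obtain ⟨e, he⟩ := Toric.exists_toricProjIso k R hη
  refine ⟨Toric.toricVariety k Δ, e.symm, Iso.refl _, ?_⟩
  have h1 : e.symm.hom ≫ (Iso.refl (Toric.toricVariety k Δ)).hom.toShHom = e.inv :=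
    Category.comp_id _
  rw [h1, ← he, Category.assoc, ← Functor.map_comp, ← op_comp, e.inv_hom_id, op_id,
    CategoryTheory.Functor.map_id, Category.comp_id]
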